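/- For $S\subseteq\mathbb{R}^2$ let $RCH(S)=\bigcap_{i=1}^4 M_i(S)$, where $M_i(S)=\bigcup_{p\in S}\overline{Q_i(p)}$ and $Q_1(p),\dots,Q_4(p)$ are the four open axis-parallel quadrants with apex $p$; this is the rectilinear convex hull of $S$. Its area is the Lebesgue measure of its interior. Consider the following problem (MaxAreaRCH): given a set $P$ of $n$ points in the plane in general position (no two points of $P$ have the same $x$-coordinate or the same $y$-coordinate), find a subset $S\subseteq P$ such that the interior of $RCH(S)$ contains no point of $P$ and such that the area of $RCH(S)$ is maximum among all subsets of $P$ with this property. Theorem. The MaxAreaRCH problem can be solved in $O(n^3)$ time and $O(n^2)$ space on a real RAM. That is, there is one program which, for every $n$ and every such $P$ (given as a list of the coordinates of its points, in any order), halts with an optimal set $S$ as its output, after $O(n^3)$ unit-cost steps and using $O(n^2)$ memory cells. The cells hold exact real numbers (with operations $+,-,\times$ and comparison) or natural numbers (with $+$, truncated $-$, $\times$, comparison, and indirect addressing); all natural numbers that occur are $O(n^2)$. -/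

import Mathlib

open Filter Asymptotics

noncomputable section

/-! ### Rectilinear convex hulls -/

namespace Rectilinear

/-- The open axis-aligned quadrants with apex `p`: upper right, upper left, lower left and
lower right. -/
def Q1 (p : ℝ × ℝ) : Set (ℝ × ℝ) := {q | p.1 < q.1 ∧ p.2 < q.2}

def Q2 (p : ℝ × ℝ) : Set (ℝ × ℝ) := {q | q.1 < p.1 ∧ p.2 < q.2}

def Q3 (p : ℝ × ℝ) : Set (ℝ × ℝ) := {q | q.1 < p.1 ∧ q.2 < p.2}

def Q4 (p : ℝ × ℝ) : Set (ℝ × ℝ) := {q | p.1 < q.1 ∧ q.2 < p.2}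

/-- The union of the closures of the quadrants of one kind with apex in `S`. -/
def quadrantUnion (Q : ℝ × ℝ → Set (ℝ × ℝ)) (S : Set (ℝ × ℝ)) : Set (ℝ × ℝ) :=
  ⋃ p ∈ S, closure (Q p)

/-- The rectilinear convex hull. -/
def RCH (S : Set (ℝ × ℝ)) : Set (ℝ × ℝ) :=
  quadrantUnion Q1 S ∩ quadrantUnion Q2 S ∩ quadrantUnion Q3 S ∩ quadrantUnion Q4 S

/-- The area of `RCH S` is the Lebesgue measure of its interior. -/
def areaRCH (S : Set (ℝ × ℝ)) : ENNReal := MeasureTheory.volume (interior (RCH S))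

/-- `S` is a subset of `P` with no point of `P` in the interior of its rectilinear convex hull. -/
def IsEmptyRCH (P S : Set (ℝ × ℝ)) : Prop :=
  S ⊆ P ∧ interior (RCH S) ∩ P = ∅

/-- `S` is a solution of the maximum-area empty rectilinear convex hull problem for `P`. -/
def IsMaxAreaEmptyRCH (P S : Set (ℝ × ℝ)) : Prop :=
  IsEmptyRCH P S ∧ ∀ S', IsEmptyRCH P S' → areaRCH S' ≤ areaRCH S

/-- The points `pt i` have pairwise distinct abscissae and pairwise distinct ordinates. -/
def GeneralPosition {n : ℕ} (pt : Fin n → ℝ × ℝ) : Prop :=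
  Function.Injective (fun i => (pt i).1) ∧ Function.Injective (fun i => (pt i).2)

end Rectilinear

/-! ### A real RAM with unit-cost operations

The memory consists of arrays of natural numbers and arrays of real numbers, named `0, 1, 2, …`;
a scalar variable is an array of which only cell `0` is used. A program mentions finitely many
names. A machine of size `M` has `M` cells in each array, and the natural numbers that it can
store, or form as an intermediate result, are those below `M` (words of `log₂ M` bits). Real
cells hold exact real numbers; the only operations on them are `+`, `-`, `*` and the comparison
`<`. There is no rounding and no conversion between the two kinds of cells, except that a
comparison of reals can direct the flow of control. -/

namespace RealRAM

/-- The contents of the cells: `int a i` and `real a i` are cell `i` of the array named `a`. -/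
structure State where
  int : ℕ → ℕ → ℕ
  real : ℕ → ℕ → ℝ

def State.setInt (σ : State) (a i v : ℕ) : State :=
  { σ with int := fun b j => if b = a ∧ j = i then v else σ.int b j }

def State.setReal (σ : State) (a i : ℕ) (v : ℝ) : State :=
  { σ with real := fun b j => if b = a ∧ j = i then v else σ.real b j }

/-- Integer expressions; `get a i` reads cell `i` of the array `a`. -/
inductive IExp where
  | lit (k : ℕ)
  | get (a : ℕ) (i : IExp)
  | add (e f : IExp)
  | sub (e f : IExp)
  | mul (e f : IExp)

/-- Real expressions. -/
inductive RExp where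
  | lit (k : ℤ)
  | get (a : ℕ) (i : IExp)
  | add (e f : RExp)
  | sub (e f : RExp)
  | mul (e f : RExp)

/-- Tests. -/
inductive BExp where
  | ilt (e f : IExp)
  | ieq (e f : IExp)
  | rlt (e f : RExp)
  | not (b : BExp)
  | and (b c : BExp)

/-- Programs. -/
inductive Stmt where
  | skip
  | setInt (a : ℕ) (i e : IExp)
  | setReal (a : ℕ) (i : IExp) (e : RExp)
  | seq (s t : Stmt)
  | cond (b : BExp) (s t : Stmt)
  | loop (b : BExp) (s : Stmt)

/-- The value of an integer expression (subtraction is truncated at `0`). -/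
def IExp.eval (σ : State) : IExp → ℕ
  | lit k => k
  | get a i => σ.int a (i.eval σ)
  | add e f => e.eval σ + f.eval σ
  | sub e f => e.eval σ - f.eval σ
  | mul e f => e.eval σ * f.eval σ

/-- On a machine of size `M`, the expression is evaluated without overflow: the value of every
subexpression, in particular every address, is below `M`. -/
def IExp.Fits (M : ℕ) (σ : State) : IExp → Prop
  | lit k => k < M
  | get a i => i.Fits M σ ∧ σ.int a (i.eval σ) < M
  | add e f => e.Fits M σ ∧ f.Fits M σ ∧ e.eval σ + f.eval σ < M
  | sub e f => e.Fits M σ ∧ f.Fits M σ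
  | mul e f => e.Fits M σ ∧ f.Fits M σ ∧ e.eval σ * f.eval σ < M

def RExp.eval (σ : State) : RExp → ℝ
  | lit k => k
  | get a i => σ.real a (i.eval σ)
  | add e f => e.eval σ + f.eval σ
  | sub e f => e.eval σ - f.eval σ
  | mul e f => e.eval σ * f.eval σ

def RExp.Fits (M : ℕ) (σ : State) : RExp → Prop
  | lit _ => True
  | get _ i => i.Fits M σ
  | add e f => e.Fits M σ ∧ f.Fits M σ
  | sub e f => e.Fits M σ ∧ f.Fits M σ
  | mul e f => e.Fits M σ ∧ f.Fits M σ

def BExp.Holds (σ : State) : BExp → Prop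
  | ilt e f => e.eval σ < f.eval σ
  | ieq e f => e.eval σ = f.eval σ
  | rlt e f => e.eval σ < f.eval σ
  | not b => ¬ b.Holds σ
  | and b c => b.Holds σ ∧ c.Holds σ

def BExp.Fits (M : ℕ) (σ : State) : BExp → Prop
  | ilt e f => e.Fits M σ ∧ f.Fits M σ
  | ieq e f => e.Fits M σ ∧ f.Fits M σ
  | rlt e f => e.Fits M σ ∧ f.Fits M σ
  | not b => b.Fits M σ
  | and b c => b.Fits M σ ∧ c.Fits M σ

/-- The number of unit-cost operations in the evaluation of an expression: one for each constant,
memory access and arithmetic, comparison or logical operation. -/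
def IExp.cost : IExp → ℕ
  | lit _ => 1
  | get _ i => i.cost + 1
  | add e f => e.cost + f.cost + 1
  | sub e f => e.cost + f.cost + 1
  | mul e f => e.cost + f.cost + 1

def RExp.cost : RExp → ℕ
  | lit _ => 1
  | get _ i => i.cost + 1
  | add e f => e.cost + f.cost + 1
  | sub e f => e.cost + f.cost + 1
  | mul e f => e.cost + f.cost + 1

def BExp.cost : BExp → ℕ
  | ilt e f => e.cost + f.cost + 1
  | ieq e f => e.cost + f.cost + 1
  | rlt e f => e.cost + f.cost + 1
  | not b => b.cost + 1
  | and b c => b.cost + c.cost + 1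

/-- `Exec M s σ σ' t`: on a machine of size `M`, the program `s`, started in the state `σ`, halts
in the state `σ'` after exactly `t` steps, without overflow and without access to a cell outside
the machine. -/
inductive Exec (M : ℕ) : Stmt → State → State → ℕ → Prop
  | skip (σ : State) : Exec M .skip σ σ 1
  | setInt (a : ℕ) (i e : IExp) (σ : State) (hi : i.Fits M σ) (he : e.Fits M σ) :
      Exec M (.setInt a i e) σ (σ.setInt a (i.eval σ) (e.eval σ)) (i.cost + e.cost + 1)
  | setReal (a : ℕ) (i : IExp) (e : RExp) (σ : State) (hi : i.Fits M σ) (he : e.Fits M σ) :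
      Exec M (.setReal a i e) σ (σ.setReal a (i.eval σ) (e.eval σ)) (i.cost + e.cost + 1)
  | seq {s s' : Stmt} {σ σ' σ'' : State} {t t' : ℕ} (h : Exec M s σ σ' t)
      (h' : Exec M s' σ' σ'' t') : Exec M (.seq s s') σ σ'' (t + t')
  | condTrue {b : BExp} {s s' : Stmt} {σ σ' : State} {t : ℕ} (hf : b.Fits M σ) (hb : b.Holds σ)
      (h : Exec M s σ σ' t) : Exec M (.cond b s s') σ σ' (b.cost + 1 + t)
  | condFalse {b : BExp} {s s' : Stmt} {σ σ' : State} {t : ℕ} (hf : b.Fits M σ)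
      (hb : ¬ b.Holds σ) (h : Exec M s' σ σ' t) : Exec M (.cond b s s') σ σ' (b.cost + 1 + t)
  | loopTrue {b : BExp} {s : Stmt} {σ σ' σ'' : State} {t t' : ℕ} (hf : b.Fits M σ)
      (hb : b.Holds σ) (h : Exec M s σ σ' t) (h' : Exec M (.loop b s) σ' σ'' t') :
      Exec M (.loop b s) σ σ'' (b.cost + 1 + t + t')
  | loopFalse {b : BExp} {s : Stmt} {σ : State} (hf : b.Fits M σ) (hb : ¬ b.Holds σ) :
      Exec M (.loop b s) σ σ (b.cost + 1)

/-- The machine is deterministic: final state and number of steps are unique. -/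
theorem Exec.deterministic {M : ℕ} {s : Stmt} {σ σ₁ σ₂ : State} {t₁ t₂ : ℕ}
    (h₁ : Exec M s σ σ₁ t₁) (h₂ : Exec M s σ σ₂ t₂) : σ₁ = σ₂ ∧ t₁ = t₂ := by
  induction h₁ generalizing σ₂ t₂ with
  | skip => cases h₂; exact ⟨rfl, rfl⟩
  | setInt => cases h₂; exact ⟨rfl, rfl⟩
  | setReal => cases h₂; exact ⟨rfl, rfl⟩
  | seq _ _ ih ih' =>
    cases h₂ with
    | seq g g' =>
      obtain ⟨rfl, rfl⟩ := ih g
      obtain ⟨rfl, rfl⟩ := ih' g'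
      exact ⟨rfl, rfl⟩
  | condTrue _ hb _ ih =>
    cases h₂ with
    | condTrue _ _ g => obtain ⟨rfl, rfl⟩ := ih g; exact ⟨rfl, rfl⟩
    | condFalse _ hb' _ => exact absurd hb hb'
  | condFalse _ hb _ ih =>
    cases h₂ with
    | condTrue _ hb' _ => exact absurd hb' hb
    | condFalse _ _ g => obtain ⟨rfl, rfl⟩ := ih g; exact ⟨rfl, rfl⟩
  | loopTrue _ hb _ _ ih ih' =>
    cases h₂ with
    | loopTrue _ _ g g' =>
      obtain ⟨rfl, rfl⟩ := ih g
      obtain ⟨rfl, rfl⟩ := ih' g'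
      exact ⟨rfl, rfl⟩
    | loopFalse _ hb' => exact absurd hb hb'
  | loopFalse _ hb =>
    cases h₂ with
    | loopTrue _ hb' _ _ => exact absurd hb' hb
    | loopFalse => exact ⟨rfl, rfl⟩

/-- All array names that occur are below the width. -/
def IExp.width : IExp → ℕ
  | lit _ => 0
  | get a i => max (a + 1) i.width
  | add e f => max e.width f.width
  | sub e f => max e.width f.width
  | mul e f => max e.width f.width

def RExp.width : RExp → ℕ
  | lit _ => 0
  | get a i => max (a + 1) i.width
  | add e f => max e.width f.width
  | sub e f => max e.width f.width
  | mul e f => max e.width f.width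

def BExp.width : BExp → ℕ
  | ilt e f => max e.width f.width
  | ieq e f => max e.width f.width
  | rlt e f => max e.width f.width
  | not b => b.width
  | and b c => max b.width c.width

def Stmt.width : Stmt → ℕ
  | skip => 0
  | setInt a i e => max (a + 1) (max i.width e.width)
  | setReal a i e => max (a + 1) (max i.width e.width)
  | seq s t => max s.width t.width
  | cond b s t => max b.width (max s.width t.width)
  | loop b s => max b.width s.width

/-- The total number of memory cells available to the program on a machine of size `M`: `M` cells
in each of the `width` integer arrays and in each of the `width` real arrays. -/
def Stmt.space (s : Stmt) (M : ℕ) : ℕ := 2 * s.width * M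

/-- The initial state for the input `pt 0, …, pt (n - 1)`: cell `0` of the integer array `0` holds
`n`, the real arrays `0` and `1` hold the abscissae and the ordinates, everything else is `0`. -/
def input {n : ℕ} (pt : Fin n → ℝ × ℝ) : State where
  int a i := if a = 0 ∧ i = 0 then n else 0
  real a i :=
    if h : i < n then
      if a = 0 then (pt ⟨i, h⟩).1 else if a = 1 then (pt ⟨i, h⟩).2 else 0
    else 0

/-- The output: the input points whose index is marked by a `1` in the integer array `1`. -/
def output {n : ℕ} (pt : Fin n → ℝ × ℝ) (σ : State) : Set (ℝ × ℝ) :=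
  {x | ∃ i : Fin n, pt i = x ∧ σ.int 1 i = 1}

end RealRAM

end

/-! ### Interior of the rectilinear hull -/

noncomputable section

open MeasureTheory Set

namespace Rectilinear

/-! Number the points from left to right. A point is interior to the hull of `S` exactly when each
of its four open quadrants meets `S` (`mem_interior_RCH`). Hence over the slab between two
consecutive abscissae the interior is a product with an open interval. Its top is the smaller of the
two highest ordinates of `S` to the left and to the right of the slab, its bottom the larger of the
two lowest ones. If `a` and `b` are the points of `S` that attain these bounds (`Source`), the slab
contributes its width times `max (Y a - Y b) 0`, and the area is the sum over the slabs
(`areaRCH_eq`, `slab_eq`).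

A sweep over the slabs therefore only has to remember the pair `(a, b)`. A bound `a` behind the
sweep is the highest point chosen so far, and a higher one must still come. A bound `a` ahead is a
promise: it will be chosen, it will be the highest of those still to come, and some point already
chosen exceeds it. At the point `k` a bound either persists or is replaced because `k` is chosen, as
a new record or as a promise now fulfilled. Emptiness is local too: if `k` replaces a bound, nothing
exceeds it on one side, so it is not interior (`Move.not_under`); if both bounds persist, `k` is
interior exactly when it lies strictly between them (`not_under_of_le`, `Source.under_of_keep`).

Correctness has two halves. Soundness (`Good`, `HalfGood`): the value of an entry is the area of
every completion of its prefix that honours the bounds, and no point passed so far is interior.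
Completeness (`Source.exists_prev`, `complete_step`): for every admissible set, the entry at its two
sources has at least its area so far. A hull is finished at its rightmost point and compared with
the best one found before.

Time: a new record `k` may at once be followed by a promise, which would mean about `n` successors
for each of `n ^ 2` entries. But neither the area so far nor emptiness up to `k` depends on that
promise. So the record is first entered with bound `k`, and a second pass turns the entries of row
and column `k` into promises. Each pass costs `O(n ^ 2)`, and there is a constant number of passes
for each of the `n` points.

Space: the chosen sets are linked lists with shared tails. Whenever `k` is added to a nonempty
prefix, it is a bound of the old or of the new entry. It thus suffices to append `k` to the lists in
row and column `k` of the old table, and again of the new one. This creates at most `4 * n` nodes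
per point, plus one for a hull that starts there. -/

theorem exists_pos_mem_of_mem_interior {A : Set (ℝ × ℝ)} {q : ℝ × ℝ} (h : q ∈ interior A)
    (a b : ℝ) : ∃ t > 0, (q.1 + a * t, q.2 + b * t) ∈ A := by
  have hc : Tendsto (fun t : ℝ => (q.1 + a * t, q.2 + b * t)) (nhds 0) (nhds q) := by
    have : Continuous (fun t : ℝ => (q.1 + a * t, q.2 + b * t)) := by fun_prop
    simpa using this.tendsto 0
  have h1 : ∀ᶠ t in nhdsWithin (0 : ℝ) (Ioi 0), (q.1 + a * t, q.2 + b * t) ∈ A :=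
    (hc.eventually (mem_interior_iff_mem_nhds.1 h)).filter_mono nhdsWithin_le_nhds
  obtain ⟨t, ht, ht'⟩ := (h1.and self_mem_nhdsWithin).exists
  exact ⟨t, ht', ht⟩

theorem Q1_eq (p : ℝ × ℝ) : Q1 p = Ioi p.1 ×ˢ Ioi p.2 := rfl
theorem Q2_eq (p : ℝ × ℝ) : Q2 p = Iio p.1 ×ˢ Ioi p.2 := rfl
theorem Q3_eq (p : ℝ × ℝ) : Q3 p = Iio p.1 ×ˢ Iio p.2 := rfl
theorem Q4_eq (p : ℝ × ℝ) : Q4 p = Ioi p.1 ×ˢ Iio p.2 := rfl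

/-- The vector `(a, b)` points out of the quadrant. An interior point of the union stays in it after
a small shift along this vector, so the shifted point is in some closed quadrant; undoing the shift
leads into the open one. -/
theorem interior_quadrantUnion {Q : ℝ × ℝ → Set (ℝ × ℝ)} (hopen : ∀ p, IsOpen (Q p)) (a b : ℝ)
    (hab : ∀ p q : ℝ × ℝ, ∀ t > 0, (q.1 + a * t, q.2 + b * t) ∈ closure (Q p) → q ∈ Q p)
    (S : Set (ℝ × ℝ)) : interior (quadrantUnion Q S) = ⋃ p ∈ S, Q p := by
  apply subset_antisymm
  · intro q hq
    obtain ⟨t, ht, hqt⟩ := exists_pos_mem_of_mem_interior hq a b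
    simp only [quadrantUnion, mem_iUnion] at hqt ⊢
    obtain ⟨p, hp, hqt⟩ := hqt
    exact ⟨p, hp, hab p q t ht hqt⟩
  · apply interior_maximal
    · exact iUnion₂_mono fun p _ => subset_closure
    · exact isOpen_biUnion fun p _ => hopen p

/-- A point is interior to the hull if and only if all its open quadrants meet the set. -/
theorem mem_interior_RCH (S : Set (ℝ × ℝ)) (q : ℝ × ℝ) : q ∈ interior (RCH S) ↔
    (∃ p ∈ S, p.1 < q.1 ∧ q.2 < p.2) ∧ (∃ p ∈ S, q.1 < p.1 ∧ q.2 < p.2) ∧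
    (∃ p ∈ S, p.1 < q.1 ∧ p.2 < q.2) ∧ (∃ p ∈ S, q.1 < p.1 ∧ p.2 < q.2) := by
  have h1 := interior_quadrantUnion (Q := Q1) (fun p => isOpen_Ioi.prod isOpen_Ioi) (-1) (-1)
    (fun p q t ht h => by
      simp only [Q1_eq, closure_prod_eq, closure_Ioi, mem_prod, mem_Ici, mem_Ioi] at h ⊢
      constructor <;> linarith) S
  have h2 := interior_quadrantUnion (Q := Q2) (fun p => isOpen_Iio.prod isOpen_Ioi) 1 (-1)
    (fun p q t ht h => by
      simp only [Q2_eq, closure_prod_eq, closure_Ioi, closure_Iio, mem_prod, mem_Ici, mem_Iic,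
        mem_Ioi, mem_Iio] at h ⊢
      constructor <;> linarith) S
  have h3 := interior_quadrantUnion (Q := Q3) (fun p => isOpen_Iio.prod isOpen_Iio) 1 1
    (fun p q t ht h => by
      simp only [Q3_eq, closure_prod_eq, closure_Iio, mem_prod, mem_Iic, mem_Iio] at h ⊢
      constructor <;> linarith) S
  have h4 := interior_quadrantUnion (Q := Q4) (fun p => isOpen_Ioi.prod isOpen_Iio) (-1) 1
    (fun p q t ht h => by
      simp only [Q4_eq, closure_prod_eq, closure_Ioi, closure_Iio, mem_prod, mem_Ici, mem_Iic,
        mem_Ioi, mem_Iio] at h ⊢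
      constructor <;> linarith) S
  simp only [RCH, interior_inter, h1, h2, h3, h4, mem_inter_iff, mem_iUnion, Q1_eq, Q2_eq, Q3_eq,
    Q4_eq, mem_prod, mem_Ioi, mem_Iio, exists_prop]
  tauto

end Rectilinear

/-! ### Area and emptiness, slab by slab -/

namespace Sweep

/-- `y` lies below some value of `Z` on each of the two parts of `S`, before and from `k` on. -/
def Below (Z : ℕ → ℝ) (S : Set ℕ) (k : ℕ) (y : ℝ) : Prop :=
  (∃ s ∈ S, s < k ∧ y < Z s) ∧ ∃ s ∈ S, k ≤ s ∧ y < Z s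

/-- The cross-section of the hull in the slab between the abscissae `k - 1` and `k`. -/
def crossSection (Y : ℕ → ℝ) (S : Set ℕ) (k : ℕ) : Set ℝ :=
  {y | Below Y S k y ∧ Below (-Y) S k (-y)}

/-- There are elements of `S` with a greater value of `Z` both before and after `p`. -/
def Under (Z : ℕ → ℝ) (S : Set ℕ) (p : ℕ) : Prop :=
  (∃ s ∈ S, s < p ∧ Z p < Z s) ∧ ∃ s ∈ S, p < s ∧ Z p < Z s

/-- The point with index `p` is in the interior of the hull of the points with index in `S`. -/
def Inner (Y : ℕ → ℝ) (S : Set ℕ) (p : ℕ) : Prop := Under Y S p ∧ Under (-Y) S p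

/-- The area of the hull in the slab between the abscissae `k - 1` and `k`. -/
def slab (X Y : ℕ → ℝ) (S : Set ℕ) (k : ℕ) : ℝ :=
  (X k - X (k - 1)) * (volume (crossSection Y S k)).toReal

variable {n : ℕ} {X Y : ℕ → ℝ} {S : Set ℕ}

theorem crossSection_eq_empty {k : ℕ} (h : (∀ s ∈ S, k ≤ s) ∨ ∀ s ∈ S, s < k) :
    crossSection Y S k = ∅ := by
  ext y
  simp only [crossSection, Below, mem_ofPred_eq, mem_empty_iff_false, iff_false]
  rintro ⟨⟨⟨s, hs, h1, -⟩, ⟨s', hs', h2, -⟩⟩, -⟩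
  rcases h with h | h
  · exact absurd (h s hs) (by omega)
  · exact absurd (h s' hs') (by omega)

theorem slab_eq_zero {k : ℕ} (h : (∀ s ∈ S, k ≤ s) ∨ ∀ s ∈ S, s < k) : slab X Y S k = 0 := by
  simp [slab, crossSection_eq_empty h]

/-- Within a slab, lying to the left or right of `q` depends only on the index, so the quadrant
conditions no longer involve `q.1`. For `k = 0` the slab is everything to the left of the first
point. -/
theorem mem_interior_RCH_iff (hX : ∀ i j, i < j → j < n → X i < X j) (hS : S ⊆ Iio n)
    {k : ℕ} (hk : k < n) {q : ℝ × ℝ} (h1 : k = 0 ∨ X (k - 1) < q.1) (h2 : q.1 < X k) :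
    q ∈ interior (Rectilinear.RCH ((fun i => (X i, Y i)) '' S)) ↔ q.2 ∈ crossSection Y S k := by
  have hle : ∀ s ∈ S, (X s < q.1 ↔ s < k) ∧ (q.1 < X s ↔ k ≤ s) := by
    intro s hs
    have hsn : s < n := hS hs
    rcases lt_or_ge s k with h | h
    · have : X s < q.1 := by
        rcases h1 with h1 | h1
        · omega
        · rcases (show s = k - 1 ∨ s < k - 1 by omega) with rfl | h'
          · exact h1
          · exact (hX _ _ h' (by omega)).trans h1
      exact ⟨by simp [this, h], iff_of_false this.not_gt (not_le.2 h)⟩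
    · have : q.1 < X s := by
        rcases h.eq_or_lt with rfl | h'
        · exact h2
        · exact h2.trans (hX _ _ h' hsn)
      exact ⟨iff_of_false this.not_gt (not_lt.2 h), by simp [this, h]⟩
  simp only [Rectilinear.mem_interior_RCH, exists_mem_image, crossSection, Below, mem_ofPred_eq,
    Pi.neg_apply, neg_lt_neg_iff]
  have e1 : ∀ s, (s ∈ S ∧ X s < q.1 ∧ q.2 < Y s) ↔ (s ∈ S ∧ s < k ∧ q.2 < Y s) := fun s =>
    and_congr_right fun hs => by rw [(hle s hs).1]
  have e2 : ∀ s, (s ∈ S ∧ q.1 < X s ∧ q.2 < Y s) ↔ (s ∈ S ∧ k ≤ s ∧ q.2 < Y s) := fun s =>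
    and_congr_right fun hs => by rw [(hle s hs).2]
  have e3 : ∀ s, (s ∈ S ∧ X s < q.1 ∧ Y s < q.2) ↔ (s ∈ S ∧ s < k ∧ Y s < q.2) := fun s =>
    and_congr_right fun hs => by rw [(hle s hs).1]
  have e4 : ∀ s, (s ∈ S ∧ q.1 < X s ∧ Y s < q.2) ↔ (s ∈ S ∧ k ≤ s ∧ Y s < q.2) := fun s =>
    and_congr_right fun hs => by rw [(hle s hs).2]
  simp only [e1, e2, e3, e4, and_assoc]

theorem inner_iff (hX : ∀ i j, i < j → j < n → X i < X j) (hS : S ⊆ Iio n)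
    {p : ℕ} (hp : p < n) :
    (X p, Y p) ∈ interior (Rectilinear.RCH ((fun i => (X i, Y i)) '' S)) ↔ Inner Y S p := by
  have hle : ∀ i j, i < n → j < n → (X i < X j ↔ i < j) := by
    intro i j hi hj
    rcases lt_trichotomy i j with h | rfl | h
    · simp [h, hX i j h hj]
    · simp
    · exact iff_of_false (hX j i h hi).not_gt h.not_gt
  simp only [Rectilinear.mem_interior_RCH, exists_mem_image, Inner, Under,
    Pi.neg_apply, neg_lt_neg_iff]
  have e1 : ∀ s, ∀ c : Prop, (s ∈ S ∧ X s < X p ∧ c) ↔ (s ∈ S ∧ s < p ∧ c) := fun s c =>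
    and_congr_right fun hs => by rw [hle s p (hS hs) hp]
  have e2 : ∀ s, ∀ c : Prop, (s ∈ S ∧ X p < X s ∧ c) ↔ (s ∈ S ∧ p < s ∧ c) := fun s c =>
    and_congr_right fun hs => by rw [hle p s hp (hS hs)]
  simp only [e1, e2, and_assoc]

theorem exists_slab (hn : 0 < n) {x : ℝ}
    (hne : ∀ i < n, x ≠ X i) (hx : x < X (n - 1)) :
    ∃ k < n, (k = 0 ∨ X (k - 1) < x) ∧ x < X k := by
  classical
  have hex : ∃ k, x < X k := ⟨n - 1, hx⟩
  have hle : Nat.find hex ≤ n - 1 := Nat.find_min' hex hx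
  refine ⟨Nat.find hex, by omega, ?_, Nat.find_spec hex⟩
  rcases Nat.eq_zero_or_pos (Nat.find hex) with h | h
  · exact Or.inl h
  · right
    have := Nat.find_min hex (m := Nat.find hex - 1) (by omega)
    exact lt_of_le_of_ne (not_lt.1 this) (hne _ (by omega)).symm

theorem volume_crossSection_lt_top (hS : S ⊆ Iio n) (k : ℕ) : volume (crossSection Y S k) < ⊤ := by
  have hfin : (Y '' Iio n).Finite := (finite_Iio n).image _
  obtain ⟨M, hM⟩ := hfin.bddAbove
  obtain ⟨m, hm⟩ := hfin.bddBelow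
  refine lt_of_le_of_lt (measure_mono (t := Icc m M) ?_) (by simp)
  rintro y ⟨⟨⟨s, hs, -, h1⟩, -⟩, ⟨⟨s', hs', -, h2⟩, -⟩⟩
  have h1' := hM (mem_image_of_mem Y (hS hs))
  have h2' := hm (mem_image_of_mem Y (hS hs'))
  simp only [Pi.neg_apply, neg_lt_neg_iff] at h2
  exact ⟨by linarith, by linarith⟩

/-- The area of the hull is the sum of the areas in the slabs. -/
theorem areaRCH_eq (hX : ∀ i j, i < j → j < n → X i < X j) (hS : S ⊆ Iio n) :
    Rectilinear.areaRCH ((fun i => (X i, Y i)) '' S) =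
      ENNReal.ofReal (∑ k ∈ Finset.range n, slab X Y S k) := by
  set I := interior (Rectilinear.RCH ((fun i => (X i, Y i)) '' S)) with hI
  rcases Nat.eq_zero_or_pos n with rfl | hn
  · have : S = ∅ := by
      ext s; simp only [mem_empty_iff_false, iff_false]; intro h; exact absurd (hS h) (by simp)
    have hI0 : I = ∅ := by
      ext q; simp [hI, Rectilinear.mem_interior_RCH, this]
    simp [Rectilinear.areaRCH, ← hI, hI0]
  set R : ℕ → Set (ℝ × ℝ) := fun k => Ioo (X (k - 1)) (X k) ×ˢ crossSection Y S k with hR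
  have h0 : ∀ s ∈ S, 0 ≤ s := fun s _ => Nat.zero_le s
  have hsec0 : crossSection Y S 0 = ∅ := crossSection_eq_empty (Or.inl h0)
  -- The vertical lines through the points are negligible, and off these lines every interior point
  -- belongs to one of the slabs.
  have hnull : volume (⋃ i ∈ Finset.range n, (({X i} : Set ℝ) ×ˢ (univ : Set ℝ))) = 0 := by
    refine (measure_biUnion_null_iff (Finset.range n).countable_toSet).2 fun i _ => ?_
    rw [Measure.volume_eq_prod, Measure.prod_prod]; simp
  have hae : volume I = volume (⋃ k ∈ Finset.range n, R k) := by
    apply measure_congr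
    filter_upwards [measure_eq_zero_iff_ae_notMem.1 hnull] with q hq
    simp only [mem_iUnion, mem_prod, mem_singleton_iff, mem_univ, and_true, Finset.mem_range,
      not_exists] at hq
    apply propext
    change q ∈ I ↔ q ∈ ⋃ k ∈ Finset.range n, R k
    simp only [mem_iUnion, Finset.mem_range, hR, mem_prod, exists_prop, mem_Ioo]
    constructor
    · intro h
      have hx : q.1 < X (n - 1) := by
        obtain ⟨-, ⟨p, hp, h1, -⟩, -⟩ := (Rectilinear.mem_interior_RCH _ _).1 h
        obtain ⟨s, hs, rfl⟩ := hp
        have hsn : s < n := hS hs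
        rcases (show s = n - 1 ∨ s < n - 1 by omega) with rfl | h'
        · exact h1
        · exact h1.trans (hX _ _ h' (by omega))
      obtain ⟨k, hk, h1, h2⟩ := exists_slab hn (fun i hi => hq i hi) hx
      have hmem := (mem_interior_RCH_iff hX hS hk h1 h2).1 h
      refine ⟨k, hk, ⟨?_, h2⟩, hmem⟩
      -- The slab `0` is unbounded to the left, whereas `R 0` is empty because `0 - 1 = 0`; they
      -- agree since the cross-section there is empty.
      rcases h1 with rfl | h1
      · simp [hsec0] at hmem
      · exact h1
    · rintro ⟨k, hk, ⟨h1, h2⟩, h3⟩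
      exact (mem_interior_RCH_iff hX hS hk (Or.inr h1) h2).2 h3
  have hopen : ∀ k, MeasurableSet (crossSection Y S k) := by
    intro k
    have : crossSection Y S k = ((⋃ s ∈ {s ∈ S | s < k}, Iio (Y s)) ∩ ⋃ s ∈ {s ∈ S | k ≤ s}, Iio (Y s))
        ∩ ((⋃ s ∈ {s ∈ S | s < k}, Ioi (Y s)) ∩ ⋃ s ∈ {s ∈ S | k ≤ s}, Ioi (Y s)) := by
      ext y
      simp [crossSection, Below, and_assoc]
    rw [this]
    have o1 : ∀ T : Set ℕ, IsOpen (⋃ s ∈ T, Iio (Y s)) := fun T =>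
      isOpen_biUnion fun s _ => isOpen_Iio
    have o2 : ∀ T : Set ℕ, IsOpen (⋃ s ∈ T, Ioi (Y s)) := fun T =>
      isOpen_biUnion fun s _ => isOpen_Ioi
    exact (((o1 _).inter (o1 _)).inter ((o2 _).inter (o2 _))).measurableSet
  have hmono : ∀ i j, i ≤ j → j < n → X i ≤ X j := by
    intro i j hij hj
    rcases hij.eq_or_lt with rfl | h
    · exact le_rfl
    · exact (hX i j h hj).le
  have hdisj : (↑(Finset.range n) : Set ℕ).PairwiseDisjoint R := by
    have key : ∀ i j, i < j → j < n → Disjoint (R i) (R j) := by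
      intro i j hij hj
      refine disjoint_left.2 ?_
      rintro q ⟨⟨-, h2⟩, -⟩ ⟨⟨h1, -⟩, -⟩
      have := hmono i (j - 1) (by omega) (by omega)
      linarith
    intro i hi j hj hij
    simp only [Finset.coe_range, mem_Iio] at hi hj
    rcases lt_or_gt_of_ne hij with h | h
    · exact key i j h hj
    · exact (key j i h hi).symm
  rw [Rectilinear.areaRCH, ← hI, hae, measure_biUnion_finset hdisj
    (fun k _ => measurableSet_Ioo.prod (hopen k)), ENNReal.ofReal_sum_of_nonneg]
  · refine Finset.sum_congr rfl fun k hk => ?_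
    simp only [Finset.mem_range] at hk
    rw [hR, Measure.volume_eq_prod, Measure.prod_prod, Real.volume_Ioo, slab,
      ENNReal.ofReal_mul (by have := hmono (k - 1) k (by omega) hk; linarith),
      ENNReal.ofReal_toReal (volume_crossSection_lt_top hS k).ne]
  · intro k hk
    simp only [Finset.mem_range] at hk
    refine mul_nonneg ?_ ENNReal.toReal_nonneg
    have := hmono (k - 1) k (by omega) hk
    linarith

end Sweep
end

noncomputable section

open MeasureTheory Set

namespace Sweep

/-! ### Sources of the bounds of a cross-section

The points are numbered from left to right. The cross-section of the hull of `S` in a slab is the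
interval `(Y b, Y a)`, where `a` attains the minimum of the maximal ordinates to the left and to the
right, and `b` the maximum of the minimal ordinates. The dynamic program sweeps over the slabs with
the pairs `(a, b)` as states; a bound `a ≥ k` is a promise that `a` will be selected later. The
lower bounds are treated as upper bounds for `-Y`. -/

/-- The condition on the elements of `S` before time `k` under which `a` bounds the slab `k`:
`a` is either the highest of them, or lies ahead and is exceeded by one of them. -/
def Past (Z : ℕ → ℝ) (S : Set ℕ) (k a : ℕ) : Prop :=
  (a < k → a ∈ S ∧ ∀ s ∈ S, Z s ≤ Z a) ∧ (k ≤ a → ∃ s ∈ S, Z a < Z s)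

/-- The condition on the elements of `S` from time `k` on under which `a` bounds the slab `k`. -/
def Future (Z : ℕ → ℝ) (S : Set ℕ) (k a : ℕ) : Prop :=
  (a < k → ∃ s ∈ S, k ≤ s ∧ Z a < Z s) ∧ (k ≤ a → a ∈ S ∧ ∀ s ∈ S, k ≤ s → Z s ≤ Z a)

/-- The condition on the elements of `S` after `k` without the requirement that `k` itself be
exceeded. -/
def WeakFuture (Z : ℕ → ℝ) (S : Set ℕ) (k a : ℕ) : Prop :=
  (a < k → ∃ s ∈ S, k < s ∧ Z a < Z s) ∧ (k < a → a ∈ S ∧ ∀ s ∈ S, k < s → Z s ≤ Z a)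

/-- `a` attains the minimum of the two maxima of `Z` over the parts of `S` before and from `k` on. -/
def Source (Z : ℕ → ℝ) (S : Set ℕ) (k a : ℕ) : Prop :=
  Past Z {s ∈ S | s < k} k a ∧ Future Z S k a

/-- The element `k` does not affect the bound `a`. -/
def Keep (Z : ℕ → ℝ) (sel : Prop) (k a : ℕ) : Prop := a ≠ k ∧ (sel → Z k < Z a)

/-- The selected element `k` replaces the bound `a` by `a'`. -/
def Move (Z : ℕ → ℝ) (k a a' : ℕ) : Prop :=
  (a < k ∧ Z a < Z k ∧ (a' = k ∨ (k < a' ∧ Z a' < Z k))) ∨ (a = k ∧ k < a' ∧ Z a' < Z k)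

variable {n k a a' : ℕ} {X Y Z : ℕ → ℝ} {S S₀ : Set ℕ}

/-- `a` is the maximum of its own side and is exceeded on the other side, so it alone decides. -/
theorem Source.below_iff (h : Source Z S k a) (y : ℝ) : Below Z S k y ↔ y < Z a := by
  obtain ⟨⟨h1, h2⟩, h3, h4⟩ := h
  constructor
  · rintro ⟨⟨s, hs, hsk, hy⟩, ⟨s', hs', hks, hy'⟩⟩
    rcases lt_or_ge a k with h | h
    · exact hy.trans_le ((h1 h).2 s ⟨hs, hsk⟩)
    · exact hy'.trans_le ((h4 h).2 s' hs' hks)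
  · intro hy
    rcases lt_or_ge a k with h | h
    · obtain ⟨s, hs, hks, hlt⟩ := h3 h
      exact ⟨⟨a, (h1 h).1.1, h, hy⟩, ⟨s, hs, hks, hy.trans hlt⟩⟩
    · obtain ⟨s, ⟨hs, hsk⟩, hlt⟩ := h2 h
      exact ⟨⟨s, hs, hsk, hy.trans hlt⟩, ⟨a, (h4 h).1, h, hy⟩⟩

/-- The bounds may be in the wrong order, namely where the interior of the hull is interrupted;
hence the truncation at `0`. -/
theorem slab_eq {b : ℕ} (ha : Source Y S k a) (hb : Source (-Y) S k b) :
    slab X Y S k = (X k - X (k - 1)) * max (Y a - Y b) 0 := by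
  have : crossSection Y S k = Ioo (Y b) (Y a) := by
    ext y
    simp only [crossSection, mem_ofPred_eq, ha.below_iff, hb.below_iff, Pi.neg_apply,
      neg_lt_neg_iff, mem_Ioo, and_comm]
  rw [slab, this, Real.volume_Ioo, ENNReal.toReal_ofReal']

/-- Only `k` itself can lie ahead: a promise must be `k`, and a record must be exceeded by `k`. -/
theorem Source.of_not_under_right (h : Source Z S k a) (hm : ∀ s ∈ S, s ≤ k) :
    a = k ∨ (a < k ∧ Z a < Z k) := by
  rcases lt_or_ge a k with h' | h'
  · obtain ⟨s, hs, hks, hlt⟩ := h.2.1 h'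
    obtain rfl : s = k := le_antisymm (hm s hs) hks
    exact Or.inr ⟨h', hlt⟩
  · exact Or.inl (le_antisymm (hm a (h.2.2 h').1) h')

/-! ### Soundness of the transitions -/

theorem Keep.past_insert (h : Keep Z True k a) (hp : Past Z S₀ k a) :
    Past Z (insert k S₀) (k + 1) a := by
  obtain ⟨h1, h2⟩ := h
  refine ⟨fun ha => ?_, fun ha => ?_⟩
  · have := hp.1 (by omega)
    refine ⟨Or.inr this.1, ?_⟩
    rintro s (rfl | hs)
    · exact (h2 trivial).le
    · exact this.2 s hs
  · obtain ⟨s, hs, hlt⟩ := hp.2 (by omega)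
    exact ⟨s, Or.inr hs, hlt⟩

theorem Keep.past {sel : Prop} (h : Keep Z sel k a) (hp : Past Z S₀ k a) :
    Past Z S₀ (k + 1) a :=
  ⟨fun ha => hp.1 (by have := h.1; omega), fun ha => hp.2 (by omega)⟩

theorem Keep.future {sel : Prop} (h : Keep Z sel k a) (hsel : k ∈ S → sel)
    (hf : WeakFuture Z S k a) : Future Z S k a := by
  obtain ⟨h1, h2⟩ := h
  refine ⟨fun ha => ?_, fun ha => ?_⟩
  · obtain ⟨s, hs, hks, hlt⟩ := hf.1 ha
    exact ⟨s, hs, hks.le, hlt⟩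
  · have := hf.2 (by omega)
    refine ⟨this.1, fun s hs hks => ?_⟩
    rcases hks.eq_or_lt with rfl | hks
    · exact (h2 (hsel hs)).le
    · exact this.2 s hs hks

theorem Move.past_insert (h : Move Z k a a') (hp : Past Z S₀ k a) :
    Past Z (insert k S₀) (k + 1) a' := by
  rcases h with ⟨h1, h2, rfl | ⟨h3, h4⟩⟩ | ⟨rfl, h3, h4⟩
  · refine ⟨fun _ => ⟨Or.inl rfl, ?_⟩, fun h => by omega⟩
    rintro s (rfl | hs)
    · exact le_rfl
    · exact ((hp.1 h1).2 s hs).trans h2.le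
  · exact ⟨fun h => by omega, fun _ => ⟨k, Or.inl rfl, h4⟩⟩
  · exact ⟨fun h => by omega, fun _ => ⟨a, Or.inl rfl, h4⟩⟩

theorem Move.future (h : Move Z k a a') (hk : k ∈ S) (hf : WeakFuture Z S k a') :
    Future Z S k a := by
  rcases h with ⟨h1, h2, -⟩ | ⟨rfl, h3, h4⟩
  · exact ⟨fun _ => ⟨k, hk, le_rfl, h2⟩, fun h => by omega⟩
  · refine ⟨fun h => by omega, fun _ => ⟨hk, fun s hs hks => ?_⟩⟩
    rcases hks.eq_or_lt with rfl | hks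
    · exact le_rfl
    · exact ((hf.2 h3).2 s hs hks).trans h4.le

/-- A new record exceeds everything before it. A fulfilled promise exceeds the next promise `a'`,
which dominates everything after it. Either way one side has nothing above `k`. -/
theorem Move.not_under (h : Move Z k a a') (hS : ∀ s < k, s ∈ S ↔ s ∈ S₀) (hp : Past Z S₀ k a)
    (hf : WeakFuture Z S k a') : ¬ Under Z S k := by
  rintro ⟨⟨s, hs, hsk, hlt⟩, ⟨s', hs', hks, hlt'⟩⟩
  rcases h with ⟨h1, h2, -⟩ | ⟨rfl, h3, h4⟩
  · have := (hp.1 h1).2 s ((hS s hsk).1 hs)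
    linarith
  · have := (hf.2 h3).2 s' hs' hks
    linarith

/-- A bound other than `k` is the maximum of the side of `k` on which it lies. -/
theorem not_under_of_le (hS : ∀ s < k, s ∈ S ↔ s ∈ S₀) (hp : Past Z S₀ k a)
    (hf : WeakFuture Z S k a) (hne : a ≠ k) (h : Z a ≤ Z k) : ¬ Under Z S k := by
  rintro ⟨⟨s, hs, hsk, hlt⟩, ⟨s', hs', hks, hlt'⟩⟩
  rcases lt_or_gt_of_ne hne with ha | ha
  · have := (hp.1 ha).2 s ((hS s hsk).1 hs)
    linarith
  · have := (hf.2 ha).2 s' hs' hks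
    linarith

/-- The entry `(a, b)` at time `k`: whichever way the prefix `S₀` is completed in accordance with
the bounds `a` and `b`, the hull has area `v` up to abscissa `k` and no inner point before `k`. -/
def Good (X Y : ℕ → ℝ) (k a b : ℕ) (S₀ : Set ℕ) (v : ℝ) : Prop :=
  S₀ ⊆ Iio k ∧ Past Y S₀ k a ∧ Past (-Y) S₀ k b ∧
  ∀ S : Set ℕ, (∀ s < k, s ∈ S ↔ s ∈ S₀) → Future Y S k a → Future (-Y) S k b →
    v = ∑ j ∈ Finset.range (k + 1), slab X Y S j ∧ ∀ p < k, ¬ Inner Y S p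

/-- The entry `(a, b)` after processing `k`, when the next slab is not yet accounted for. -/
def HalfGood (X Y : ℕ → ℝ) (k a b : ℕ) (S₀ : Set ℕ) (v : ℝ) : Prop :=
  S₀ ⊆ Iio (k + 1) ∧ Past Y S₀ (k + 1) a ∧ Past (-Y) S₀ (k + 1) b ∧
  ∀ S : Set ℕ, (∀ s < k + 1, s ∈ S ↔ s ∈ S₀) → WeakFuture Y S k a → WeakFuture (-Y) S k b →
    v = ∑ j ∈ Finset.range (k + 1), slab X Y S j ∧ ∀ p < k + 1, ¬ Inner Y S p

variable {b b' : ℕ} {v : ℝ}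

theorem insert_subset_Iio_succ (h : S₀ ⊆ Iio k) : insert k S₀ ⊆ Iio (k + 1) := by
  rintro s (rfl | hs)
  · simp
  · have : s < k := h hs
    simp only [mem_Iio]; omega

theorem mem_iff_of_insert (h : ∀ s < k + 1, s ∈ S ↔ s ∈ insert k S₀) :
    k ∈ S ∧ ∀ s < k, s ∈ S ↔ s ∈ S₀ := by
  refine ⟨(h k (by omega)).2 (Or.inl rfl), fun s hs => ?_⟩
  rw [h s (by omega), mem_insert_iff]
  simp [hs.ne]

theorem forall_lt_succ_not_inner (h : ∀ p < k, ¬ Inner Y S p) (hk : ¬ Inner Y S k) :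
    ∀ p < k + 1, ¬ Inner Y S p := by
  intro p hp
  rcases (show p < k ∨ p = k by omega) with h' | rfl
  · exact h p h'
  · exact hk

theorem Good.skip (h : Good X Y k a b S₀ v) (ha : Keep Y False k a) (hb : Keep (-Y) False k b)
    (hab : ¬ (Y b < Y k ∧ Y k < Y a)) : HalfGood X Y k a b S₀ v := by
  obtain ⟨h0, h1, h2, h3⟩ := h
  have hk : k ∉ S₀ := fun h => lt_irrefl k (h0 h)
  refine ⟨h0.trans (Iio_subset_Iio (by omega)), ha.past h1, hb.past h2, fun S hS hfa hfb => ?_⟩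
  have hkS : k ∉ S := fun h => hk ((hS k (by omega)).1 h)
  have hS' : ∀ s < k, s ∈ S ↔ s ∈ S₀ := fun s hs => hS s (by omega)
  obtain ⟨h4, h5⟩ := h3 S hS' (ha.future hkS hfa) (hb.future hkS hfb)
  refine ⟨h4, forall_lt_succ_not_inner h5 fun hin => ?_⟩
  rw [not_and_or, not_lt, not_lt] at hab
  rcases hab with hab | hab
  · exact not_under_of_le hS' h2 hfb hb.1 (by simpa using hab) hin.2
  · exact not_under_of_le hS' h1 hfa ha.1 hab hin.1

theorem Good.move_keep (h : Good X Y k a b S₀ v) (ha : Move Y k a a') (hb : Keep (-Y) True k b) :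
    HalfGood X Y k a' b (insert k S₀) v := by
  obtain ⟨h0, h1, h2, h3⟩ := h
  refine ⟨insert_subset_Iio_succ h0, ha.past_insert h1, hb.past_insert h2, fun S hS hfa hfb => ?_⟩
  obtain ⟨hk, hS'⟩ := mem_iff_of_insert hS
  obtain ⟨h4, h5⟩ := h3 S hS' (ha.future hk hfa) (hb.future (fun _ => trivial) hfb)
  exact ⟨h4, forall_lt_succ_not_inner h5 fun hin => ha.not_under hS' h1 hfa hin.1⟩

theorem Good.keep_move (h : Good X Y k a b S₀ v) (ha : Keep Y True k a) (hb : Move (-Y) k b b') :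
    HalfGood X Y k a b' (insert k S₀) v := by
  obtain ⟨h0, h1, h2, h3⟩ := h
  refine ⟨insert_subset_Iio_succ h0, ha.past_insert h1, hb.past_insert h2, fun S hS hfa hfb => ?_⟩
  obtain ⟨hk, hS'⟩ := mem_iff_of_insert hS
  obtain ⟨h4, h5⟩ := h3 S hS' (ha.future (fun _ => trivial) hfa) (hb.future hk hfb)
  exact ⟨h4, forall_lt_succ_not_inner h5 fun hin => hb.not_under hS' h2 hfb hin.2⟩

theorem Good.move_move (h : Good X Y k a b S₀ v) (ha : Move Y k a a') (hb : Move (-Y) k b b') :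
    HalfGood X Y k a' b' (insert k S₀) v := by
  obtain ⟨h0, h1, h2, h3⟩ := h
  refine ⟨insert_subset_Iio_succ h0, ha.past_insert h1, hb.past_insert h2, fun S hS hfa hfb => ?_⟩
  obtain ⟨hk, hS'⟩ := mem_iff_of_insert hS
  obtain ⟨h4, h5⟩ := h3 S hS' (ha.future hk hfa) (hb.future hk hfb)
  exact ⟨h4, forall_lt_succ_not_inner h5 fun hin => ha.not_under hS' h1 hfa hin.1⟩

theorem Past.turn {w : ℕ} (h : Past Z S₀ (k + 1) k) (hw : k < w) (hlt : Z w < Z k) :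
    Past Z S₀ (k + 1) w :=
  ⟨fun h => by omega, fun _ => ⟨k, (h.1 (by omega)).1, hlt⟩⟩

/-- This is what makes the second pass possible: an entry with the bound `k`, just after `k`,
demands nothing of the future with respect to that bound. -/
theorem weakFuture_self : WeakFuture Z S k k := ⟨fun h => by omega, fun h => by omega⟩

/-- If nothing higher than `k` follows, the highest later point `w` takes over as the bound. The
area and emptiness are inherited, because the entry with bound `k` vouches for every future as far
as this bound is concerned. -/
theorem HalfGood.turn_left {w : ℕ} (h : HalfGood X Y k k b S₀ v) (hw : k < w) (hlt : Y w < Y k) :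
    HalfGood X Y k w b S₀ v :=
  ⟨h.1, h.2.1.turn hw hlt, h.2.2.1, fun S hS _ hfb => h.2.2.2 S hS weakFuture_self hfb⟩

theorem HalfGood.turn_right {w : ℕ} (h : HalfGood X Y k a k S₀ v) (hw : k < w)
    (hlt : Y k < Y w) : HalfGood X Y k a w S₀ v :=
  ⟨h.1, h.2.1, h.2.2.1.turn hw (by simpa using hlt),
    fun S hS hfa _ => h.2.2.2 S hS hfa weakFuture_self⟩

theorem HalfGood.start : HalfGood X Y k k k {k} 0 := by
  have hp : ∀ Z : ℕ → ℝ, Past Z {k} (k + 1) k := fun Z =>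
    ⟨fun _ => ⟨rfl, fun s hs => by rw [hs]⟩, fun h => by omega⟩
  refine ⟨by simp, hp _, hp _, fun S hS _ _ => ?_⟩
  have hle : ∀ s ∈ S, k ≤ s := by
    intro s hs
    by_contra h
    have := (hS s (by omega)).1 hs
    simp only [mem_singleton_iff] at this
    omega
  constructor
  · rw [Finset.sum_eq_zero]
    intro j hj
    simp only [Finset.mem_range] at hj
    exact slab_eq_zero (Or.inl fun s hs => by have := hle s hs; omega)
  · rintro p hp ⟨⟨⟨s, hs, hsp, -⟩, -⟩, -⟩
    have := hle s hs
    omega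

theorem Future.weakFuture (h : Future Z S (k + 1) a) : WeakFuture Z S k a := by
  refine ⟨fun ha => ?_, fun ha => ?_⟩
  · obtain ⟨s, hs, hks, hlt⟩ := h.1 (by omega)
    exact ⟨s, hs, by omega, hlt⟩
  · exact ⟨(h.2 ha).1, fun s hs hks => (h.2 ha).2 s hs hks⟩

theorem sep_lt_eq (h0 : S₀ ⊆ Iio k) (hS : ∀ s < k, s ∈ S ↔ s ∈ S₀) : S₀ = {s ∈ S | s < k} := by
  ext s
  simp only [mem_ofPred_eq]
  constructor
  · intro h
    exact ⟨(hS s (h0 h)).2 h, h0 h⟩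
  · rintro ⟨h1, h2⟩
    exact (hS s h2).1 h1

/-- The past and future conditions together say that `a` and `b` are the sources of the slab `k +
1`, so its area is known before the set is completed. -/
theorem HalfGood.good_succ (h : HalfGood X Y k a b S₀ v) :
    Good X Y (k + 1) a b S₀ (v + (X (k + 1) - X k) * max (Y a - Y b) 0) := by
  obtain ⟨h0, h1, h2, h3⟩ := h
  refine ⟨h0, h1, h2, fun S hS hfa hfb => ?_⟩
  obtain ⟨h4, h5⟩ := h3 S hS hfa.weakFuture hfb.weakFuture
  refine ⟨?_, h5⟩
  have he := sep_lt_eq h0 hS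
  rw [Finset.sum_range_succ, ← h4, slab_eq ⟨he ▸ h1, hfa⟩ ⟨he ▸ h2, hfb⟩]
  simp

/-- The element `k` replaces the bound `a` if nothing follows. -/
def Touch (Z : ℕ → ℝ) (k a : ℕ) : Prop := a = k ∨ (a < k ∧ Z a < Z k)

theorem Touch.future (h : Touch Z k a) (hk : k ∈ S) (hS : ∀ s ∈ S, s ≤ k) : Future Z S k a := by
  rcases h with rfl | ⟨h1, h2⟩
  · refine ⟨fun h => by omega, fun _ => ⟨hk, fun s hs has => ?_⟩⟩
    rw [le_antisymm (hS s hs) has]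
  · exact ⟨fun _ => ⟨k, hk, le_rfl, h2⟩, fun h => by omega⟩

theorem sum_slab_eq {m : ℕ} (hS : ∀ s ∈ S, s ≤ k) (hk : k < m) :
    ∑ j ∈ Finset.range m, slab X Y S j = ∑ j ∈ Finset.range (k + 1), slab X Y S j := by
  symm
  refine Finset.sum_subset (fun j hj => ?_) fun j _ hj => ?_
  · simp only [Finset.mem_range] at hj ⊢; omega
  · simp only [Finset.mem_range] at hj
    exact slab_eq_zero (Or.inr fun s hs => by have := hS s hs; omega)

/-- Choosing `k` and nothing afterwards is one of the completions that `Good` speaks about, since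
`Touch` provides both future conditions. Points from `k` on are not interior because nothing lies to
their right. -/
theorem Good.finish (h : Good X Y k a b S₀ v) (ha : Touch Y k a) (hb : Touch (-Y) k b)
    (hk : k < n) : insert k S₀ ⊆ Iio n ∧
      v = ∑ j ∈ Finset.range n, slab X Y (insert k S₀) j ∧ ∀ p, ¬ Inner Y (insert k S₀) p := by
  obtain ⟨h0, h1, h2, h3⟩ := h
  have hle : ∀ s ∈ insert k S₀, s ≤ k := fun s hs => by
    have := insert_subset_Iio_succ h0 hs; simp only [mem_Iio] at this; omega
  have hS : ∀ s < k, s ∈ insert k S₀ ↔ s ∈ S₀ := fun s hs => by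
    rw [mem_insert_iff]; simp [hs.ne]
  have hmem : k ∈ insert k S₀ := Or.inl rfl
  obtain ⟨h4, h5⟩ := h3 _ hS (ha.future hmem hle) (hb.future hmem hle)
  refine ⟨fun s hs => ?_, ?_, fun p hin => ?_⟩
  · have := hle s hs; simp only [mem_Iio]; omega
  · rw [h4, sum_slab_eq hle hk]
  · obtain ⟨⟨-, s, hs, hps, -⟩, -⟩ := id hin
    rcases lt_or_ge p k with hp | hp
    · exact h5 p hp hin
    · have := hle s hs; omega

/-! ### Completeness of the transitions -/

theorem exists_max (hS : S.Finite) (h : S.Nonempty) (Z : ℕ → ℝ) :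
    ∃ a ∈ S, ∀ s ∈ S, Z s ≤ Z a := Set.exists_max_image S Z hS h

/-- The source is the lower of the maximal elements of the two sides; general position excludes a
tie. -/
theorem exists_source (hZ : InjOn Z (Iio n)) (hS : S ⊆ Iio n) (h1 : ∃ s ∈ S, s < k)
    (h2 : ∃ s ∈ S, k ≤ s) : ∃ a, Source Z S k a := by
  have hfin : S.Finite := (finite_Iio n).subset hS
  obtain ⟨a, ⟨ha, hak⟩, hamax⟩ := exists_max (S := {s ∈ S | s < k}) (hfin.subset (sep_subset _ _))
    (by obtain ⟨s, hs, h⟩ := h1; exact ⟨s, hs, h⟩) Z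
  obtain ⟨b, ⟨hb, hbk⟩, hbmax⟩ := exists_max (S := {s ∈ S | k ≤ s}) (hfin.subset (sep_subset _ _))
    (by obtain ⟨s, hs, h⟩ := h2; exact ⟨s, hs, h⟩) Z
  have hne : Z a ≠ Z b := fun h => by
    have := hZ (hS ha) (hS hb) h
    omega
  rcases lt_or_gt_of_ne hne with h | h
  · exact ⟨a, ⟨fun _ => ⟨⟨ha, hak⟩, hamax⟩, fun h' => by omega⟩,
      fun _ => ⟨b, hb, hbk, h⟩, fun h' => by omega⟩
  · exact ⟨b, ⟨fun h' => by omega, fun _ => ⟨a, ⟨ha, hak⟩, h⟩⟩,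
      fun h' => by omega, fun _ => ⟨hb, fun s hs hks => hbmax s ⟨hs, hks⟩⟩⟩

theorem Source.mem (h : Source Z S k a) : a ∈ S := by
  rcases lt_or_ge a k with h' | h'
  · exact (h.1.1 h').1.1
  · exact (h.2.2 h').1

/-- A bound after `k` arises from a bound before `k` by one of the transitions. -/
theorem Source.exists_prev (hZ : InjOn Z (Iio n)) (hS : S ⊆ Iio n) (h1 : ∃ s ∈ S, s < k)
    (h : Source Z S (k + 1) a') : ∃ a, Source Z S k a ∧
      ((a' = a ∧ Keep Z (k ∈ S) k a) ∨ (k ∈ S ∧ Move Z k a a')) := by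
  have hmem : a' ∈ S := h.mem
  obtain ⟨⟨hp1, hp2⟩, hf1, hf2⟩ := h
  have hinj : ∀ s ∈ S, ∀ t ∈ S, s ≠ t → Z s ≠ Z t := fun s hs t ht hne he =>
    hne (hZ (hS hs) (hS ht) he)
  have hmax : k ∈ S → ∃ a ∈ S, a < k ∧ (∀ s ∈ S, s < k → Z s ≤ Z a) := by
    intro _
    obtain ⟨a, ⟨ha, hak⟩, hamax⟩ := exists_max (S := {s ∈ S | s < k})
      (((finite_Iio n).subset hS).subset (sep_subset _ _))
      (by obtain ⟨s, hs, h⟩ := h1; exact ⟨s, hs, h⟩) Z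
    exact ⟨a, ha, hak, fun s hs hsk => hamax s ⟨hs, hsk⟩⟩
  -- If `k` exceeds everything before it, the previous record was the source of the slab `k`.
  have hup : ∀ a ∈ S, a < k → (∀ s ∈ S, s < k → Z s ≤ Z a) → k ∈ S → Z a < Z k →
      Source Z S k a := fun a ha hak hm hk hlt =>
    ⟨⟨fun _ => ⟨⟨ha, hak⟩, fun s hs => hm s hs.1 hs.2⟩, fun h => by omega⟩,
      fun _ => ⟨k, hk, le_rfl, hlt⟩, fun h => by omega⟩
  by_cases hk : k ∈ S
  · rcases lt_trichotomy a' k with h' | rfl | h'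
    · have hle : Z k ≤ Z a' := (hp1 (by omega)).2 k ⟨hk, by omega⟩
      have hlt : Z k < Z a' := lt_of_le_of_ne hle (hinj k hk a' hmem (by omega))
      refine ⟨a', ⟨⟨fun _ => ⟨⟨hmem, h'⟩, fun s hs => (hp1 (by omega)).2 s ⟨hs.1, ?_⟩⟩,
        fun h => by omega⟩, fun _ => ?_, fun h => by omega⟩, Or.inl ⟨rfl, h'.ne, fun _ => hlt⟩⟩
      · have := hs.2; omega
      · obtain ⟨s, hs, hks, hlt⟩ := hf1 (by omega)
        exact ⟨s, hs, by omega, hlt⟩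
    · obtain ⟨a, ha, hak, hm⟩ := hmax hk
      have hlt : Z a < Z a' := lt_of_le_of_ne ((hp1 (by omega)).2 a ⟨ha, by omega⟩)
        (hinj a ha a' hk (by omega))
      exact ⟨a, hup a ha hak hm hk hlt, Or.inr ⟨hk, Or.inl ⟨hak, hlt, Or.inl rfl⟩⟩⟩
    · rcases lt_or_gt_of_ne (hinj k hk a' hmem (by omega)) with hlt | hlt
      · refine ⟨a', ⟨⟨fun h => by omega, fun _ => ?_⟩, fun h => by omega, fun _ => ⟨hmem, ?_⟩⟩,
          Or.inl ⟨rfl, h'.ne', fun _ => hlt⟩⟩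
        · obtain ⟨s, ⟨hs, hsk⟩, hlt'⟩ := hp2 (by omega)
          refine ⟨s, ⟨hs, ?_⟩, hlt'⟩
          rcases (show s = k ∨ s < k by omega) with rfl | h''
          · linarith
          · exact h''
        · intro s hs hks
          rcases hks.eq_or_lt with rfl | hks
          · exact hlt.le
          · exact (hf2 (by omega)).2 s hs hks
      · obtain ⟨a, ha, hak, hm⟩ := hmax hk
        -- Here `k` lies above all that follows. Either it is a new record, turning into the promise
        -- `a'` at once, or an earlier element is higher and `k` was itself the promise.
        rcases lt_or_gt_of_ne (hinj a ha k hk (by omega)) with hlt' | hlt'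
        · exact ⟨a, hup a ha hak hm hk hlt', Or.inr ⟨hk, Or.inl ⟨hak, hlt', Or.inr ⟨h', hlt⟩⟩⟩⟩
        · refine ⟨k, ⟨⟨fun h => by omega, fun _ => ⟨a, ⟨ha, hak⟩, hlt'⟩⟩, fun h => by omega,
            fun _ => ⟨hk, fun s hs hks => ?_⟩⟩, Or.inr ⟨hk, Or.inr ⟨rfl, h', hlt⟩⟩⟩
          rcases hks.eq_or_lt with rfl | hks
          · exact le_rfl
          · exact ((hf2 (by omega)).2 s hs hks).trans hlt.le
  · have hne : a' ≠ k := fun h => hk (h ▸ hmem)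
    refine ⟨a', ⟨⟨fun h => ?_, fun h => ?_⟩, fun h => ?_, fun h => ⟨hmem, fun s hs hks => ?_⟩⟩,
      Or.inl ⟨rfl, hne, fun h => absurd h hk⟩⟩
    · exact ⟨⟨hmem, h⟩, fun s hs => (hp1 (by omega)).2 s ⟨hs.1, by have := hs.2; omega⟩⟩
    · obtain ⟨s, ⟨hs, hsk⟩, hlt⟩ := hp2 (by omega)
      refine ⟨s, ⟨hs, ?_⟩, hlt⟩
      have : s ≠ k := fun h => hk (h ▸ hs)
      omega
    · obtain ⟨s, hs, hks, hlt⟩ := hf1 (by omega)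
      exact ⟨s, hs, by omega, hlt⟩
    · have : s ≠ k := fun h => hk (h ▸ hs)
      exact (hf2 (by omega)).2 s hs (by omega)

/-- On its own side of `k` the element `a` exceeds `k`; on the other side something exceeds `a`. -/
theorem Source.under_of_keep (h : Source Z S k a) (ha : a ≠ k) (hlt : Z k < Z a) :
    Under Z S k := by
  obtain ⟨⟨h1, h2⟩, h3, h4⟩ := h
  rcases lt_or_gt_of_ne ha with h' | h'
  · obtain ⟨s, hs, hks, hlt'⟩ := h3 h'
    refine ⟨⟨a, (h1 h').1.1, h', hlt⟩, s, hs, ?_, hlt.trans hlt'⟩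
    rcases hks.eq_or_lt with rfl | h
    · linarith
    · exact h
  · obtain ⟨s, hs, hlt'⟩ := h2 h'.le
    exact ⟨⟨s, hs.1, hs.2, hlt.trans hlt'⟩, a, (h4 h'.le).1, h', hlt⟩

/-- The bounds of the slab after `k` when `k` is the first element. -/
theorem Source.of_first (h : Source Z S (k + 1) a') (h1 : ¬ ∃ s ∈ S, s < k) :
    k ∈ S ∧ (a' = k ∨ (k < a' ∧ Z a' < Z k ∧ ∀ s ∈ S, k < s → Z s ≤ Z a')) := by
  push Not at h1
  obtain ⟨⟨hp1, hp2⟩, hf1, hf2⟩ := h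
  rcases lt_or_ge a' (k + 1) with h' | h'
  · have := (hp1 h').1
    have := h1 a' this.1
    obtain rfl : a' = k := by omega
    exact ⟨(hp1 h').1.1, Or.inl rfl⟩
  · obtain ⟨s, ⟨hs, hsk⟩, hlt⟩ := hp2 h'
    have := h1 s hs
    obtain rfl : s = k := by omega
    exact ⟨hs, Or.inr ⟨h', hlt, (hf2 h').2⟩⟩

/-- The combinations of transitions of the two bounds that can replace both of them. -/
theorem move_move_cases (ha : Source Y S k a) (hb : Source (-Y) S k b)
    (ha' : Source Y S (k + 1) a') (hb' : Source (-Y) S (k + 1) b')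
    (h : Move Y k a a') (h' : Move (-Y) k b b') :
    (a = k ∧ k < a' ∧ Y a' < Y k ∧ b < k ∧ Y k < Y b ∧ b' = k) ∨
    (b = k ∧ k < b' ∧ Y k < Y b' ∧ a < k ∧ Y a < Y k ∧ a' = k) := by
  have hneg : ∀ i j, (-Y) i < (-Y) j ↔ Y j < Y i := fun i j => by simp
  have hneg' : ∀ i j, (-Y) i ≤ (-Y) j ↔ Y j ≤ Y i := fun i j => by simp
  simp only [Move, hneg] at h h'
  have fa := ha'.2.2
  have fb := hb'.2.2
  simp only [hneg'] at fb
  rcases h with ⟨h1, h2, h3⟩ | ⟨h1, h2, h3⟩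
  · rcases h' with ⟨g1, g2, -⟩ | ⟨g1, g2, g3⟩
    · have := (hb.1.1 g1).2 a ⟨ha.mem, h1⟩
      rw [hneg'] at this
      linarith
    · right
      refine ⟨g1, g2, g3, h1, h2, ?_⟩
      rcases h3 with h3 | ⟨h3, h4⟩
      · exact h3
      · have := (fa h3).2 b' hb'.mem g2
        linarith
  · rcases h' with ⟨g1, g2, g3⟩ | ⟨g1, g2, g3⟩
    · left
      refine ⟨h1, h2, h3, g1, g2, ?_⟩
      rcases g3 with g3 | ⟨g3, g4⟩
      · exact g3
      · have := (fa h2).2 b' hb'.mem g3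
        linarith
    · have := (fa h2).2 b' hb'.mem g2
      linarith

end Sweep
end

noncomputable section


namespace RealRAM

/-! ### Reasoning about programs -/

section States
variable (σ : State) (a b i j v : ℕ) (x : ℝ)

@[simp] theorem setInt_int : (σ.setInt a i v).int b j = if b = a ∧ j = i then v else σ.int b j :=
  rfl
@[simp] theorem setInt_real : (σ.setInt a i v).real = σ.real := rfl
@[simp] theorem setReal_int : (σ.setReal a i x).int = σ.int := rfl
@[simp] theorem setReal_real :
    (σ.setReal a i x).real b j = if b = a ∧ j = i then x else σ.real b j := rfl

theorem setInt_int_of_ne (h : b ≠ a) : (σ.setInt a i v).int b = σ.int b := by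
  funext j; simp [h]
theorem setReal_real_of_ne (h : b ≠ a) : (σ.setReal a i x).real b = σ.real b := by
  funext j; simp [h]

end States

/-- On a machine of size `M`, the program `s` started in `σ` halts after at most `T` steps in a
state that satisfies `Q`. -/
def Runs (M : ℕ) (s : Stmt) (σ : State) (T : ℕ) (Q : State → Prop) : Prop :=
  ∃ σ' t, Exec M s σ σ' t ∧ t ≤ T ∧ Q σ'

variable {M T T' : ℕ} {s s' : Stmt} {σ : State} {Q Q' : State → Prop}

theorem Runs.mono (h : Runs M s σ T Q) (hT : T ≤ T') (hQ : ∀ σ', Q σ' → Q' σ') :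
    Runs M s σ T' Q' := by
  obtain ⟨σ', t, h1, h2, h3⟩ := h
  exact ⟨σ', t, h1, h2.trans hT, hQ _ h3⟩

theorem Runs.imp (h : Runs M s σ T Q) (hQ : ∀ σ', Q σ' → Q' σ') : Runs M s σ T Q' :=
  h.mono le_rfl hQ

theorem Runs.skip (h : Q σ) : Runs M .skip σ 1 Q := ⟨σ, 1, .skip σ, le_rfl, h⟩

theorem Runs.setInt {a : ℕ} {i e : IExp} (hi : i.Fits M σ) (he : e.Fits M σ)
    (h : Q (σ.setInt a (i.eval σ) (e.eval σ))) :
    Runs M (.setInt a i e) σ (i.cost + e.cost + 1) Q :=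
  ⟨_, _, .setInt a i e σ hi he, le_rfl, h⟩

theorem Runs.setReal {a : ℕ} {i : IExp} {e : RExp} (hi : i.Fits M σ) (he : e.Fits M σ)
    (h : Q (σ.setReal a (i.eval σ) (e.eval σ))) :
    Runs M (.setReal a i e) σ (i.cost + e.cost + 1) Q :=
  ⟨_, _, .setReal a i e σ hi he, le_rfl, h⟩

theorem Runs.seq (h : Runs M s σ T Q') (h' : ∀ σ', Q' σ' → Runs M s' σ' T' Q) :
    Runs M (.seq s s') σ (T + T') Q := by
  obtain ⟨σ', t, h1, h2, h3⟩ := h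
  obtain ⟨σ'', t', g1, g2, g3⟩ := h' σ' h3
  exact ⟨σ'', t + t', .seq h1 g1, Nat.add_le_add h2 g2, g3⟩

theorem Runs.cond {b : BExp} (hf : b.Fits M σ) (h : b.Holds σ → Runs M s σ T Q)
    (h' : ¬ b.Holds σ → Runs M s' σ T' Q) :
    Runs M (.cond b s s') σ (b.cost + 1 + (T + T')) Q := by
  by_cases hb : b.Holds σ
  · obtain ⟨σ', t, h1, h2, h3⟩ := h hb
    exact ⟨σ', _, .condTrue hf hb h1, by omega, h3⟩
  · obtain ⟨σ', t, h1, h2, h3⟩ := h' hb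
    exact ⟨σ', _, .condFalse hf hb h1, by omega, h3⟩

/-- The integer variable with name `a`. -/
abbrev ivar (a : ℕ) : IExp := .get a (.lit 0)

/-- Execute `body` for the values `0, …, bound - 1` of the variable `x`. -/
def forLoop (x : ℕ) (bound : IExp) (body : Stmt) : Stmt :=
  .seq (.setInt x (.lit 0) (.lit 0))
    (.loop (.ilt (ivar x) bound)
      (.seq body (.setInt x (.lit 0) (.add (ivar x) (.lit 1)))))

/-- Here `m` counts the remaining rounds. A round costs the body, the test (`bound.cost + 4`) and
the increment (`6`); the last, failing test costs `bound.cost + 4`. -/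
theorem Runs.forLoop_aux {x B : ℕ} {bound : IExp} {body : Stmt} {I : ℕ → State → Prop}
    (hB : B < M) (hM : 1 < M)
    (hbound : ∀ j σ, I j σ → bound.Fits M σ ∧ bound.eval σ = B)
    (hbody : ∀ j < B, ∀ σ, I j σ → σ.int x 0 = j → Runs M body σ T fun σ' =>
      σ'.int x 0 = j ∧ I (j + 1) (σ'.setInt x 0 (j + 1))) (m : ℕ) :
    ∀ j σ, j + m = B → I j σ → σ.int x 0 = j →
      Runs M (.loop (.ilt (ivar x) bound)
        (.seq body (.setInt x (.lit 0) (.add (ivar x) (.lit 1))))) σ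
        (m * (T + bound.cost + 10) + bound.cost + 4) (fun σ' => I B σ' ∧ σ'.int x 0 = B) := by
  induction m with
  | zero =>
    intro j σ hj hI hx
    obtain ⟨hb1, hb2⟩ := hbound j σ hI
    refine ⟨σ, _, .loopFalse (b := .ilt (ivar x) bound) ?_ ?_, ?_, ?_⟩
    · simp only [BExp.Fits, IExp.Fits, IExp.eval, hx]
      exact ⟨⟨by omega, by omega⟩, hb1⟩
    · simp only [BExp.Holds, IExp.eval, hx, hb2]; omega
    · simp only [BExp.cost, IExp.cost]; omega
    · obtain rfl : j = B := by omega
      exact ⟨hI, hx⟩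
  | succ m ih =>
    intro j σ hj hI hx
    obtain ⟨hb1, hb2⟩ := hbound j σ hI
    obtain ⟨σ₁, t₁, h1, h2, h3, h4⟩ := hbody j (by omega) σ hI hx
    obtain ⟨σ₂, t₂, g1, g2, g3⟩ := ih (j + 1) (σ₁.setInt x 0 (j + 1)) (by omega) h4 (by simp)
    have e : Exec M (.setInt x (.lit 0) (.add (ivar x) (.lit 1))) σ₁ (σ₁.setInt x 0 (j + 1)) 6 := by
      have := Exec.setInt (M := M) x (.lit 0) (.add (ivar x) (.lit 1)) σ₁
        (by simp only [IExp.Fits]; omega)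
        (by simp only [IExp.Fits, IExp.eval, h3]; omega)
      simpa only [IExp.eval, h3, IExp.cost] using this
    refine ⟨σ₂, _, .loopTrue (b := .ilt (ivar x) bound) ?_ ?_ (.seq h1 e) g1, ?_, g3⟩
    · simp only [BExp.Fits, IExp.Fits, IExp.eval, hx]
      exact ⟨⟨by omega, by omega⟩, hb1⟩
    · simp only [BExp.Holds, IExp.eval, hx, hb2]; omega
    · simp only [BExp.cost, IExp.cost]
      have : (m + 1) * (T + bound.cost + 10) = m * (T + bound.cost + 10) + (T + bound.cost + 10) :=
        Nat.succ_mul _ _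
      omega

/-- The rule for loops: `I j` is the invariant after `j` rounds. -/
theorem Runs.forLoop {x B : ℕ} {bound : IExp} {body : Stmt} (I : ℕ → State → Prop)
    (hB : B < M) (hM : 1 < M)
    (hbound : ∀ j σ, I j σ → bound.Fits M σ ∧ bound.eval σ = B)
    (hbody : ∀ j < B, ∀ σ, I j σ → σ.int x 0 = j → Runs M body σ T fun σ' =>
      σ'.int x 0 = j ∧ I (j + 1) (σ'.setInt x 0 (j + 1)))
    (h0 : I 0 (σ.setInt x 0 0)) :
    Runs M (forLoop x bound body) σ ((T + bound.cost + 10) * (B + 1)) (I B) := by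
  have h1 : Runs M (.setInt x (.lit 0) (.lit 0)) σ 3 fun σ' => σ' = σ.setInt x 0 0 :=
    Runs.setInt (by simp only [IExp.Fits]; omega) (by simp only [IExp.Fits]; omega) rfl
  have h2 := Runs.seq h1 (T' := B * (T + bound.cost + 10) + bound.cost + 4) (Q := I B)
    (s' := .loop (.ilt (ivar x) bound)
        (.seq body (.setInt x (.lit 0) (.add (ivar x) (.lit 1))))) fun σ' hσ' => by
      subst hσ'
      exact (Runs.forLoop_aux hB hM hbound hbody B 0 _ (by omega) h0 (by simp)).imp
        fun _ h => h.1
  refine h2.mono ?_ fun _ h => h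
  have : (T + bound.cost + 10) * (B + 1) = B * (T + bound.cost + 10) + (T + bound.cost + 10) := by
    ring
  omega

end RealRAM
end

noncomputable section


namespace RealRAM

variable {M T T' n k : ℕ} {s s' : Stmt} {σ σ₀ : State} {Q Q' : State → Prop}

/-- A bound for the number of steps of a program without loops. -/
def Stmt.bound : Stmt → ℕ
  | skip => 1
  | setInt _ i e => i.cost + e.cost + 1
  | setReal _ i e => i.cost + e.cost + 1
  | seq s t => s.bound + t.bound
  | cond b s t => b.cost + 1 + (s.bound + t.bound)
  | loop _ _ => 0

theorem IExp.eval_congr {σ σ' : State} (h : σ'.int = σ.int) (e : IExp) : e.eval σ' = e.eval σ := by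
  induction e <;> simp_all [IExp.eval]

theorem IExp.fits_congr {σ σ' : State} (h : σ'.int = σ.int) (e : IExp) :
    e.Fits M σ' ↔ e.Fits M σ := by
  induction e <;> simp_all [IExp.Fits, IExp.eval_congr h]

/-! ### Rules -/

/-- A rule: under the condition `g`, the entry `s` of the table with values in the real array `tv`
and links in the integer array `tp` is a candidate for the entry `d` of the table `5`, `4`. -/
structure Rule where
  g : BExp
  tv : ℕ
  tp : ℕ
  s : IExp
  d : IExp

/-- Copy the source of the rule to its destination if this is an improvement. -/
def Rule.stmt (r : Rule) : Stmt :=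
  .cond r.g
    (.cond (.ieq (.get r.tp r.s) (.lit 0)) .skip
      (.cond (.and (.not (.ieq (.get 4 r.d) (.lit 0))) (.not (.rlt (.get 5 r.d) (.get r.tv r.s))))
        .skip
        (.seq (.setReal 5 r.d (.get r.tv r.s)) (.setInt 4 r.d (.get r.tp r.s)))))
    .skip

/-- The effect of a rule. -/
structure Rule.Effect (r : Rule) (σ σ' : State) : Prop where
  int : ∀ a ≠ 4, σ'.int a = σ.int a
  real : ∀ a ≠ 5, σ'.real a = σ.real a
  sound : ∀ d, (σ'.int 4 d = σ.int 4 d ∧ σ'.real 5 d = σ.real 5 d) ∨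
    (r.g.Holds σ ∧ σ.int r.tp (r.s.eval σ) ≠ 0 ∧ d = r.d.eval σ ∧
      σ'.int 4 d = σ.int r.tp (r.s.eval σ) ∧ σ'.real 5 d = σ.real r.tv (r.s.eval σ))
  complete : r.g.Holds σ → σ.int r.tp (r.s.eval σ) ≠ 0 →
    σ'.int 4 (r.d.eval σ) ≠ 0 ∧ σ.real r.tv (r.s.eval σ) ≤ σ'.real 5 (r.d.eval σ)
  mono : ∀ d, σ.int 4 d ≠ 0 → σ'.int 4 d ≠ 0 ∧ σ.real 5 d ≤ σ'.real 5 d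

/-- The link `0` marks a missing entry and plays the role of the value `-∞`; the real cell matters
only when the link is nonzero. -/
theorem Rule.runs (r : Rule) (hM : 0 < M) (hg : r.g.Fits M σ)
    (h : r.g.Holds σ → r.s.Fits M σ ∧ r.d.Fits M σ ∧ σ.int r.tp (r.s.eval σ) < M ∧
      σ.int 4 (r.d.eval σ) < M) : Runs M r.stmt σ r.stmt.bound (r.Effect σ) := by
  have htriv : (¬ r.g.Holds σ ∨ σ.int r.tp (r.s.eval σ) = 0 ∨ (σ.int 4 (r.d.eval σ) ≠ 0 ∧
      σ.real r.tv (r.s.eval σ) ≤ σ.real 5 (r.d.eval σ))) → r.Effect σ σ := by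
    intro h
    refine ⟨fun _ _ => rfl, fun _ _ => rfl, fun _ => Or.inl ⟨rfl, rfl⟩, fun h1 h2 => ?_,
      fun d hd => ⟨hd, le_rfl⟩⟩
    rcases h with h | h | h
    · exact absurd h1 h
    · exact absurd h h2
    · exact h
  refine Runs.cond hg (fun hgh => ?_) fun hgh => Runs.skip (htriv (Or.inl hgh))
  obtain ⟨h1, h2, h3, h4⟩ := h hgh
  refine Runs.cond ⟨⟨h1, h3⟩, hM⟩ (fun h0 => Runs.skip (htriv (Or.inr (Or.inl h0)))) fun h0 => ?_
  change ¬ (σ.int r.tp (r.s.eval σ) = 0) at h0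
  refine Runs.cond ⟨⟨⟨h2, h4⟩, hM⟩, h2, h1⟩ (fun hi => Runs.skip (htriv (Or.inr (Or.inr ?_))))
    fun hi => ?_
  · simpa [BExp.Holds, IExp.eval, RExp.eval] using hi
  · simp only [BExp.Holds, IExp.eval, RExp.eval, not_and, not_not] at hi
    refine Runs.seq (Q' := fun σ' => σ' = σ.setReal 5 (r.d.eval σ) (σ.real r.tv (r.s.eval σ)))
      (Runs.setReal h2 h1 rfl) fun σ' hσ' => ?_
    have hint : σ'.int = σ.int := by rw [hσ']; rfl
    refine Runs.setInt ((IExp.fits_congr hint _).2 h2) (IExp.Fits.eq_def M σ' _ ▸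
      ⟨(IExp.fits_congr hint _).2 h1, by rw [IExp.eval_congr hint, hint]; exact h3⟩) ?_
    simp only [IExp.eval, IExp.eval_congr hint]
    subst hσ'
    refine ⟨fun a ha => by rw [setInt_int_of_ne _ _ _ _ _ ha]; rfl,
      fun a ha => by rw [setInt_real, setReal_real_of_ne _ _ _ _ _ ha], fun d => ?_,
      fun _ _ => ?_, fun d hd => ?_⟩
    · by_cases hd : d = r.d.eval σ
      · right
        simp [hd, hgh, h0]
      · left
        simp [hd]
    · simp [h0]
    · by_cases hd' : d = r.d.eval σ
      · subst hd'
        simpa [h0] using (hi hd).le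
      · simp [hd', hd]

/-! ### Passes -/

abbrev vN : IExp := ivar 0
abbrev vK : IExp := ivar 7
abbrev vU : IExp := ivar 8
abbrev vV : IExp := ivar 9
abbrev vC : IExp := ivar 10

/-- The index of an entry of a square table. -/
def idx (e f : IExp) : IExp := .add (.mul e vN) f

theorem idx_lt {u v : ℕ} (hu : u < n) (hv : v < n) : u * n + v < n * n := by nlinarith

theorem idx_inj {u v u' v' : ℕ} (hv : v < n) (hv' : v' < n) (h : u * n + v = u' * n + v') :
    u = u' ∧ v = v' := by
  have h1 : (u * n + v) / n = u := by
    rw [mul_comm, Nat.mul_add_div (by omega), Nat.div_eq_of_lt hv, add_zero]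
  have h2 : (u' * n + v') / n = u' := by
    rw [mul_comm, Nat.mul_add_div (by omega), Nat.div_eq_of_lt hv', add_zero]
  have : u = u' := by rw [← h1, ← h2, h]
  subst this
  exact ⟨rfl, by omega⟩

/-- The loop over all pairs of values of the variables `8` and `9`. -/
def for2 (body : Stmt) : Stmt := forLoop 8 vN (forLoop 9 vN body)

theorem ivar_fits {a : ℕ} (hM : 0 < M) (h : σ.int a 0 < M) : (ivar a).Fits M σ := ⟨hM, h⟩

/-- The invariant follows the lexicographic order, with `(u, n)` passed on to `(u + 1, 0)`. The
constant `12` is the loop overhead `10` plus the cost `2` of reading `n`. -/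
theorem Runs.for2 {body : Stmt} (I : ℕ → ℕ → State → Prop) (hn : n < M) (hM : 1 < M)
    (hN : ∀ u v σ, I u v σ → σ.int 0 0 = n)
    (hset : ∀ u v σ a c, a = 8 ∨ a = 9 → I u v σ → I u v (σ.setInt a 0 c))
    (hbody : ∀ u < n, ∀ v < n, ∀ σ, I u v σ → σ.int 8 0 = u → σ.int 9 0 = v →
      Runs M body σ T fun σ' => σ'.int 8 0 = u ∧ σ'.int 9 0 = v ∧ I u (v + 1) σ')
    (hrow : ∀ u < n, ∀ σ, I u n σ → I (u + 1) 0 σ) (h0 : I 0 0 σ) :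
    Runs M (for2 body) σ (((T + 12) * (n + 1) + 12) * (n + 1)) (I n 0) := by
  have hb : ∀ σ, σ.int 0 0 = n → vN.Fits M σ ∧ vN.eval σ = n := fun σ h =>
    ⟨ivar_fits (by omega) (by omega), h⟩
  refine Runs.forLoop (T := (T + 12) * (n + 1)) (fun u => I u 0) hn hM
    (fun j σ h => hb σ (hN _ _ _ h)) (fun u hu σ hI h8 => ?_) (hset _ _ _ _ _ (Or.inl rfl) h0)
  refine (Runs.forLoop (T := T) (fun v σ => I u v σ ∧ σ.int 8 0 = u) hn hM
    (fun j σ h => hb σ (hN _ _ _ h.1)) (fun v hv σ hI h9 => ?_)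
    ⟨hset _ _ _ _ _ (Or.inr rfl) hI, by simpa using h8⟩).imp fun σ' h =>
      ⟨h.2, hset _ _ _ _ _ (Or.inl rfl) (hrow u hu _ h.1)⟩
  exact (hbody u hu v hv σ hI.1 hI.2 h9).imp fun σ' h =>
    ⟨h.2.1, hset _ _ _ _ _ (Or.inr rfl) h.2.2, by simpa using h.1⟩

/-- Execute the programs of a list one after another. -/
def seqs : List Stmt → Stmt
  | [] => .skip
  | s :: l => .seq s (seqs l)

/-- The values of the variables. -/
structure Env (n k u v : ℕ) (σ : State) : Prop where
  n : σ.int 0 0 = n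
  k : σ.int 7 0 = k
  u : σ.int 8 0 = u
  v : σ.int 9 0 = v

/-- A rule together with its meaning in terms of the values of the variables. -/
structure RuleSpec (M n k : ℕ) (Y : ℕ → ℝ) where
  rule : Rule
  G : ℕ → ℕ → Prop
  S : ℕ → ℕ → ℕ
  D : ℕ → ℕ → ℕ
  table : (rule.tp = 3 ∧ rule.tv = 4) ∨ (rule.tp = 4 ∧ rule.tv = 5)
  spec : ∀ σ u v, u < n → v < n → Env n k u v σ → σ.real 3 = Y →
    rule.g.Fits M σ ∧ (rule.g.Holds σ ↔ G u v) ∧ (G u v → rule.s.Fits M σ ∧ rule.d.Fits M σ ∧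
      rule.s.eval σ = S u v ∧ rule.d.eval σ = D u v)

/-- What holds throughout a pass that starts in the state `σ₀`. -/
structure PassInv (Tgt : ℕ → ℝ → ℕ → Prop) (σ₀ σ : State) : Prop where
  int : ∀ a, a ≠ 4 → a ≠ 8 → a ≠ 9 → σ.int a = σ₀.int a
  real : ∀ a ≠ 5, σ.real a = σ₀.real a
  sound : ∀ d, σ.int 4 d ≠ 0 → Tgt d (σ.real 5 d) (σ.int 4 d)
  mono : ∀ d, σ₀.int 4 d ≠ 0 → σ.int 4 d ≠ 0 ∧ σ₀.real 5 d ≤ σ.real 5 d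

variable {Y : ℕ → ℝ} {Tgt : ℕ → ℝ → ℕ → Prop}

/-- The destination of the rule is at least as good as its source in the state `σ₀`. -/
def RuleSpec.Done (R : RuleSpec M n k Y) (σ₀ : State) (u v : ℕ) (σ : State) : Prop :=
  R.G u v → σ₀.int R.rule.tp (R.S u v) ≠ 0 →
    σ.int 4 (R.D u v) ≠ 0 ∧ σ₀.real R.rule.tv (R.S u v) ≤ σ.real 5 (R.D u v)

/-- The rule is sound with respect to the predicate `Tgt` on the entries. -/
def RuleSpec.Sound (R : RuleSpec M n k Y) (Tgt : ℕ → ℝ → ℕ → Prop) (σ₀ : State) : Prop :=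
  ∀ u < n, ∀ v < n, R.G u v → ∀ x p, p ≠ 0 →
    (R.rule.tp = 3 → x = σ₀.real 4 (R.S u v) ∧ p = σ₀.int 3 (R.S u v)) →
    (R.rule.tp = 4 → Tgt (R.S u v) x p) → Tgt (R.D u v) x p

/-- A rule may read the very table that is being written. This is harmless: every entry stays valid,
and entries only improve, so a rule finds at least what was there in `σ₀`. -/
theorem RuleSpec.runs_list (L : List (RuleSpec M n k Y)) {u v : ℕ} (hu : u < n) (hv : v < n)
    (hM : 0 < M) (h3 : ∀ d, σ₀.int 3 d < M) (hT : ∀ d x p, Tgt d x p → p < M)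
    (hn : σ₀.int 0 0 = n) (hk : σ₀.int 7 0 = k) (hY : σ₀.real 3 = Y)
    (hs : ∀ R ∈ L, R.Sound Tgt σ₀) :
    ∀ σ, PassInv Tgt σ₀ σ → σ.int 8 0 = u → σ.int 9 0 = v →
      Runs M (seqs (L.map fun R => R.rule.stmt)) σ (seqs (L.map fun R => R.rule.stmt)).bound
        fun σ' => σ'.int 8 0 = u ∧ σ'.int 9 0 = v ∧ PassInv Tgt σ₀ σ' ∧ PassInv Tgt σ σ' ∧
          ∀ R ∈ L, R.Done σ₀ u v σ' := by
  induction L with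
  | nil =>
    intro σ hI h8 h9
    exact Runs.skip ⟨h8, h9, hI, ⟨fun _ _ _ _ => rfl, fun _ _ => rfl, hI.sound,
      fun d hd => ⟨hd, le_rfl⟩⟩, by simp⟩
  | cons R L ih =>
    intro σ hI h8 h9
    have h4 : ∀ d, σ.int 4 d < M := fun d => by
      by_cases hd : σ.int 4 d = 0
      · omega
      · exact hT _ _ _ (hI.sound d hd)
    obtain ⟨e1, e2, e3⟩ := R.spec σ u v hu hv
      ⟨by rw [hI.int 0 (by omega) (by omega) (by omega), hn],
       by rw [hI.int 7 (by omega) (by omega) (by omega), hk], h8, h9⟩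
      (by rw [hI.real 3 (by omega), hY])
    have hrun := R.rule.runs hM e1 fun hg => by
      obtain ⟨f1, f2, f3, f4⟩ := e3 (e2.1 hg)
      refine ⟨f1, f2, ?_, h4 _⟩
      rcases R.table with ⟨ht, -⟩ | ⟨ht, -⟩
      · rw [ht, hI.int 3 (by omega) (by omega) (by omega)]; exact h3 _
      · rw [ht]; exact h4 _
    refine Runs.seq hrun fun σ₁ hE => ?_
    have hI₁ : PassInv Tgt σ σ₁ := by
      refine ⟨fun a h _ _ => hE.int a h, hE.real, fun d hd => ?_, hE.mono⟩
      rcases hE.sound d with ⟨g1, g2⟩ | ⟨g1, g2, g3, g4, g5⟩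
      · rw [g1] at hd
        rw [g1, g2]; exact hI.sound d hd
      · have hG := e2.1 g1
        obtain ⟨f1, f2, f3, f4⟩ := e3 hG
        rw [g4, g5, g3, f4, f3]
        rw [f3] at g2
        refine hs R (by simp) u hu v hv hG _ _ g2 (fun ht => ?_) fun ht => ?_
        · rcases R.table with ⟨-, ht'⟩ | ⟨ht', -⟩
          · rw [ht, ht', hI.int 3 (by omega) (by omega) (by omega), hI.real 4 (by omega)]
            exact ⟨rfl, rfl⟩
          · omega
        · rcases R.table with ⟨ht', -⟩ | ⟨-, ht'⟩
          · omega
          · rw [ht] at g2 ⊢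
            rw [ht']
            exact hI.sound _ g2
    have hI₀ : PassInv Tgt σ₀ σ₁ :=
      ⟨fun a h h' h'' => (hI₁.int a h h' h'').trans (hI.int a h h' h''),
        fun a h => (hI₁.real a h).trans (hI.real a h), hI₁.sound, fun d hd =>
          ⟨(hI₁.mono d (hI.mono d hd).1).1, (hI.mono d hd).2.trans
            (hI₁.mono d (hI.mono d hd).1).2⟩⟩
    refine (ih (fun R hR => hs R (by simp [hR])) σ₁ hI₀ (by rw [hE.int 8 (by omega), h8])
      (by rw [hE.int 9 (by omega), h9])).imp fun σ₂ ⟨a1, a2, a3, a4, a5⟩ => ⟨a1, a2, a3, ?_, ?_⟩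
    · exact ⟨fun a h h' h'' => (a4.int a h h' h'').trans (hI₁.int a h h' h''),
        fun a h => (a4.real a h).trans (hI₁.real a h), a4.sound, fun d hd =>
          ⟨(a4.mono d (hI₁.mono d hd).1).1, (hI₁.mono d hd).2.trans
            (a4.mono d (hI₁.mono d hd).1).2⟩⟩
    · intro R' hR'
      rcases List.mem_cons.1 hR' with rfl | hR'
      · intro hG hsrc
        obtain ⟨f1, f2, f3, f4⟩ := e3 hG
        have hsrc' : σ.int R'.rule.tp (R'.S u v) ≠ 0 ∧
            σ₀.real R'.rule.tv (R'.S u v) ≤ σ.real R'.rule.tv (R'.S u v) := by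
          rcases R'.table with ⟨t1, t2⟩ | ⟨t1, t2⟩
          · rw [t1] at hsrc
            rw [t1, t2, hI.int 3 (by omega) (by omega) (by omega), hI.real 4 (by omega)]
            exact ⟨hsrc, le_rfl⟩
          · rw [t1] at hsrc
            rw [t1, t2]
            exact hI.mono _ hsrc
        have := hE.complete (e2.2 hG) (by rw [f3]; exact hsrc'.1)
        rw [f3, f4] at this
        have h2 := a4.mono _ this.1
        exact ⟨h2.1, hsrc'.2.trans (this.2.trans h2.2)⟩
      · exact a5 R' hR'

/-- A pass applies all rules of a list for all values of the loop variables. -/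
theorem RuleSpec.runs_pass (L : List (RuleSpec M n k Y)) (hM : 1 < M) (hnM : n < M)
    (h3 : ∀ d, σ₀.int 3 d < M) (hT : ∀ d x p, Tgt d x p → p < M)
    (hn : σ₀.int 0 0 = n) (hk : σ₀.int 7 0 = k) (hY : σ₀.real 3 = Y)
    (hs : ∀ R ∈ L, R.Sound Tgt σ₀) (h4 : ∀ d, σ₀.int 4 d ≠ 0 → Tgt d (σ₀.real 5 d) (σ₀.int 4 d)) :
    Runs M (for2 (seqs (L.map fun R => R.rule.stmt))) σ₀
      ((((seqs (L.map fun R => R.rule.stmt)).bound + 12) * (n + 1) + 12) * (n + 1)) fun σ =>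
        PassInv Tgt σ₀ σ ∧ ∀ R ∈ L, ∀ u < n, ∀ v < n, R.Done σ₀ u v σ := by
  refine (Runs.for2 (fun u v σ => PassInv Tgt σ₀ σ ∧ ∀ R ∈ L, ∀ u' < n, ∀ v' < n,
    u' < u ∨ (u' = u ∧ v' < v) → R.Done σ₀ u' v' σ) hnM hM
    (fun u v σ h => by rw [h.1.int 0 (by omega) (by omega) (by omega), hn])
    (fun u v σ a c ha h => ?_) (fun u hu v hv σ hI h8 h9 => ?_) (fun u hu σ h => ?_) ?_).imp
    fun σ h => ⟨h.1, fun R hR u hu v hv => h.2 R hR u hu v hv (Or.inl hu)⟩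
  · have e4 : (σ.setInt a 0 c).int 4 = σ.int 4 := setInt_int_of_ne _ _ _ _ _ (by omega)
    refine ⟨⟨fun b b4 b8 b9 => ?_, fun b hb => h.1.real b hb, fun d hd => ?_, fun d hd => ?_⟩, ?_⟩
    · rw [setInt_int_of_ne _ _ _ _ _ (by omega)]; exact h.1.int b b4 b8 b9
    · rw [e4] at hd ⊢; exact h.1.sound d hd
    · rw [e4]; exact h.1.mono d hd
    · intro R hR u' hu' v' hv' hlt
      have := h.2 R hR u' hu' v' hv' hlt
      simpa only [Done, e4, setInt_real] using this
  · refine (runs_list L hu hv (by omega) h3 hT hn hk hY hs σ hI.1 h8 h9).imp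
      fun σ' ⟨a1, a2, a3, a4, a5⟩ => ⟨a1, a2, a3, fun R hR u' hu' v' hv' hlt => ?_⟩
    by_cases hnew : u' = u ∧ v' = v
    · rw [hnew.1, hnew.2]; exact a5 R hR
    · intro hG hsrc
      have := hI.2 R hR u' hu' v' hv' (by omega) hG hsrc
      have h2 := a4.mono _ this.1
      exact ⟨h2.1, this.2.trans h2.2⟩
  · exact ⟨h.1, fun R hR u' hu' v' hv' hlt => h.2 R hR u' hu' v' hv' (by omega)⟩
  · exact ⟨⟨fun _ _ _ _ => rfl, fun _ _ => rfl, h4, fun d hd => ⟨hd, le_rfl⟩⟩,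
      fun R hR u' hu' v' hv' hlt => by omega⟩

end RealRAM
end

noncomputable section


namespace RealRAM

variable {M T T' n k : ℕ} {s s' : Stmt} {σ σ₀ : State} {Q Q' : State → Prop}

/-! ### Linked lists -/

/-- The list that starts at a node consists of the elements of the given set. The node `i` holds
the element `pt i` and is followed by the node `par i`; the empty list is represented by `0`. -/
inductive Chain (pt par : ℕ → ℕ) : ℕ → Set ℕ → Prop
  | nil : Chain pt par 0 ∅
  | cons {i : ℕ} {C : Set ℕ} (h : par i < i) (hC : Chain pt par (par i) C) :
      Chain pt par i (insert (pt i) C)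

/-- Links strictly decrease, so a list that starts below `c` uses no node from `c` on. New nodes
never disturb old lists, and tails can be shared. -/
theorem Chain.congr {pt par pt' par' : ℕ → ℕ} {c i : ℕ} {C : Set ℕ}
    (h : Chain pt par i C) (hi : i < c) (h1 : ∀ j < c, pt' j = pt j)
    (h2 : ∀ j < c, par' j = par j) : Chain pt' par' i C := by
  induction h with
  | nil => exact .nil
  | @cons i C h hC ih =>
    rw [← h1 i hi]
    refine .cons (by rw [h2 i hi]; exact h) ?_
    rw [h2 i hi]
    exact ih (h.trans hi)

/-- The list in the node arrays of a state. -/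
abbrev ChainIn (σ : State) : ℕ → Set ℕ → Prop := Chain (σ.int 5) (σ.int 6)

/-- Append the element in the variable `7` to the list at entry `d` of the array `tp`. -/
def push (tp : ℕ) (d : IExp) : Stmt :=
  .cond (.ieq (.get tp d) (.lit 0)) .skip
    (.seq (.setInt 5 vC vK) (.seq (.setInt 6 vC (.get tp d))
      (.seq (.setInt tp d vC) (.setInt 10 (.lit 0) (.add vC (.lit 1))))))

/-- The effect of appending `k` to some of the lists in the array `tp`, those with indices in
`D`. -/
structure Pushed (tp k m : ℕ) (D : Set ℕ) (σ₀ σ : State) : Prop where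
  int : ∀ a, a ≠ 5 → a ≠ 6 → a ≠ 9 → a ≠ 10 → a ≠ tp → σ.int a = σ₀.int a
  real : σ.real = σ₀.real
  le : σ₀.int 10 0 ≤ σ.int 10 0
  count : σ.int 10 0 ≤ σ₀.int 10 0 + m
  lt : ∀ d, σ.int tp d < σ.int 10 0
  zero : ∀ d, σ.int tp d = 0 ↔ σ₀.int tp d = 0
  ne : ∀ d ∉ D, σ.int tp d = σ₀.int tp d
  old : ∀ i < σ₀.int 10 0, ∀ C, ChainIn σ₀ i C → ChainIn σ i C
  new : ∀ d ∈ D, σ₀.int tp d ≠ 0 → ∀ C, ChainIn σ₀ (σ₀.int tp d) C →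
    ChainIn σ (σ.int tp d) (insert k C)

theorem Pushed.set9 {tp m : ℕ} {D : Set ℕ} (h : Pushed tp k m D σ₀ σ)
    (htp : tp = 3 ∨ tp = 4) (c : ℕ) : Pushed tp k m D σ₀ (σ.setInt 9 0 c) := by
  have e : ∀ a ≠ 9, (σ.setInt 9 0 c).int a = σ.int a := fun a ha => setInt_int_of_ne _ _ _ _ _ ha
  refine ⟨fun a h5 h6 h9 h10 ht => ?_, ?_, ?_, ?_, ?_, ?_, ?_, ?_, ?_⟩
  · rw [e a h9]; exact h.int a h5 h6 h9 h10 ht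
  · exact h.real
  · rw [e 10 (by omega)]; exact h.le
  · rw [e 10 (by omega)]; exact h.count
  · rw [e 10 (by omega), e tp (by omega)]; exact h.lt
  · rw [e tp (by omega)]; exact h.zero
  · rw [e tp (by omega)]; exact h.ne
  · unfold ChainIn; rw [e 5 (by omega), e 6 (by omega)]; exact h.old
  · unfold ChainIn; rw [e 5 (by omega), e 6 (by omega), e tp (by omega)]; exact h.new

/-- The address `d` is evaluated again after the node arrays `5` and `6` have changed, so its value
must not depend on them. -/
theorem push_runs {tp m : ℕ} {D : Set ℕ} {d : IExp} (htp : tp = 3 ∨ tp = 4)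
    (h : Pushed tp k m D σ₀ σ) (hlt : ∀ d, σ₀.int tp d < σ₀.int 10 0)
    (hk : σ.int 7 0 = k) (hkM : k < M) (hcM : σ₀.int 10 0 + m + 1 < M)
    (hd : ∀ σ' : State, (∀ a, a ≠ 5 → a ≠ 6 → σ'.int a = σ.int a) →
      d.Fits M σ' ∧ d.eval σ' = d.eval σ) :
    Runs M (push tp d) σ (push tp d).bound fun σ' =>
      Pushed tp k (m + 1) (insert (d.eval σ) D) σ₀ σ' ∧
        ∀ a, a ≠ 5 → a ≠ 6 → a ≠ 10 → a ≠ tp → σ'.int a = σ.int a := by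
  have hc := h.count
  have hle := h.le
  have hdσ := (hd σ fun _ _ _ => rfl).1
  have hptr := h.lt (d.eval σ)
  refine Runs.cond ⟨⟨hdσ, by omega⟩, (by omega : 0 < M)⟩ (fun h0 => Runs.skip ⟨?_, fun _ _ _ _ _ => rfl⟩)
    fun h0 => ?_
  · change σ.int tp (d.eval σ) = 0 at h0
    refine ⟨h.int, h.real, h.le, by omega, h.lt, h.zero, fun d' hd' => h.ne d' fun h' =>
      hd' (Or.inr h'), h.old, ?_⟩
    rintro d' (rfl | hd') hne
    · exact absurd ((h.zero _).1 h0) hne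
    · exact h.new d' hd' hne
  · change ¬ σ.int tp (d.eval σ) = 0 at h0
    set c := σ.int 10 0 with hcdef
    set D' := d.eval σ with hD'
    refine Runs.seq (Q' := fun σ₁ => σ₁ = σ.setInt 5 c k)
      (Runs.setInt ⟨(by omega : 0 < M), by change c < M; omega⟩
        ⟨(by omega : 0 < M), by change σ.int 7 0 < M; omega⟩
        (by simp only [IExp.eval, hk, hcdef])) fun σ₁ h₁ => ?_
    obtain ⟨f1, f2⟩ := hd σ₁ fun a h5 h6 => by rw [h₁, setInt_int_of_ne _ _ _ _ _ h5]
    have t1 : σ₁.int tp = σ.int tp := by rw [h₁, setInt_int_of_ne _ _ _ _ _ (by omega)]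
    have c1 : σ₁.int 10 0 = c := by rw [h₁, setInt_int_of_ne _ _ _ _ _ (by omega)]
    refine Runs.seq (Q' := fun σ₂ => σ₂ = σ₁.setInt 6 c (σ.int tp D'))
      (Runs.setInt ⟨(by omega : 0 < M), by change σ₁.int 10 0 < M; omega⟩
        ⟨f1, by rw [f2, t1]; omega⟩
        (by simp only [IExp.eval, c1, f2, t1])) fun σ₂ h₂ => ?_
    obtain ⟨g1, g2⟩ := hd σ₂ fun a h5 h6 => by
      rw [h₂, setInt_int_of_ne _ _ _ _ _ h6, h₁, setInt_int_of_ne _ _ _ _ _ h5]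
    have c2 : σ₂.int 10 0 = c := by rw [h₂, setInt_int_of_ne _ _ _ _ _ (by omega), c1]
    refine Runs.seq (Q' := fun σ₃ => σ₃ = σ₂.setInt tp D' c)
      (Runs.setInt g1 ⟨(by omega : 0 < M), by change σ₂.int 10 0 < M; omega⟩
        (by simp only [IExp.eval, c2, g2])) fun σ₃ h₃ => ?_
    have c3 : σ₃.int 10 0 = c := by rw [h₃, setInt_int_of_ne _ _ _ _ _ (by omega), c2]
    have hM0 : 0 < M := by omega
    refine Runs.setInt hM0 ⟨⟨hM0, by change σ₃.int 10 0 < M; omega⟩, (by omega : 1 < M),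
      by simp only [IExp.eval, c3]; omega⟩ ?_
    simp only [IExp.eval, c3]
    set τ := σ₃.setInt 10 0 (c + 1) with hτ
    have e0 : ∀ a, a ≠ 5 → a ≠ 6 → a ≠ 10 → a ≠ tp → τ.int a = σ.int a := by
      intro a h5 h6 h10 ht
      rw [hτ, setInt_int_of_ne _ _ _ _ _ h10, h₃, setInt_int_of_ne _ _ _ _ _ ht, h₂,
        setInt_int_of_ne _ _ _ _ _ h6, h₁, setInt_int_of_ne _ _ _ _ _ h5]
    have e5 : ∀ j, τ.int 5 j = if j = c then k else σ.int 5 j := by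
      intro j
      rw [hτ, setInt_int_of_ne _ _ _ _ _ (by omega), h₃, setInt_int_of_ne _ _ _ _ _ (by omega),
        h₂, setInt_int_of_ne _ _ _ _ _ (by omega), h₁]
      simp
    have e6 : ∀ j, τ.int 6 j = if j = c then σ.int tp D' else σ.int 6 j := by
      intro j
      rw [hτ, setInt_int_of_ne _ _ _ _ _ (by omega), h₃, setInt_int_of_ne _ _ _ _ _ (by omega),
        h₂]
      simp [h₁]
    have et : ∀ j, τ.int tp j = if j = D' then c else σ.int tp j := by
      intro j
      rw [hτ, setInt_int_of_ne _ _ _ _ _ (by omega), h₃]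
      simp only [setInt_int, true_and, h₂, h₁]
      rcases htp with rfl | rfl <;> simp
    have e10 : τ.int 10 0 = c + 1 := by simp [hτ]
    have hold : ∀ i < c, ∀ C, ChainIn σ i C → ChainIn τ i C := fun i hi C hC =>
      hC.congr hi (fun j hj => by rw [e5, if_neg hj.ne]) (fun j hj => by rw [e6, if_neg hj.ne])
    have hcons : ∀ C, ChainIn σ (σ.int tp D') C → ChainIn τ (τ.int tp D') (insert k C) := by
      intro C hC
      have hpar : τ.int 6 c = σ.int tp D' := by rw [e6, if_pos rfl]
      have hpt : τ.int 5 c = k := by rw [e5, if_pos rfl]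
      rw [et, if_pos rfl, ← hpt]
      refine .cons (by rw [hpar]; exact hptr) ?_
      rw [hpar]
      exact hold _ hptr C hC
    refine ⟨⟨fun a h5 h6 h9 h10 ht => by rw [e0 a h5 h6 h10 ht, h.int a h5 h6 h9 h10 ht], ?_,
      by omega, by omega, fun j => ?_, fun j => ?_, fun j hj => ?_, fun i hi C hC =>
      hold i (by omega) C (h.old i hi C hC), fun j hj hne C hC => ?_⟩, e0⟩
    · rw [hτ, h₃, h₂, h₁]; exact h.real
    · rw [et, e10]
      have := h.lt j
      split_ifs <;> omega
    · rw [et]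
      split_ifs with hj
      · subst hj
        rw [← h.zero]
        have := hlt 0
        exact iff_of_false (by omega) h0
      · exact h.zero j
    · rw [et, if_neg fun h' => hj (Or.inl h')]
      exact h.ne j fun h' => hj (Or.inr h')
    · by_cases hjD : j = D'
      · subst hjD
        -- The entry `(k, k)` is reached both along its row and along its column; the repeated
        -- element does not change the set.
        by_cases hmem : d.eval σ ∈ D
        · have := hcons _ (h.new _ hmem hne C hC)
          rwa [Set.insert_eq_of_mem (Set.mem_insert k C)] at this
        · refine hcons _ ?_
          rw [hD', h.ne _ hmem]
          exact h.old _ (hlt _) C hC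
      · rw [et, if_neg hjD]
        exact hold _ (h.lt j) _ (h.new j (hj.resolve_left hjD) hne C hC)

/-- Append the element in the variable `7` to the lists in its row and column of the table. -/
def pushAll (tp : ℕ) : Stmt := forLoop 9 vN (.seq (push tp (idx vK vV)) (push tp (idx vV vK)))

theorem idx_spec {e f : IExp} {i j : ℕ} {σ : State} (hn : σ.int 0 0 = n) (hnM : n * n < M)
    (he : e.Fits M σ) (hf : f.Fits M σ) (hi : e.eval σ = i) (hj : f.eval σ = j)
    (hin : i < n) (hjn : j < n) : (idx e f).Fits M σ ∧ (idx e f).eval σ = i * n + j := by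
  have h := idx_lt hin hjn
  have h1 : i * n ≤ i * n + j := Nat.le_add_right _ _
  have h2 : n ≤ n * n := Nat.le_mul_self n
  refine ⟨⟨⟨he, ivar_fits (by omega) (by omega), ?_⟩, hf, ?_⟩, ?_⟩
  · simp only [IExp.eval, hi, hn]; omega
  · simp only [IExp.eval, hi, hj, hn]; omega
  · simp only [idx, IExp.eval, hi, hj, hn]

/-- The linear bound `2 * n` on the number of new nodes is what keeps all lists within quadratic
space. -/
theorem pushAll_runs {tp : ℕ} (htp : tp = 3 ∨ tp = 4) (hn : σ.int 0 0 = n) (hk : σ.int 7 0 = k)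
    (hkn : k < n) (hnM : n * n < M) (hM : 1 < M) (hcM : σ.int 10 0 + 2 * n < M)
    (hlt : ∀ d, σ.int tp d < σ.int 10 0) :
    Runs M (pushAll tp) σ
      (((push tp (idx vK vV)).bound + (push tp (idx vV vK)).bound + 12) * (n + 1))
      (Pushed tp k (2 * n) {d | ∃ v < n, d = k * n + v ∨ d = v * n + k} σ) := by
  have h2 : n ≤ n * n := Nat.le_mul_self n
  refine (Runs.forLoop (fun j σ' =>
    Pushed tp k (2 * j) {d | ∃ v < j, d = k * n + v ∨ d = v * n + k} σ σ') (by omega : n < M) hM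
    (fun j σ' h => ?_) (fun j hj σ' h h9 => ?_) ?_)
  · have : σ'.int 0 0 = n := by
      rw [h.int 0 (by omega) (by omega) (by omega) (by omega) (by omega), hn]
    exact ⟨ivar_fits (by omega) (by omega), this⟩
  · have hspec : ∀ τ : State, (∀ a, a ≠ 5 → a ≠ 6 → a ≠ 10 → a ≠ tp → τ.int a = σ'.int a) →
        ((idx vK vV).Fits M τ ∧ (idx vK vV).eval τ = k * n + j) ∧
        ((idx vV vK).Fits M τ ∧ (idx vV vK).eval τ = j * n + k) := by
      intro τ hτ
      have t0 : τ.int 0 0 = n := by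
        rw [hτ 0 (by omega) (by omega) (by omega) (by omega),
          h.int 0 (by omega) (by omega) (by omega) (by omega) (by omega), hn]
      have t7 : τ.int 7 0 = k := by
        rw [hτ 7 (by omega) (by omega) (by omega) (by omega),
          h.int 7 (by omega) (by omega) (by omega) (by omega) (by omega), hk]
      have t9 : τ.int 9 0 = j := by
        rw [hτ 9 (by omega) (by omega) (by omega) (by omega), h9]
      exact ⟨idx_spec t0 hnM (ivar_fits (by omega) (by omega)) (ivar_fits (by omega) (by omega))
        t7 t9 hkn hj, idx_spec t0 hnM (ivar_fits (by omega) (by omega))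
        (ivar_fits (by omega) (by omega)) t9 t7 hj hkn⟩
    have t7 : σ'.int 7 0 = k := by
      rw [h.int 7 (by omega) (by omega) (by omega) (by omega) (by omega), hk]
    refine Runs.seq (push_runs (d := idx vK vV) htp h hlt t7 (by omega) (by omega)
      fun τ hτ => ?_) fun σ₁ h₁ => ?_
    · have a1 := (hspec τ fun a h5 h6 _ _ => hτ a h5 h6).1
      rw [(hspec σ' fun _ _ _ _ _ => rfl).1.2]
      exact a1
    rw [(hspec σ' fun _ _ _ _ _ => rfl).1.2] at h₁
    refine (push_runs (d := idx vV vK) htp h₁.1 hlt ?_ (by omega) (by omega)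
      fun τ hτ => ?_).imp fun σ₂ h₂ => ?_
    · rw [h₁.2 7 (by omega) (by omega) (by omega) (by omega), t7]
    · have a1 := (hspec τ fun a h5 h6 h10 ht => (hτ a h5 h6).trans (h₁.2 a h5 h6 h10 ht)).2
      rw [(hspec σ₁ h₁.2).2.2]
      exact a1
    · rw [(hspec σ₁ h₁.2).2.2] at h₂
      refine ⟨?_, ?_⟩
      · rw [h₂.2 9 (by omega) (by omega) (by omega) (by omega),
          h₁.2 9 (by omega) (by omega) (by omega) (by omega), h9]
      · have := h₂.1.set9 htp (j + 1)
        have hset : {d | ∃ v < j + 1, d = k * n + v ∨ d = v * n + k} = insert (j * n + k)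
            (insert (k * n + j) {d | ∃ v < j, d = k * n + v ∨ d = v * n + k}) := by
          ext d
          simp only [Set.mem_ofPred_eq, Set.mem_insert_iff]
          constructor
          · rintro ⟨v, hv, hd⟩
            rcases (show v = j ∨ v < j by omega) with rfl | hv'
            · tauto
            · exact Or.inr (Or.inr ⟨v, hv', hd⟩)
          · rintro (hd | hd | ⟨v, hv, hd⟩)
            · exact ⟨j, by omega, Or.inr hd⟩
            · exact ⟨j, by omega, Or.inl hd⟩
            · exact ⟨v, by omega, hd⟩
        rw [hset]
        exact this
  · refine Pushed.set9 ⟨fun _ _ _ _ _ _ => rfl, rfl, le_rfl, by omega, hlt, fun _ => Iff.rfl,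
      fun _ _ => rfl, fun _ _ _ h => h, ?_⟩ htp 0
    rintro d ⟨v, hv, -⟩
    omega

end RealRAM
end

noncomputable section

set_option linter.unusedSimpArgs false

namespace RealRAM

variable {M T T' n k : ℕ} {s s' : Stmt} {σ σ₀ : State} {Q Q' : State → Prop} {X Y : ℕ → ℝ}

theorem Runs.setInt_seq {a : ℕ} {i e : IExp} (hi : i.Fits M σ) (he : e.Fits M σ)
    (h : Runs M s (σ.setInt a (i.eval σ) (e.eval σ)) T Q) :
    Runs M (.seq (.setInt a i e) s) σ (i.cost + e.cost + 1 + T) Q :=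
  Runs.seq (Q' := fun σ' => σ' = _) (Runs.setInt hi he rfl) fun _ h' => h' ▸ h

theorem Runs.setReal_seq {a : ℕ} {i : IExp} {e : RExp} (hi : i.Fits M σ) (he : e.Fits M σ)
    (h : Runs M s (σ.setReal a (i.eval σ) (e.eval σ)) T Q) :
    Runs M (.seq (.setReal a i e) s) σ (i.cost + e.cost + 1 + T) Q :=
  Runs.seq (Q' := fun σ' => σ' = _) (Runs.setReal hi he rfl) fun _ h' => h' ▸ h

/-! ### The rules of the dynamic program -/

/-- The comparison of the ordinates of two points. -/
def ylt (e f : IExp) : BExp := .rlt (.get 3 e) (.get 3 f)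

def ine (e f : IExp) : BExp := .not (.ieq e f)

/-- The values of the expressions that occur in rules. -/
structure Env.Facts (M n k u v : ℕ) (σ : State) : Prop where
  fK : vK.Fits M σ
  fU : vU.Fits M σ
  fV : vV.Fits M σ
  eK : vK.eval σ = k
  eU : vU.eval σ = u
  eV : vV.eval σ = v
  uv : (idx vU vV).Fits M σ ∧ (idx vU vV).eval σ = u * n + v
  kv : (idx vK vV).Fits M σ ∧ (idx vK vV).eval σ = k * n + v
  uk : (idx vU vK).Fits M σ ∧ (idx vU vK).eval σ = u * n + k
  kk : (idx vK vK).Fits M σ ∧ (idx vK vK).eval σ = k * n + k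
  nn : (IExp.mul vN vN).Fits M σ ∧ (IExp.mul vN vN).eval σ = n * n

theorem Env.facts {u v : ℕ} (h : Env n k u v σ) (hnM : n * n < M) (hk : k < n) (hu : u < n)
    (hv : v < n) : Env.Facts M n k u v σ := by
  have h2 : n ≤ n * n := Nat.le_mul_self n
  have fN : vN.Fits M σ := ivar_fits (by omega) (by rw [h.n]; omega)
  have fK : vK.Fits M σ := ivar_fits (by omega) (by rw [h.k]; omega)
  have fU : vU.Fits M σ := ivar_fits (by omega) (by rw [h.u]; omega)
  have fV : vV.Fits M σ := ivar_fits (by omega) (by rw [h.v]; omega)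
  refine ⟨fK, fU, fV, h.k, h.u, h.v, idx_spec h.n hnM fU fV h.u h.v hu hv,
    idx_spec h.n hnM fK fV h.k h.v hk hv, idx_spec h.n hnM fU fK h.u h.k hu hk,
    idx_spec h.n hnM fK fK h.k h.k hk hk, ⟨⟨fN, fN, ?_⟩, ?_⟩⟩
  · simp only [IExp.eval, h.n]; exact hnM
  · simp only [IExp.eval, h.n]

/-- In all rules the row is the upper bound and the column the lower bound. The old table has its
values in `4` and its links in `3`, the new one in `5` and `4`; the extra cell `n * n` of the new
one holds the best finished hull. Except for the turn and end rules, a guard combines `Keep` or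
`Move` conditions for the two bounds. -/
def keepRule : Rule :=
  ⟨.and (ine vU vK) (.and (ine vV vK) (.not (.and (ylt vV vK) (ylt vK vU)))), 4, 3,
    idx vU vV, idx vU vV⟩
def upperRiseRule : Rule :=
  ⟨.and (.and (.ilt vU vK) (ylt vU vK)) (.and (ine vV vK) (ylt vV vK)), 4, 3,
    idx vU vV, idx vK vV⟩
-- The promise `k` is fulfilled. As the source row is fixed, the loop variable `vU` is free to range
-- over the next promise.
def upperFallRule : Rule :=
  ⟨.and (.and (.ilt vK vU) (ylt vU vK)) (.and (ine vV vK) (ylt vV vK)), 4, 3,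
    idx vK vV, idx vU vV⟩
def lowerFallRule : Rule :=
  ⟨.and (.and (.ilt vV vK) (ylt vK vV)) (.and (ine vU vK) (ylt vK vU)), 4, 3,
    idx vU vV, idx vU vK⟩
def lowerRiseRule : Rule :=
  ⟨.and (.and (.ilt vK vV) (ylt vK vV)) (.and (ine vU vK) (ylt vK vU)), 4, 3,
    idx vU vK, idx vU vV⟩
-- Both bounds change at once only where the hull is pinched at `k`: everything chosen before is
-- above `k` and everything chosen after is below it.
def crossDownRule : Rule :=
  ⟨.and (.and (.ilt vV vK) (ylt vK vV)) (.and (.ilt vK vU) (ylt vU vK)), 4, 3,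
    idx vK vV, idx vU vK⟩
def crossUpRule : Rule :=
  ⟨.and (.and (.ilt vU vK) (ylt vU vK)) (.and (.ilt vK vV) (ylt vK vV)), 4, 3,
    idx vU vK, idx vK vV⟩
def endLowRule : Rule := ⟨.and (.ilt vV vK) (ylt vK vV), 4, 3, idx vK vV, .mul vN vN⟩
def endHighRule : Rule := ⟨.and (.ilt vU vK) (ylt vU vK), 4, 3, idx vU vK, .mul vN vN⟩
-- The guard is always true; repeating the same comparison for all loop values is harmless.
def endRule : Rule := ⟨.ieq vK vK, 4, 3, idx vK vK, .mul vN vN⟩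
-- Source and destination are in the same table. All promises are served from the one row `k`, which
-- saves a factor `n`.
def turnUpperRule : Rule := ⟨.and (.ilt vK vU) (ylt vU vK), 5, 4, idx vK vV, idx vU vV⟩
def turnLowerRule : Rule := ⟨.and (.ilt vK vV) (ylt vK vV), 5, 4, idx vU vK, idx vU vV⟩

def keepSpec (Y : ℕ → ℝ) (hnM : n * n < M) (hk : k < n) : RuleSpec M n k Y where
  rule := keepRule
  G u v := u ≠ k ∧ v ≠ k ∧ ¬ (Y v < Y k ∧ Y k < Y u)
  S u v := u * n + v
  D u v := u * n + v
  table := Or.inl ⟨rfl, rfl⟩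
  spec σ u v hu hv hE hY := by
    have h := hE.facts hnM hk hu hv
    exact ⟨by simp [keepRule, BExp.Fits, RExp.Fits, ylt, ine, h.fK, h.fU, h.fV],
      by simp [keepRule, BExp.Holds, RExp.eval, ylt, ine, h.eK, h.eU, h.eV, hY],
      fun _ => ⟨h.uv.1, h.uv.1, h.uv.2, h.uv.2⟩⟩

def upperRiseSpec (Y : ℕ → ℝ) (hnM : n * n < M) (hk : k < n) : RuleSpec M n k Y where
  rule := upperRiseRule
  G u v := (u < k ∧ Y u < Y k) ∧ v ≠ k ∧ Y v < Y k
  S u v := u * n + v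
  D _ v := k * n + v
  table := Or.inl ⟨rfl, rfl⟩
  spec σ u v hu hv hE hY := by
    have h := hE.facts hnM hk hu hv
    exact ⟨by simp [upperRiseRule, BExp.Fits, RExp.Fits, ylt, ine, h.fK, h.fU, h.fV],
      by simp [upperRiseRule, BExp.Holds, RExp.eval, ylt, ine, h.eK, h.eU, h.eV, hY],
      fun _ => ⟨h.uv.1, h.kv.1, h.uv.2, h.kv.2⟩⟩

def upperFallSpec (Y : ℕ → ℝ) (hnM : n * n < M) (hk : k < n) : RuleSpec M n k Y where
  rule := upperFallRule
  G u v := (k < u ∧ Y u < Y k) ∧ v ≠ k ∧ Y v < Y k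
  S _ v := k * n + v
  D u v := u * n + v
  table := Or.inl ⟨rfl, rfl⟩
  spec σ u v hu hv hE hY := by
    have h := hE.facts hnM hk hu hv
    exact ⟨by simp [upperFallRule, BExp.Fits, RExp.Fits, ylt, ine, h.fK, h.fU, h.fV],
      by simp [upperFallRule, BExp.Holds, RExp.eval, ylt, ine, h.eK, h.eU, h.eV, hY],
      fun _ => ⟨h.kv.1, h.uv.1, h.kv.2, h.uv.2⟩⟩

def lowerFallSpec (Y : ℕ → ℝ) (hnM : n * n < M) (hk : k < n) : RuleSpec M n k Y where
  rule := lowerFallRule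
  G u v := (v < k ∧ Y k < Y v) ∧ u ≠ k ∧ Y k < Y u
  S u v := u * n + v
  D u _ := u * n + k
  table := Or.inl ⟨rfl, rfl⟩
  spec σ u v hu hv hE hY := by
    have h := hE.facts hnM hk hu hv
    exact ⟨by simp [lowerFallRule, BExp.Fits, RExp.Fits, ylt, ine, h.fK, h.fU, h.fV],
      by simp [lowerFallRule, BExp.Holds, RExp.eval, ylt, ine, h.eK, h.eU, h.eV, hY],
      fun _ => ⟨h.uv.1, h.uk.1, h.uv.2, h.uk.2⟩⟩

def lowerRiseSpec (Y : ℕ → ℝ) (hnM : n * n < M) (hk : k < n) : RuleSpec M n k Y where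
  rule := lowerRiseRule
  G u v := (k < v ∧ Y k < Y v) ∧ u ≠ k ∧ Y k < Y u
  S u _ := u * n + k
  D u v := u * n + v
  table := Or.inl ⟨rfl, rfl⟩
  spec σ u v hu hv hE hY := by
    have h := hE.facts hnM hk hu hv
    exact ⟨by simp [lowerRiseRule, BExp.Fits, RExp.Fits, ylt, ine, h.fK, h.fU, h.fV],
      by simp [lowerRiseRule, BExp.Holds, RExp.eval, ylt, ine, h.eK, h.eU, h.eV, hY],
      fun _ => ⟨h.uk.1, h.uv.1, h.uk.2, h.uv.2⟩⟩

def crossDownSpec (Y : ℕ → ℝ) (hnM : n * n < M) (hk : k < n) : RuleSpec M n k Y where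
  rule := crossDownRule
  G u v := (v < k ∧ Y k < Y v) ∧ k < u ∧ Y u < Y k
  S _ v := k * n + v
  D u _ := u * n + k
  table := Or.inl ⟨rfl, rfl⟩
  spec σ u v hu hv hE hY := by
    have h := hE.facts hnM hk hu hv
    exact ⟨by simp [crossDownRule, BExp.Fits, RExp.Fits, ylt, ine, h.fK, h.fU, h.fV],
      by simp [crossDownRule, BExp.Holds, RExp.eval, ylt, ine, h.eK, h.eU, h.eV, hY],
      fun _ => ⟨h.kv.1, h.uk.1, h.kv.2, h.uk.2⟩⟩

def crossUpSpec (Y : ℕ → ℝ) (hnM : n * n < M) (hk : k < n) : RuleSpec M n k Y where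
  rule := crossUpRule
  G u v := (u < k ∧ Y u < Y k) ∧ k < v ∧ Y k < Y v
  S u _ := u * n + k
  D _ v := k * n + v
  table := Or.inl ⟨rfl, rfl⟩
  spec σ u v hu hv hE hY := by
    have h := hE.facts hnM hk hu hv
    exact ⟨by simp [crossUpRule, BExp.Fits, RExp.Fits, ylt, ine, h.fK, h.fU, h.fV],
      by simp [crossUpRule, BExp.Holds, RExp.eval, ylt, ine, h.eK, h.eU, h.eV, hY],
      fun _ => ⟨h.uk.1, h.kv.1, h.uk.2, h.kv.2⟩⟩

def endLowSpec (Y : ℕ → ℝ) (hnM : n * n < M) (hk : k < n) : RuleSpec M n k Y where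
  rule := endLowRule
  G _ v := v < k ∧ Y k < Y v
  S _ v := k * n + v
  D _ _ := n * n
  table := Or.inl ⟨rfl, rfl⟩
  spec σ u v hu hv hE hY := by
    have h := hE.facts hnM hk hu hv
    exact ⟨by simp [endLowRule, BExp.Fits, RExp.Fits, ylt, ine, h.fK, h.fU, h.fV],
      by simp [endLowRule, BExp.Holds, RExp.eval, ylt, ine, h.eK, h.eU, h.eV, hY],
      fun _ => ⟨h.kv.1, h.nn.1, h.kv.2, h.nn.2⟩⟩

def endHighSpec (Y : ℕ → ℝ) (hnM : n * n < M) (hk : k < n) : RuleSpec M n k Y where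
  rule := endHighRule
  G u _ := u < k ∧ Y u < Y k
  S u _ := u * n + k
  D _ _ := n * n
  table := Or.inl ⟨rfl, rfl⟩
  spec σ u v hu hv hE hY := by
    have h := hE.facts hnM hk hu hv
    exact ⟨by simp [endHighRule, BExp.Fits, RExp.Fits, ylt, ine, h.fK, h.fU, h.fV],
      by simp [endHighRule, BExp.Holds, RExp.eval, ylt, ine, h.eK, h.eU, h.eV, hY],
      fun _ => ⟨h.uk.1, h.nn.1, h.uk.2, h.nn.2⟩⟩

def endSpec (Y : ℕ → ℝ) (hnM : n * n < M) (hk : k < n) : RuleSpec M n k Y where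
  rule := endRule
  G _ _ := True
  S _ _ := k * n + k
  D _ _ := n * n
  table := Or.inl ⟨rfl, rfl⟩
  spec σ u v hu hv hE hY := by
    have h := hE.facts hnM hk hu hv
    exact ⟨by simp [endRule, BExp.Fits, RExp.Fits, ylt, ine, h.fK, h.fU, h.fV],
      by simp [endRule, BExp.Holds, RExp.eval, ylt, ine, h.eK, h.eU, h.eV, hY],
      fun _ => ⟨h.kk.1, h.nn.1, h.kk.2, h.nn.2⟩⟩

def turnUpperSpec (Y : ℕ → ℝ) (hnM : n * n < M) (hk : k < n) : RuleSpec M n k Y where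
  rule := turnUpperRule
  G u _ := k < u ∧ Y u < Y k
  S _ v := k * n + v
  D u v := u * n + v
  table := Or.inr ⟨rfl, rfl⟩
  spec σ u v hu hv hE hY := by
    have h := hE.facts hnM hk hu hv
    exact ⟨by simp [turnUpperRule, BExp.Fits, RExp.Fits, ylt, ine, h.fK, h.fU, h.fV],
      by simp [turnUpperRule, BExp.Holds, RExp.eval, ylt, ine, h.eK, h.eU, h.eV, hY],
      fun _ => ⟨h.kv.1, h.uv.1, h.kv.2, h.uv.2⟩⟩

def turnLowerSpec (Y : ℕ → ℝ) (hnM : n * n < M) (hk : k < n) : RuleSpec M n k Y where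
  rule := turnLowerRule
  G _ v := k < v ∧ Y k < Y v
  S u _ := u * n + k
  D u v := u * n + v
  table := Or.inr ⟨rfl, rfl⟩
  spec σ u v hu hv hE hY := by
    have h := hE.facts hnM hk hu hv
    exact ⟨by simp [turnLowerRule, BExp.Fits, RExp.Fits, ylt, ine, h.fK, h.fU, h.fV],
      by simp [turnLowerRule, BExp.Holds, RExp.eval, ylt, ine, h.eK, h.eU, h.eV, hY],
      fun _ => ⟨h.uk.1, h.uv.1, h.uk.2, h.uv.2⟩⟩

end RealRAM
end

/-! ### Starting a hull and passing to the next slab -/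

noncomputable section

set_option linter.unusedSimpArgs false

namespace RealRAM

variable {M T T' n k : ℕ} {s s' : Stmt} {σ σ₀ : State} {Q Q' : State → Prop} {X Y : ℕ → ℝ}

/-- Enter the hull that starts at the point in the variable `7`. -/
def startStmt : Stmt :=
  .seq (.setInt 5 vC vK) (.seq (.setInt 6 vC (.lit 0)) (.seq (.setInt 4 (idx vK vK) vC)
    (.seq (.setReal 5 (idx vK vK) (.lit 0)) (.setInt 10 (.lit 0) (.add vC (.lit 1))))))

structure Started (n k : ℕ) (σ₀ σ : State) : Prop where
  int : ∀ a, a ≠ 4 → a ≠ 5 → a ≠ 6 → a ≠ 10 → σ.int a = σ₀.int a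
  real : ∀ a ≠ 5, σ.real a = σ₀.real a
  count : σ.int 10 0 = σ₀.int 10 0 + 1
  link : ∀ j, σ.int 4 j = if j = k * n + k then σ₀.int 10 0 else σ₀.int 4 j
  val : ∀ j, σ.real 5 j = if j = k * n + k then 0 else σ₀.real 5 j
  old : ∀ i < σ₀.int 10 0, ∀ C, ChainIn σ₀ i C → ChainIn σ i C
  new : ChainIn σ (σ₀.int 10 0) {k}

theorem start_runs (hn : σ.int 0 0 = n) (hk : σ.int 7 0 = k) (hkn : k < n) (hnM : n * n < M)
    (hc : 0 < σ.int 10 0) (hcM : σ.int 10 0 + 1 < M) :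
    Runs M startStmt σ startStmt.bound (Started n k σ) := by
  have h2 : n ≤ n * n := Nat.le_mul_self n
  have hfit : ∀ τ : State, (∀ a, a ≠ 4 → a ≠ 5 → a ≠ 6 → τ.int a = σ.int a) →
      vC.Fits M τ ∧ vK.Fits M τ ∧ (idx vK vK).Fits M τ ∧ vC.eval τ = σ.int 10 0 ∧
        vK.eval τ = k ∧ (idx vK vK).eval τ = k * n + k := by
    intro τ hτ
    have t0 : τ.int 0 0 = n := by rw [hτ 0 (by omega) (by omega) (by omega), hn]
    have t7 : τ.int 7 0 = k := by rw [hτ 7 (by omega) (by omega) (by omega), hk]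
    have t10 : τ.int 10 0 = σ.int 10 0 := by rw [hτ 10 (by omega) (by omega) (by omega)]
    have fK : vK.Fits M τ := ivar_fits (by omega) (by omega)
    obtain ⟨f1, f2⟩ := idx_spec t0 hnM fK fK t7 t7 hkn hkn
    exact ⟨ivar_fits (by omega) (by omega), fK, f1, t10, t7, f2⟩
  have hM0 : (IExp.lit 0).Fits M σ := by change 0 < M; omega
  obtain ⟨a1, a2, a3, a4, a5, a6⟩ := hfit σ fun _ _ _ _ => rfl
  refine Runs.setInt_seq a1 a2 ?_
  rw [a4, a5]
  set σ₁ := σ.setInt 5 (σ.int 10 0) k with h₁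
  have i₁ : ∀ a, a ≠ 4 → a ≠ 5 → a ≠ 6 → σ₁.int a = σ.int a := fun a _ h _ =>
    setInt_int_of_ne _ _ _ _ _ h
  obtain ⟨b1, b2, b3, b4, b5, b6⟩ := hfit σ₁ i₁
  refine Runs.setInt_seq b1 hM0 ?_
  rw [b4]
  simp only [IExp.eval]
  set σ₂ := σ₁.setInt 6 (σ.int 10 0) 0 with h₂
  have i₂ : ∀ a, a ≠ 4 → a ≠ 5 → a ≠ 6 → σ₂.int a = σ.int a := fun a h4 h5 h6 =>
    (setInt_int_of_ne _ _ _ _ _ h6).trans (i₁ a h4 h5 h6)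
  obtain ⟨c1, c2, c3, c4, c5, c6⟩ := hfit σ₂ i₂
  refine Runs.setInt_seq c3 c1 ?_
  rw [c4, c6]
  set σ₃ := σ₂.setInt 4 (k * n + k) (σ.int 10 0) with h₃
  have i₃ : ∀ a, a ≠ 4 → a ≠ 5 → a ≠ 6 → σ₃.int a = σ.int a := fun a h4 h5 h6 =>
    (setInt_int_of_ne _ _ _ _ _ h4).trans (i₂ a h4 h5 h6)
  obtain ⟨d1, d2, d3, d4, d5, d6⟩ := hfit σ₃ i₃
  refine Runs.setReal_seq d3 trivial ?_
  rw [d6]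
  simp only [RExp.eval]
  set σ₄ := σ₃.setReal 5 (k * n + k) (((0 : ℤ) : ℝ)) with h₄
  have i₄ : ∀ a, a ≠ 4 → a ≠ 5 → a ≠ 6 → σ₄.int a = σ.int a := i₃
  obtain ⟨e1, e2, e3, e4, e5, e6⟩ := hfit σ₄ i₄
  refine Runs.setInt hM0 ⟨e1, by change 1 < M; omega, by rw [e4]; exact hcM⟩ ?_
  have e4' : (IExp.add vC (.lit 1)).eval σ₄ = σ.int 10 0 + 1 := by
    change vC.eval σ₄ + 1 = _
    rw [e4]
  rw [e4']
  simp only [IExp.eval]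
  set τ := σ₄.setInt 10 0 (σ.int 10 0 + 1) with hτ
  have t5 : ∀ j, τ.int 5 j = if j = σ.int 10 0 then k else σ.int 5 j := by
    intro j; simp [hτ, h₄, h₃, h₂, h₁]
  have t6 : ∀ j, τ.int 6 j = if j = σ.int 10 0 then 0 else σ.int 6 j := by
    intro j; simp [hτ, h₄, h₃, h₂, h₁]
  refine ⟨fun a h4 h5 h6 h10 => ?_, fun a ha => ?_, ?_, fun j => ?_, fun j => ?_,
    fun i hi C hC => ?_, ?_⟩
  · rw [hτ, setInt_int_of_ne _ _ _ _ _ h10, i₄ a h4 h5 h6]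
  · rw [hτ, setInt_real, h₄, setReal_real_of_ne _ _ _ _ _ ha]; rfl
  · simp [hτ]
  · simp [hτ, h₄, h₃, h₂, h₁]
  · simp [hτ, h₄, h₃, h₂, h₁]
  · exact hC.congr hi (fun j hj => by rw [t5, if_neg hj.ne]) fun j hj => by rw [t6, if_neg hj.ne]
  · have := Chain.cons (pt := τ.int 5) (par := τ.int 6) (i := σ.int 10 0) (C := ∅)
      (by rw [t6, if_pos rfl]; exact hc) (by rw [t6, if_pos rfl]; exact .nil)
    rw [t5, if_pos rfl] at this
    simpa using this

/-- Replace an entry of the old table by the entry of the new one, add the area of the next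
slab, and clear the new entry. -/
def copyStmt : Stmt :=
  .seq (.setInt 3 (idx vU vV) (.get 4 (idx vU vV)))
    (.seq (.setInt 4 (idx vU vV) (.lit 0))
      (.cond (ylt vV vU)
        (.setReal 4 (idx vU vV) (.add (.get 5 (idx vU vV))
          (.mul (.sub (.get 2 (.add vK (.lit 1))) (.get 2 vK)) (.sub (.get 3 vU) (.get 3 vV)))))
        (.setReal 4 (idx vU vV) (.get 5 (idx vU vV)))))

theorem copyStmt_runs {u v : ℕ} (hE : Env n k u v σ) (hk : k < n) (hu : u < n) (hv : v < n)
    (hnM : n * n < M) (hkM : k + 1 < M) (h4 : σ.int 4 (u * n + v) < M) (hX : σ.real 2 = X)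
    (hY : σ.real 3 = Y) :
    Runs M copyStmt σ copyStmt.bound fun σ' =>
      (∀ a, a ≠ 3 → a ≠ 4 → σ'.int a = σ.int a) ∧ (∀ a ≠ 4, σ'.real a = σ.real a) ∧
      (∀ j, σ'.int 3 j = if j = u * n + v then σ.int 4 j else σ.int 3 j) ∧
      (∀ j, σ'.int 4 j = if j = u * n + v then 0 else σ.int 4 j) ∧
      ∀ j, σ'.real 4 j = if j = u * n + v then
        σ.real 5 j + (X (k + 1) - X k) * max (Y u - Y v) 0 else σ.real 4 j := by
  have f0 := hE.facts hnM hk hu hv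
  refine Runs.setInt_seq f0.uv.1 ⟨f0.uv.1, by rw [f0.uv.2]; exact h4⟩ ?_
  have e0 : (IExp.get 4 (idx vU vV)).eval σ = σ.int 4 (u * n + v) := by
    rw [← f0.uv.2]; rfl
  rw [f0.uv.2, e0]
  set σ₁ := σ.setInt 3 (u * n + v) (σ.int 4 (u * n + v)) with h₁
  have hE₁ : Env n k u v σ₁ := ⟨by simp [h₁, hE.n], by simp [h₁, hE.k], by simp [h₁, hE.u],
    by simp [h₁, hE.v]⟩
  have f1 := hE₁.facts hnM hk hu hv
  refine Runs.setInt_seq f1.uv.1 (by change 0 < M; omega) ?_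
  rw [f1.uv.2]
  simp only [IExp.eval]
  set σ₂ := σ₁.setInt 4 (u * n + v) 0 with h₂
  have hE₂ : Env n k u v σ₂ := ⟨by simp [h₂, hE₁.n], by simp [h₂, hE₁.k], by simp [h₂, hE₁.u],
    by simp [h₂, hE₁.v]⟩
  have f2 := hE₂.facts hnM hk hu hv
  have hr : σ₂.real = σ.real := rfl
  have hadd : (IExp.add vK (.lit 1)).Fits M σ₂ := ⟨f2.fK, by change 1 < M; omega, by
    rw [f2.eK]; exact hkM⟩
  have hadd' : (IExp.add vK (.lit 1)).eval σ₂ = k + 1 := by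
    change vK.eval σ₂ + 1 = _; rw [f2.eK]
  have key : ∀ x : ℝ, x = σ.real 5 (u * n + v) + (X (k + 1) - X k) * max (Y u - Y v) 0 →
      (fun σ' : State => (∀ a, a ≠ 3 → a ≠ 4 → σ'.int a = σ.int a) ∧
        (∀ a ≠ 4, σ'.real a = σ.real a) ∧
        (∀ j, σ'.int 3 j = if j = u * n + v then σ.int 4 j else σ.int 3 j) ∧
        (∀ j, σ'.int 4 j = if j = u * n + v then 0 else σ.int 4 j) ∧
        ∀ j, σ'.real 4 j = if j = u * n + v then
          σ.real 5 j + (X (k + 1) - X k) * max (Y u - Y v) 0 else σ.real 4 j)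
        (σ₂.setReal 4 ((idx vU vV).eval σ₂) x) := by
    intro x hx
    rw [f2.uv.2]
    refine ⟨fun a h3 h4 => ?_, fun a ha => ?_, fun j => ?_, fun j => ?_, fun j => ?_⟩
    · rw [setReal_int, h₂, setInt_int_of_ne _ _ _ _ _ h4, h₁, setInt_int_of_ne _ _ _ _ _ h3]
    · rw [setReal_real_of_ne _ _ _ _ _ ha]; rfl
    · simp only [setReal_int, h₂, h₁, setInt_int]
      by_cases hj : j = u * n + v <;> simp [hj]
    · simp only [setReal_int, h₂, h₁, setInt_int]
      by_cases hj : j = u * n + v <;> simp [hj]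
    · simp only [setReal_real, h₂, h₁, setInt_real]
      by_cases hj : j = u * n + v
      · simp [hj, hx]
      · simp [hj]
  refine Runs.cond ⟨f2.fV, f2.fU⟩ (fun hlt => ?_) fun hlt => ?_
  · refine Runs.setReal f2.uv.1 ⟨f2.uv.1, ⟨hadd, f2.fK⟩, f2.fU, f2.fV⟩ (key _ ?_)
    have hlt' : Y v < Y u := by
      simpa only [ylt, BExp.Holds, RExp.eval, f2.eU, f2.eV, hr, hY] using hlt
    simp only [RExp.eval, f2.uv.2, hadd', f2.eK, f2.eU, f2.eV, hr, hX, hY]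
    rw [max_eq_left (by linarith)]
  · refine Runs.setReal f2.uv.1 f2.uv.1 (key _ ?_)
    have hlt' : ¬ Y v < Y u := by
      simpa only [ylt, BExp.Holds, RExp.eval, f2.eU, f2.eV, hr, hY] using hlt
    simp only [RExp.eval, f2.uv.2, hr]
    rw [max_eq_right (by linarith)]
    simp

/-- `D` is the set of cells treated so far. -/
structure Copied (n k : ℕ) (X Y : ℕ → ℝ) (D : Set ℕ) (σ₀ σ : State) : Prop where
  int : ∀ a, a ≠ 3 → a ≠ 4 → a ≠ 8 → a ≠ 9 → σ.int a = σ₀.int a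
  real : ∀ a ≠ 4, σ.real a = σ₀.real a
  val : ∀ u < n, ∀ v < n, u * n + v ∈ D → σ.real 4 (u * n + v) =
    σ₀.real 5 (u * n + v) + (X (k + 1) - X k) * max (Y u - Y v) 0
  link : ∀ d ∈ D, σ.int 3 d = σ₀.int 4 d
  clear : ∀ d ∈ D, σ.int 4 d = 0
  ne3 : ∀ d ∉ D, σ.int 3 d = σ₀.int 3 d
  ne4 : ∀ d ∉ D, σ.int 4 d = σ₀.int 4 d

theorem copy_runs (hn : σ₀.int 0 0 = n) (hk : σ₀.int 7 0 = k) (hkn : k < n) (hM : 1 < M)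
    (hnM : n * n < M) (hkM : k + 1 < M) (h4 : ∀ d, σ₀.int 4 d < M) (hX : σ₀.real 2 = X)
    (hY : σ₀.real 3 = Y) :
    Runs M (for2 copyStmt) σ₀ (((copyStmt.bound + 12) * (n + 1) + 12) * (n + 1))
      (Copied n k X Y (Set.Iio (n * n)) σ₀) := by
  have h2 : n ≤ n * n := Nat.le_mul_self n
  refine (Runs.for2 (fun u v σ => Copied n k X Y (Set.Iio (u * n + v)) σ₀ σ)
    (by omega : n < M) hM (fun u v σ h => ?_) (fun u v σ a c ha h => ?_)
    (fun u hu v hv σ h h8 h9 => ?_) (fun u hu σ h => ?_) ?_).imp fun σ h => by simpa using h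
  · rw [h.int 0 (by omega) (by omega) (by omega) (by omega), hn]
  · have e : ∀ b, b ≠ 8 → b ≠ 9 → (σ.setInt a 0 c).int b = σ.int b := fun b h8 h9 =>
      setInt_int_of_ne _ _ _ _ _ (by omega)
    refine ⟨fun b b3 b4 b8 b9 => by rw [e b b8 b9, h.int b b3 b4 b8 b9], h.real, h.val, ?_, ?_, ?_,
      ?_⟩
    · rw [e 3 (by omega) (by omega)]; exact h.link
    · rw [e 4 (by omega) (by omega)]; exact h.clear
    · rw [e 3 (by omega) (by omega)]; exact h.ne3
    · rw [e 4 (by omega) (by omega)]; exact h.ne4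
  · have hE : Env n k u v σ := ⟨by rw [h.int 0 (by omega) (by omega) (by omega) (by omega), hn],
      by rw [h.int 7 (by omega) (by omega) (by omega) (by omega), hk], h8, h9⟩
    have hnot : u * n + v ∉ Set.Iio (u * n + v) := by simp
    refine (copyStmt_runs hE hkn hu hv hnM hkM (by rw [h.ne4 _ hnot]; exact h4 _)
      ((h.real 2 (by omega)).trans hX) ((h.real 3 (by omega)).trans hY)).imp
      fun σ' ⟨a1, a2, a3, a4, a5⟩ => ⟨by rw [a1 8 (by omega) (by omega), h8],
        by rw [a1 9 (by omega) (by omega), h9], ?_⟩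
    have hmem : ∀ d, d ∈ Set.Iio (u * n + (v + 1)) ↔ d = u * n + v ∨ d ∈ Set.Iio (u * n + v) := by
      intro d; simp only [Set.mem_Iio]; omega
    refine ⟨fun b b3 b4 b8 b9 => by rw [a1 b b3 b4, h.int b b3 b4 b8 b9],
      fun b b4 => by rw [a2 b b4, h.real b b4], fun u' hu' v' hv' hd => ?_, fun d hd => ?_,
      fun d hd => ?_, fun d hd => ?_, fun d hd => ?_⟩
    · rw [a5]
      split_ifs with hj
      · obtain ⟨rfl, rfl⟩ := idx_inj hv' hv hj
        rw [h.real 5 (by omega)]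
      · exact h.val u' hu' v' hv' (((hmem _).1 hd).resolve_left hj)
    · rw [a3]
      split_ifs with hj
      · rw [hj]; exact h.ne4 _ hnot
      · exact h.link d (((hmem _).1 hd).resolve_left hj)
    · rw [a4]
      split_ifs with hj
      · rfl
      · exact h.clear d (((hmem _).1 hd).resolve_left hj)
    · rw [hmem, not_or] at hd
      rw [a3, if_neg hd.1]; exact h.ne3 d hd.2
    · rw [hmem, not_or] at hd
      rw [a4, if_neg hd.1]; exact h.ne4 d hd.2
  · have : (u + 1) * n + 0 = u * n + n := by ring
    rw [this]; exact h
  · refine ⟨fun b b3 b4 b8 b9 => ?_, fun b b4 => rfl, ?_, ?_, ?_, fun d hd => rfl, fun d hd => rfl⟩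
    · rfl
    · intro u hu v hv h; simp at h
    · intro d hd; simp at hd
    · intro d hd; simp at hd

end RealRAM
end

/-! ### Completeness and soundness of one step of the sweep -/

noncomputable section

set_option linter.unusedSimpArgs false

namespace Sweep
open Set

variable {n k a' b' : ℕ} {X Y : ℕ → ℝ} {S : Set ℕ}

/-- The hulls of the sets in question have no inner points. -/
def Admissible (n : ℕ) (Y : ℕ → ℝ) (S : Set ℕ) : Prop := S ⊆ Iio n ∧ ∀ p < n, ¬ Inner Y S p

/-- The transitions reach the bounds of all slabs of an admissible set. -/
theorem complete_step (hY : InjOn Y (Iio n)) (hS : Admissible n Y S) (hk : k < n)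
    {A B C : ℕ → ℕ → Prop} (hcomp : ∀ a b, Source Y S k a → Source (-Y) S k b → A a b)
    (hBC : ∀ a < n, ∀ b < n, B a b → C a b)
    (hstart : ∑ j ∈ Finset.range (k + 1), slab X Y S j = 0 → B k k)
    (hkeep : ∀ a < n, ∀ b < n, a ≠ k ∧ b ≠ k ∧ ¬ (Y b < Y k ∧ Y k < Y a) → A a b → B a b)
    (hupperRise : ∀ a < n, ∀ b < n, (a < k ∧ Y a < Y k) ∧ b ≠ k ∧ Y b < Y k → A a b → B k b)
    (hupperFall : ∀ a < n, ∀ b < n, (k < a ∧ Y a < Y k) ∧ b ≠ k ∧ Y b < Y k → A k b → B a b)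
    (hlowerFall : ∀ a < n, ∀ b < n, (b < k ∧ Y k < Y b) ∧ a ≠ k ∧ Y k < Y a → A a b → B a k)
    (hlowerRise : ∀ a < n, ∀ b < n, (k < b ∧ Y k < Y b) ∧ a ≠ k ∧ Y k < Y a → A a k → B a b)
    (hcrossDown : ∀ a < n, ∀ b < n, (b < k ∧ Y k < Y b) ∧ k < a ∧ Y a < Y k → A k b → B a k)
    (hcrossUp : ∀ a < n, ∀ b < n, (a < k ∧ Y a < Y k) ∧ k < b ∧ Y k < Y b → A a k → B k b)
    (hturnUpper : ∀ a < n, ∀ b < n, k < a ∧ Y a < Y k → B k b → C a b)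
    (hturnLower : ∀ a < n, ∀ b < n, k < b ∧ Y k < Y b → B a k → C a b)
    (ha' : Source Y S (k + 1) a') (hb' : Source (-Y) S (k + 1) b') : C a' b' := by
  -- In the application `A`, `B` and `C` say that an entry is present with at least the area of `S`
  -- so far: in the old table, after the main pass, and after the turns.
  obtain ⟨hSn, hin⟩ := hS
  have hY' : InjOn (-Y) (Iio n) := fun i hi j hj h => hY hi hj (by simpa using h)
  have han : a' < n := hSn ha'.mem
  have hbn : b' < n := hSn hb'.mem
  by_cases h1 : ∃ s ∈ S, s < k
  · obtain ⟨a, ha, hstep⟩ := ha'.exists_prev hY hSn h1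
    obtain ⟨b, hb, hstep'⟩ := hb'.exists_prev hY' hSn h1
    have hA := hcomp a b ha hb
    have han0 : a < n := hSn ha.mem
    have hbn0 : b < n := hSn hb.mem
    have hneg : ∀ i j, (-Y) i < (-Y) j ↔ Y j < Y i := fun i j => by simp
    rcases hstep with ⟨rfl, hka⟩ | ⟨hkS, hma⟩
    · rcases hstep' with ⟨rfl, hkb⟩ | ⟨hkS, hmb⟩
      -- Between two persisting bounds `k` would be an inner point. This also excludes a chosen `k`
      -- here, which `Keep` would place between them.
      · refine hBC _ han _ hbn (hkeep _ han _ hbn ⟨hka.1, hkb.1, fun h => ?_⟩ hA)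
        exact hin k hk ⟨ha.under_of_keep hka.1 h.2, hb.under_of_keep hkb.1 ((hneg _ _).2 h.1)⟩
      · have g2 := hka.2 hkS
        simp only [Move, hneg] at hmb
        rcases hmb with ⟨h3, h4, rfl | ⟨h5, h6⟩⟩ | ⟨rfl, h5, h6⟩
        · exact hBC _ han _ hbn (hlowerFall _ han _ hbn0 ⟨⟨h3, h4⟩, hka.1, g2⟩ hA)
        -- A record that turns at once: first to the bound `k`, then on to the promise in the second
        -- pass.
        · exact hturnLower _ han _ hbn ⟨h5, h6⟩
            (hlowerFall _ han _ hbn0 ⟨⟨h3, h4⟩, hka.1, g2⟩ hA)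
        · exact hBC _ han _ hbn (hlowerRise _ han _ hbn ⟨⟨h5, h6⟩, hka.1, g2⟩ hA)
    · rcases hstep' with ⟨rfl, hkb⟩ | ⟨-, hmb⟩
      · have g2 := (hneg _ _).1 (hkb.2 hkS)
        rcases hma with ⟨h3, h4, rfl | ⟨h5, h6⟩⟩ | ⟨rfl, h5, h6⟩
        · exact hBC _ han _ hbn (hupperRise _ han0 _ hbn ⟨⟨h3, h4⟩, hkb.1, g2⟩ hA)
        · exact hturnUpper _ han _ hbn ⟨h5, h6⟩
            (hupperRise _ han0 _ hbn ⟨⟨h3, h4⟩, hkb.1, g2⟩ hA)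
        · exact hBC _ han _ hbn (hupperFall _ han _ hbn ⟨⟨h5, h6⟩, hkb.1, g2⟩ hA)
      · rcases move_move_cases ha hb ha' hb' hma hmb with ⟨rfl, h3, h4, h5, h6, rfl⟩ |
          ⟨rfl, h3, h4, h5, h6, rfl⟩
        · exact hBC _ han _ hbn (hcrossDown _ han _ hbn0 ⟨⟨h5, h6⟩, h3, h4⟩ hA)
        · exact hBC _ han _ hbn (hcrossUp _ han0 _ hbn ⟨⟨h5, h6⟩, h3, h4⟩ hA)
  · obtain ⟨hkS, ha⟩ := ha'.of_first h1
    obtain ⟨-, hb⟩ := hb'.of_first h1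
    have h0 : B k k := hstart (Finset.sum_eq_zero fun j hj => slab_eq_zero (Or.inl fun s hs => by
      push Not at h1
      have := h1 s hs
      simp only [Finset.mem_range] at hj
      omega))
    rcases ha with rfl | ⟨g1, g2, g3⟩
    · rcases hb with rfl | ⟨g1, g2, g3⟩
      · exact hBC _ han _ hbn h0
      · exact hturnLower _ han _ hbn ⟨g1, by simpa using g2⟩ h0
    · rcases hb with rfl | ⟨f1, f2, f3⟩
      · exact hturnUpper _ han _ hbn ⟨g1, g2⟩ h0
      -- Both bounds cannot lie ahead of the first element: `b'` would be above `k`, yet at most as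
      -- high as `a'`, which is below `k`.
      · have := g3 b' hb'.mem f1
        simp only [Pi.neg_apply, neg_lt_neg_iff] at f2
        linarith

/-- The bounds of the last slab of a set. -/
theorem last_cases {a b : ℕ} (hm : ∀ s ∈ S, s ≤ k) (ha : Source Y S k a)
    (hb : Source (-Y) S k b) :
    (a = k ∧ b = k) ∨ (a = k ∧ b < k ∧ Y k < Y b) ∨ (b = k ∧ a < k ∧ Y a < Y k) := by
  rcases ha.of_not_under_right hm with h | ⟨h1, h2⟩
  · rcases hb.of_not_under_right hm with h' | ⟨h1', h2'⟩
    · exact Or.inl ⟨h, h'⟩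
    · exact Or.inr (Or.inl ⟨h, h1', by simpa using h2'⟩)
  · rcases hb.of_not_under_right hm with h' | ⟨h1', h2'⟩
    · exact Or.inr (Or.inr ⟨h', h1, h2⟩)
    · have := (hb.1.1 h1').2 a ⟨ha.mem, h1⟩
      simp only [Pi.neg_apply, neg_lt_neg_iff, neg_le_neg_iff] at this h2'
      linarith

end Sweep

namespace RealRAM
open Sweep

variable {M T T' n k : ℕ} {s s' : Stmt} {σ σ₀ : State} {Q Q' : State → Prop} {X Y : ℕ → ℝ}
  {ID : ℕ → ℕ}

/-- The entries below `n * n` satisfy `P` and the entry `n * n` satisfies `B`. -/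
def TableOK (n c : ℕ) (P : ℕ → ℕ → ℝ → ℕ → Prop) (B : ℝ → ℕ → Prop) (d : ℕ) (x : ℝ) (p : ℕ) :
    Prop :=
  p < c ∧ d ≤ n * n ∧ (∀ u < n, ∀ v < n, d = u * n + v → P u v x p) ∧ (d = n * n → B x p)

theorem TableOK.cell {c u v p : ℕ} {x : ℝ} {P : ℕ → ℕ → ℝ → ℕ → Prop} {B : ℝ → ℕ → Prop}
    (hp : p < c) (hu : u < n) (hv : v < n) (h : P u v x p) :
    TableOK n c P B (u * n + v) x p := by
  have := idx_lt hu hv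
  refine ⟨hp, this.le, fun u' _ v' hv' hd => ?_, fun hd => by omega⟩
  obtain ⟨rfl, rfl⟩ := idx_inj hv hv' hd
  exact h

theorem TableOK.last {c p : ℕ} {x : ℝ} {P : ℕ → ℕ → ℝ → ℕ → Prop} {B : ℝ → ℕ → Prop}
    (hp : p < c) (h : B x p) : TableOK n c P B (n * n) x p := by
  refine ⟨hp, le_rfl, fun u' hu' v' hv' hd => ?_, fun _ => h⟩
  have := idx_lt hu' hv'
  omega

/-- The candidate with area `x` whose points are listed at the node `p` is an admissible set. -/
def BestOK (n : ℕ) (X Y : ℕ → ℝ) (σ : State) (x : ℝ) (p : ℕ) : Prop :=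
  ∃ S, ChainIn σ p S ∧ Admissible n Y S ∧ x = ∑ j ∈ Finset.range n, slab X Y S j

/-- The set `C` together with `k` if `k` is one of the bounds `u` and `v`. -/
def withBounds (k u v : ℕ) (C : Set ℕ) : Set ℕ := if u = k ∨ v = k then insert k C else C

/-- The rules applied at each step to the entries of the old table. -/
def mainSpecs (Y : ℕ → ℝ) (hnM : n * n < M) (hk : k < n) : List (RuleSpec M n k Y) :=
  [keepSpec Y hnM hk, upperRiseSpec Y hnM hk, upperFallSpec Y hnM hk, lowerFallSpec Y hnM hk,
    lowerRiseSpec Y hnM hk, crossDownSpec Y hnM hk, crossUpSpec Y hnM hk, endLowSpec Y hnM hk,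
    endHighSpec Y hnM hk, endSpec Y hnM hk]

def turnSpecs (Y : ℕ → ℝ) (hnM : n * n < M) (hk : k < n) : List (RuleSpec M n k Y) :=
  [turnUpperSpec Y hnM hk, turnLowerSpec Y hnM hk]

def mainBody : Stmt := seqs [keepRule.stmt, upperRiseRule.stmt, upperFallRule.stmt,
  lowerFallRule.stmt, lowerRiseRule.stmt, crossDownRule.stmt, crossUpRule.stmt, endLowRule.stmt,
  endHighRule.stmt, endRule.stmt]

def turnBody : Stmt := seqs [turnUpperRule.stmt, turnLowerRule.stmt]

theorem keep_true_neg {v : ℕ} (h1 : v ≠ k) (h2 : Y v < Y k) : Keep (-Y) True k v :=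
  ⟨h1, fun _ => by simpa using h2⟩

/-- The lists at sources with a bound `k` already contain `k`, while those at destinations with a
bound `k` receive it only after the pass. `withBounds` accounts for both, so that each rule merely
copies a link. -/
theorem mainSpecs_sound (hnM : n * n < M) (hk : k < n) {c : ℕ}
    (hsrc : ∀ u < n, ∀ v < n, σ.int 3 (u * n + v) ≠ 0 → ∃ S₀,
      Good X Y k u v S₀ (σ.real 4 (u * n + v)) ∧
      ChainIn σ (σ.int 3 (u * n + v)) (withBounds k u v S₀)) (hlt : ∀ d, σ.int 3 d < c) :
    ∀ R ∈ mainSpecs Y hnM hk, R.Sound (TableOK n c (fun u v x p => ∃ C, ChainIn σ p C ∧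
      HalfGood X Y k u v (withBounds k u v C) x) (BestOK n X Y σ)) σ := by
  have neither : ∀ {u v : ℕ} {C : Set ℕ}, u ≠ k → v ≠ k → withBounds k u v C = C := by
    intro u v C hu hv; simp [withBounds, hu, hv]
  have left : ∀ {v : ℕ} {C : Set ℕ}, withBounds k k v C = insert k C := by
    intro v C; simp [withBounds]
  have right : ∀ {u : ℕ} {C : Set ℕ}, withBounds k u k C = insert k C := by
    intro v C; simp [withBounds]
  have fin : ∀ {u v : ℕ} {S₀ : Set ℕ} {x : ℝ} {p : ℕ}, Good X Y k u v S₀ x → Touch Y k u →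
      Touch (-Y) k v → ChainIn σ p (insert k S₀) → BestOK n X Y σ x p := by
    intro u v S₀ x p hG h1 h2 hC
    obtain ⟨g1, g2, g3⟩ := hG.finish h1 h2 hk
    exact ⟨_, hC, ⟨g1, fun p _ => g3 p⟩, g2⟩
  intro R hR u hu v hv hG x p hp h3 _
  simp only [mainSpecs, List.mem_cons, List.not_mem_nil, or_false] at hR
  rcases hR with rfl | rfl | rfl | rfl | rfl | rfl | rfl | rfl | rfl | rfl <;>
    obtain ⟨rfl, rfl⟩ := h3 rfl
  · obtain ⟨h1, h2, h3⟩ := hG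
    obtain ⟨S₀, hg, hC⟩ := hsrc u hu v hv hp
    rw [neither h1 h2] at hC
    refine .cell (hlt _) hu hv ⟨S₀, hC, ?_⟩
    rw [neither h1 h2]
    exact hg.skip ⟨h1, False.elim⟩ ⟨h2, False.elim⟩ h3
  · obtain ⟨⟨h1, h2⟩, h3, h4⟩ := hG
    obtain ⟨S₀, hg, hC⟩ := hsrc u hu v hv hp
    rw [neither h1.ne h3] at hC
    refine .cell (hlt _) hk hv ⟨S₀, hC, ?_⟩
    rw [left]
    exact hg.move_keep (Or.inl ⟨h1, h2, Or.inl rfl⟩) (keep_true_neg h3 h4)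
  · obtain ⟨⟨h1, h2⟩, h3, h4⟩ := hG
    obtain ⟨S₀, hg, hC⟩ := hsrc k hk v hv hp
    rw [left] at hC
    refine .cell (hlt _) hu hv ⟨_, hC, ?_⟩
    rw [neither h1.ne' h3]
    exact hg.move_keep (Or.inr ⟨rfl, h1, h2⟩) (keep_true_neg h3 h4)
  · obtain ⟨⟨h1, h2⟩, h3, h4⟩ := hG
    obtain ⟨S₀, hg, hC⟩ := hsrc u hu v hv hp
    rw [neither h3 h1.ne] at hC
    refine .cell (hlt _) hu hk ⟨S₀, hC, ?_⟩
    rw [right]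
    exact hg.keep_move ⟨h3, fun _ => h4⟩ (Or.inl ⟨h1, by simpa using h2, Or.inl rfl⟩)
  · obtain ⟨⟨h1, h2⟩, h3, h4⟩ := hG
    obtain ⟨S₀, hg, hC⟩ := hsrc u hu k hk hp
    rw [right] at hC
    refine .cell (hlt _) hu hv ⟨_, hC, ?_⟩
    rw [neither h3 h1.ne']
    exact hg.keep_move ⟨h3, fun _ => h4⟩ (Or.inr ⟨rfl, h1, by simpa using h2⟩)
  · obtain ⟨⟨h1, h2⟩, h3, h4⟩ := hG
    obtain ⟨S₀, hg, hC⟩ := hsrc k hk v hv hp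
    rw [left] at hC
    refine .cell (hlt _) hu hk ⟨_, hC, ?_⟩
    -- At a pinch `k` is a bound both before and after, so it is appended twice.
    rw [right, Set.insert_eq_of_mem (Set.mem_insert _ _)]
    exact hg.move_move (Or.inr ⟨rfl, h3, h4⟩) (Or.inl ⟨h1, by simpa using h2, Or.inl rfl⟩)
  · obtain ⟨⟨h1, h2⟩, h3, h4⟩ := hG
    obtain ⟨S₀, hg, hC⟩ := hsrc u hu k hk hp
    rw [right] at hC
    refine .cell (hlt _) hk hv ⟨_, hC, ?_⟩
    rw [left, Set.insert_eq_of_mem (Set.mem_insert _ _)]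
    exact hg.move_move (Or.inl ⟨h1, h2, Or.inl rfl⟩) (Or.inr ⟨rfl, h3, by simpa using h4⟩)
  · obtain ⟨h1, h2⟩ := hG
    obtain ⟨S₀, hg, hC⟩ := hsrc k hk v hv hp
    rw [left] at hC
    exact .last (hlt _) (fin hg (Or.inl rfl) (Or.inr ⟨h1, by simpa using h2⟩) hC)
  · obtain ⟨h1, h2⟩ := hG
    obtain ⟨S₀, hg, hC⟩ := hsrc u hu k hk hp
    rw [right] at hC
    exact .last (hlt _) (fin hg (Or.inr ⟨h1, h2⟩) (Or.inl rfl) hC)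
  · obtain ⟨S₀, hg, hC⟩ := hsrc k hk k hk hp
    rw [left] at hC
    exact .last (hlt _) (fin hg (Or.inl rfl) (Or.inl rfl) hC)

theorem turnSpecs_sound (hnM : n * n < M) (hk : k < n) {c : ℕ} {B : ℝ → ℕ → Prop} :
    ∀ R ∈ turnSpecs Y hnM hk, R.Sound (TableOK n c (fun u v x p => ∃ C, ChainIn σ p C ∧
      HalfGood X Y k u v C x) B) σ := by
  intro R hR u hu v hv hG x p hp _ h4
  simp only [turnSpecs, List.mem_cons, List.not_mem_nil, or_false] at hR
  rcases hR with rfl | rfl <;> obtain ⟨g1, -, g2, -⟩ := h4 rfl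
  · obtain ⟨C, hC, hh⟩ := g2 k hk v hv rfl
    exact .cell g1 hu hv ⟨C, hC, hh.turn_left hG.1 hG.2⟩
  · obtain ⟨C, hC, hh⟩ := g2 u hu k hk rfl
    exact .cell g1 hu hv ⟨C, hC, hh.turn_right hG.1 hG.2⟩

end RealRAM
end

/-! ### The invariant of the sweep -/

noncomputable section


namespace RealRAM
open Sweep

variable {M T T' n k : ℕ} {s s' : Stmt} {σ σ₀ : State} {Q Q' : State → Prop} {X Y : ℕ → ℝ}
  {ID : ℕ → ℕ}

/-- The state of the dynamic program when the points before `k` have been processed. -/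
structure StepInv (n : ℕ) (ID : ℕ → ℕ) (X Y : ℕ → ℝ) (k : ℕ) (σ : State) : Prop where
  size : σ.int 0 0 = n
  out : ∀ i, σ.int 1 i = 0
  id : σ.int 2 = ID
  abscissae : σ.real 2 = X
  ordinates : σ.real 3 = Y
  pos : 0 < σ.int 10 0
  count : σ.int 10 0 ≤ 1 + k * (4 * n + 1)
  lt3 : ∀ d, σ.int 3 d < σ.int 10 0
  lt4 : σ.int 4 (n * n) < σ.int 10 0
  zero4 : ∀ d ≠ n * n, σ.int 4 d = 0
  sound : ∀ u < n, ∀ v < n, σ.int 3 (u * n + v) ≠ 0 → ∃ S₀,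
    ChainIn σ (σ.int 3 (u * n + v)) S₀ ∧ Good X Y k u v S₀ (σ.real 4 (u * n + v))
  complete : ∀ S, Admissible n Y S → ∀ a b, Source Y S k a → Source (-Y) S k b →
    σ.int 3 (a * n + b) ≠ 0 ∧
      ∑ j ∈ Finset.range (k + 1), slab X Y S j ≤ σ.real 4 (a * n + b)
  best : σ.int 4 (n * n) ≠ 0 → BestOK n X Y σ (σ.real 5 (n * n)) (σ.int 4 (n * n))
  best_complete : ∀ S, Admissible n Y S → ∀ r ∈ S, (∀ s ∈ S, s ≤ r) → (∃ s ∈ S, s < r) → r < k →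
    σ.int 4 (n * n) ≠ 0 ∧ ∑ j ∈ Finset.range n, slab X Y S j ≤ σ.real 5 (n * n)

/-- The treatment of one point. -/
def stepStmt : Stmt :=
  .seq (pushAll 3) (.seq startStmt (.seq (for2 mainBody) (.seq (pushAll 4)
    (.seq (for2 turnBody) (for2 copyStmt)))))

/-- The number of steps of `stepStmt` is at most `stepConst * (n + 1) ^ 2`. -/
def stepConst : ℕ :=
  ((push 3 (idx vK vV)).bound + (push 3 (idx vV vK)).bound + 12) + startStmt.bound +
  (mainBody.bound + 24) + ((push 4 (idx vK vV)).bound + (push 4 (idx vV vK)).bound + 12) +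
  (turnBody.bound + 24) + (copyStmt.bound + 24)

/-- The order of the parts matters. Fulfilled promises get `k` appended before the main pass, while
they are still in row or column `k`. New records get it after the main pass but before the turns,
which copy their lists to other cells. -/
theorem step_runs (hY : Set.InjOn Y (Set.Iio n)) (hk : k < n) (hM : 1 < M) (hnM : n * n < M)
    (hkM : k + 1 < M) (hcM : 1 + n * (4 * n + 1) < M) (hI : StepInv n ID X Y k σ)
    (h7 : σ.int 7 0 = k) :
    Runs M stepStmt σ (stepConst * (n + 1) ^ 2)
      fun σ' => σ'.int 7 0 = k ∧ StepInv n ID X Y (k + 1) σ' := by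
  have hcross : ∀ u < n, ∀ v < n, (u * n + v ∈ {d | ∃ w < n, d = k * n + w ∨ d = w * n + k} ↔
      u = k ∨ v = k) := by
    intro u hu v hv
    simp only [Set.mem_ofPred_eq]
    constructor
    · rintro ⟨w, hw, h | h⟩
      · exact Or.inl (idx_inj hv hw h).1
      · exact Or.inr (idx_inj hv hk h).2
    · rintro (rfl | rfl)
      · exact ⟨v, hv, Or.inl rfl⟩
      · exact ⟨u, hu, Or.inr rfl⟩
  have hnn : n * n ∉ {d | ∃ w < n, d = k * n + w ∨ d = w * n + k} := by
    rintro ⟨w, hw, h | h⟩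
    · have := idx_lt hk hw; omega
    · have := idx_lt hw hk; omega
  -- At most `2 * n` new nodes for each table and one for the start.
  have hcount : σ.int 10 0 + 4 * n + 1 < M := by
    have h1 := hI.count
    have h2 : k * (4 * n + 1) + (4 * n + 1) ≤ n * (4 * n + 1) := by
      rw [← Nat.succ_mul]; exact Nat.mul_le_mul_right _ hk
    omega
  have hkk : k * n + k ≠ n * n := (idx_lt hk hk).ne
  have hpos := hI.pos
  -- extend the lists of the old table
  have hrun : Runs M stepStmt σ
      ((((push 3 (idx vK vV)).bound + (push 3 (idx vV vK)).bound + 12) * (n + 1)) +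
        (startStmt.bound + (((mainBody.bound + 12) * (n + 1) + 12) * (n + 1) +
        ((((push 4 (idx vK vV)).bound + (push 4 (idx vV vK)).bound + 12) * (n + 1)) +
        (((turnBody.bound + 12) * (n + 1) + 12) * (n + 1) +
        ((copyStmt.bound + 12) * (n + 1) + 12) * (n + 1))))))
      fun σ' => σ'.int 7 0 = k ∧ StepInv n ID X Y (k + 1) σ' := by
    refine Runs.seq (pushAll_runs (Or.inl rfl) hI.size h7 hk hnM hM (by omega) hI.lt3) fun σ₁ h₁ => ?_
    have n₁ : σ₁.int 0 0 = n := by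
      rw [h₁.int 0 (by omega) (by omega) (by omega) (by omega) (by omega), hI.size]
    have k₁ : σ₁.int 7 0 = k := by
      rw [h₁.int 7 (by omega) (by omega) (by omega) (by omega) (by omega), h7]
    have l₁ := h₁.le
    have c₁ := h₁.count
    have four₁ : σ₁.int 4 = σ.int 4 :=
      h₁.int 4 (by omega) (by omega) (by omega) (by omega) (by omega)
    have src₁ : ∀ u < n, ∀ v < n, σ₁.int 3 (u * n + v) ≠ 0 → ∃ S₀,
        Good X Y k u v S₀ (σ₁.real 4 (u * n + v)) ∧
        ChainIn σ₁ (σ₁.int 3 (u * n + v)) (withBounds k u v S₀) := by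
      intro u hu v hv hne
      have hne' : σ.int 3 (u * n + v) ≠ 0 := fun h => hne ((h₁.zero _).2 h)
      obtain ⟨S₀, hC, hg⟩ := hI.sound u hu v hv hne'
      refine ⟨S₀, by rw [h₁.real]; exact hg, ?_⟩
      by_cases huv : u = k ∨ v = k
      · rw [withBounds, if_pos huv]
        exact h₁.new _ ((hcross u hu v hv).2 huv) hne' _ hC
      · rw [withBounds, if_neg huv, h₁.ne _ fun h => huv ((hcross u hu v hv).1 h)]
        exact h₁.old _ (hI.lt3 _) _ hC
    -- start
    refine Runs.seq (start_runs n₁ k₁ hk hnM (by omega) (by omega)) fun σ₂ h₂ => ?_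
    have n₂ : σ₂.int 0 0 = n := by rw [h₂.int 0 (by omega) (by omega) (by omega) (by omega), n₁]
    have k₂ : σ₂.int 7 0 = k := by rw [h₂.int 7 (by omega) (by omega) (by omega) (by omega), k₁]
    have three₂ : σ₂.int 3 = σ₁.int 3 := h₂.int 3 (by omega) (by omega) (by omega) (by omega)
    have y₂ : σ₂.real 3 = Y := by rw [h₂.real 3 (by omega), h₁.real, hI.ordinates]
    have c₂ := h₂.count
    have lt₂ : ∀ d, σ₂.int 3 d < σ₂.int 10 0 := fun d => by
      have := h₁.lt d
      rw [three₂]; omega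
    have src₂ : ∀ u < n, ∀ v < n, σ₂.int 3 (u * n + v) ≠ 0 → ∃ S₀,
        Good X Y k u v S₀ (σ₂.real 4 (u * n + v)) ∧
        ChainIn σ₂ (σ₂.int 3 (u * n + v)) (withBounds k u v S₀) := by
      intro u hu v hv hne
      rw [three₂] at hne ⊢
      obtain ⟨S₀, hg, hC⟩ := src₁ u hu v hv hne
      exact ⟨S₀, by rw [h₂.real 4 (by omega)]; exact hg, h₂.old _ (h₁.lt _) _ hC⟩
    have tbl₂ : ∀ d, σ₂.int 4 d ≠ 0 → TableOK n (σ₂.int 10 0) (fun u v x p => ∃ C, ChainIn σ₂ p C ∧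
        HalfGood X Y k u v (withBounds k u v C) x) (BestOK n X Y σ₂) d (σ₂.real 5 d)
        (σ₂.int 4 d) := by
      intro d hd
      rw [h₂.link] at hd ⊢
      rw [h₂.val]
      by_cases hdk : d = k * n + k
      · subst hdk
        rw [if_pos rfl, if_pos rfl]
        refine .cell (by omega) hk hk ⟨{k}, h₂.new, ?_⟩
        have : withBounds k k k {k} = {k} := by simp [withBounds]
        rw [this]
        exact .start
      · rw [if_neg hdk] at hd
        rw [if_neg hdk, if_neg hdk]
        rw [four₁] at hd ⊢
        obtain rfl : d = n * n := by
          by_contra h; exact hd (hI.zero4 d h)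
        have hl := hI.lt4
        obtain ⟨S, hC, hA, hx⟩ := hI.best hd
        refine .last (by omega) ⟨S, h₂.old _ (by omega) _ (h₁.old _ hl _ hC), hA, ?_⟩
        rw [h₁.real, hx]
    -- the main pass
    have hb₂ : σ₂.int 10 0 < M := by omega
    refine Runs.seq (RuleSpec.runs_pass (mainSpecs Y hnM hk) hM (by omega)
      (fun d => (lt₂ d).trans hb₂) (fun d x p h => h.1.trans hb₂) n₂ k₂ y₂
      (mainSpecs_sound hnM hk src₂ lt₂) tbl₂) fun σ₃ ⟨h₃, done₃⟩ => ?_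
    have i₃ : ∀ a, a ≠ 4 → a ≠ 8 → a ≠ 9 → σ₃.int a = σ₂.int a := h₃.int
    have n₃ : σ₃.int 0 0 = n := by rw [i₃ 0 (by omega) (by omega) (by omega), n₂]
    have k₃ : σ₃.int 7 0 = k := by rw [i₃ 7 (by omega) (by omega) (by omega), k₂]
    have c₃ : σ₃.int 10 0 = σ₂.int 10 0 := by rw [i₃ 10 (by omega) (by omega) (by omega)]
    have ch₃ : ∀ p C, ChainIn σ₂ p C → ChainIn σ₃ p C := fun p C h => by
      unfold ChainIn
      rw [i₃ 5 (by omega) (by omega) (by omega), i₃ 6 (by omega) (by omega) (by omega)]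
      exact h
    have lt₃ : ∀ d, σ₃.int 4 d < σ₃.int 10 0 := fun d => by
      by_cases h : σ₃.int 4 d = 0
      · omega
      · rw [c₃]; exact (h₃.sound d h).1
    -- extend the lists of the new table
    refine Runs.seq (pushAll_runs (Or.inr rfl) n₃ k₃ hk hnM hM (by omega) lt₃) fun σ₄ h₄ => ?_
    have i₄ := h₄.int
    have n₄ : σ₄.int 0 0 = n := by
      rw [i₄ 0 (by omega) (by omega) (by omega) (by omega) (by omega), n₃]
    have k₄ : σ₄.int 7 0 = k := by
      rw [i₄ 7 (by omega) (by omega) (by omega) (by omega) (by omega), k₃]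
    have y₄ : σ₄.real 3 = Y := by rw [h₄.real, h₃.real 3 (by omega), y₂]
    have l₄ := h₄.le
    have c₄ := h₄.count
    have tbl₄ : ∀ d, σ₄.int 4 d ≠ 0 → TableOK n (σ₄.int 10 0) (fun u v x p => ∃ C, ChainIn σ₄ p C ∧
        HalfGood X Y k u v C x) (BestOK n X Y σ₄) d (σ₄.real 5 d) (σ₄.int 4 d) := by
      intro d hd
      have hd' : σ₃.int 4 d ≠ 0 := fun h => hd ((h₄.zero d).2 h)
      obtain ⟨g1, g2, g3, g4⟩ := h₃.sound d hd'
      refine ⟨h₄.lt d, g2, fun u hu v hv huv => ?_, fun hdn => ?_⟩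
      · obtain ⟨C, hC, hh⟩ := g3 u hu v hv huv
        refine ⟨withBounds k u v C, ?_, by rw [h₄.real]; exact hh⟩
        subst huv
        by_cases huv : u = k ∨ v = k
        · rw [withBounds, if_pos huv]
          exact h₄.new _ ((hcross u hu v hv).2 huv) hd' _ (ch₃ _ _ hC)
        · rw [withBounds, if_neg huv, h₄.ne _ fun h => huv ((hcross u hu v hv).1 h)]
          exact h₄.old _ (lt₃ _) _ (ch₃ _ _ hC)
      · obtain ⟨S, hC, hA, hx⟩ := g4 hdn
        subst hdn
        rw [h₄.real]
        refine ⟨S, ?_, hA, hx⟩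
        rw [h₄.ne _ hnn]
        exact h₄.old _ (lt₃ _) _ (ch₃ _ _ hC)
    -- the second pass
    have lt3₄ : ∀ d, σ₄.int 3 d < M := fun d => by
      rw [i₄ 3 (by omega) (by omega) (by omega) (by omega) (by omega),
        i₃ 3 (by omega) (by omega) (by omega)]
      exact (lt₂ d).trans hb₂
    refine Runs.seq (RuleSpec.runs_pass (turnSpecs Y hnM hk) hM (by omega) lt3₄
      (fun d x p h => h.1.trans (by omega)) n₄ k₄ y₄ (turnSpecs_sound hnM hk) tbl₄)
      fun σ₅ ⟨h₅, done₅⟩ => ?_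
    have i₅ := h₅.int
    have n₅ : σ₅.int 0 0 = n := by rw [i₅ 0 (by omega) (by omega) (by omega), n₄]
    have k₅ : σ₅.int 7 0 = k := by rw [i₅ 7 (by omega) (by omega) (by omega), k₄]
    have c₅ : σ₅.int 10 0 = σ₄.int 10 0 := by rw [i₅ 10 (by omega) (by omega) (by omega)]
    have y₅ : σ₅.real 3 = Y := by rw [h₅.real 3 (by omega), y₄]
    have x₅ : σ₅.real 2 = X := by
      rw [h₅.real 2 (by omega), h₄.real, h₃.real 2 (by omega), h₂.real 2 (by omega), h₁.real,
        hI.abscissae]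
    have lt₅ : ∀ d, σ₅.int 4 d < σ₅.int 10 0 := fun d => by
      by_cases h : σ₅.int 4 d = 0
      · omega
      · rw [c₅]; exact (h₅.sound d h).1
    -- the copy
    refine (copy_runs n₅ k₅ hk hM hnM hkM (fun d => (lt₅ d).trans (by omega)) x₅ y₅).imp
      fun σ₆ h₆ => ?_
    have i₆ := h₆.int
    have c₆ : σ₆.int 10 0 = σ₅.int 10 0 := by
      rw [i₆ 10 (by omega) (by omega) (by omega) (by omega)]
    have ch₆ : ∀ p C, ChainIn σ₄ p C → ChainIn σ₆ p C := fun p C h => by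
      unfold ChainIn
      rw [i₆ 5 (by omega) (by omega) (by omega) (by omega),
        i₆ 6 (by omega) (by omega) (by omega) (by omega),
        i₅ 5 (by omega) (by omega) (by omega), i₅ 6 (by omega) (by omega) (by omega)]
      exact h
    have fixed : ∀ a, a = 0 ∨ a = 1 ∨ a = 2 ∨ a = 7 → σ₆.int a = σ.int a := by
      intro a ha
      rw [i₆ a (by omega) (by omega) (by omega) (by omega), i₅ a (by omega) (by omega) (by omega),
        i₄ a (by omega) (by omega) (by omega) (by omega) (by omega),
        i₃ a (by omega) (by omega) (by omega), h₂.int a (by omega) (by omega) (by omega) (by omega),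
        h₁.int a (by omega) (by omega) (by omega) (by omega) (by omega)]
    have mono : ∀ d, σ₃.int 4 d ≠ 0 → σ₅.int 4 d ≠ 0 ∧ σ₃.real 5 d ≤ σ₅.real 5 d := by
      intro d hd
      have := h₅.mono d fun h => hd ((h₄.zero d).1 h)
      rwa [h₄.real] at this
    -- The cell `n * n` is outside the range that is copied and cleared, so the best finished hull
    -- survives the step.
    have hnn6 : n * n ∉ Set.Iio (n * n) := by simp
    have last6 : σ₆.int 4 (n * n) = σ₅.int 4 (n * n) := h₆.ne4 _ hnn6
    have r6 : σ₆.real 5 = σ₅.real 5 := h₆.real 5 (by omega)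
    refine ⟨by rw [fixed 7 (by omega), h7], ?_⟩
    have src_done : ∀ S, Admissible n Y S → ∀ a b, Source Y S k a → Source (-Y) S k b →
        σ₂.int 3 (a * n + b) ≠ 0 ∧
          ∑ j ∈ Finset.range (k + 1), slab X Y S j ≤ σ₂.real 4 (a * n + b) := by
      intro S hS a b ha hb
      obtain ⟨g1, g2⟩ := hI.complete S hS a b ha hb
      rw [three₂, h₂.real 4 (by omega), h₁.real]
      exact ⟨fun h => g1 ((h₁.zero _).1 h), g2⟩
    refine ⟨by rw [fixed 0 (by omega)]; exact hI.size, by rw [fixed 1 (by omega)]; exact hI.out,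
      by rw [fixed 2 (by omega)]; exact hI.id, by rw [h₆.real 2 (by omega), x₅],
      by rw [h₆.real 3 (by omega), y₅], by omega, ?_, fun d => ?_, ?_, fun d hd => ?_,
      fun u hu v hv hne => ?_, fun S hS a b ha hb => ?_, fun hne => ?_, ?_⟩
    · have h1 := hI.count
      have h2 : (k + 1) * (4 * n + 1) = k * (4 * n + 1) + (4 * n + 1) := Nat.succ_mul _ _
      omega
    · by_cases hd : d < n * n
      · rw [h₆.link d hd, c₆]; exact lt₅ d
      · rw [h₆.ne3 d hd, i₅ 3 (by omega) (by omega) (by omega),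
          i₄ 3 (by omega) (by omega) (by omega) (by omega) (by omega),
          i₃ 3 (by omega) (by omega) (by omega)]
        have := lt₂ d
        omega
    · rw [last6, c₆]; exact lt₅ _
    · by_cases hd' : d < n * n
      · exact h₆.clear d hd'
      · rw [h₆.ne4 d hd']
        by_contra h
        have := (h₅.sound d h).2.1
        omega
    · have huv := idx_lt hu hv
      rw [h₆.link _ huv] at hne ⊢
      obtain ⟨-, -, g3, -⟩ := h₅.sound _ hne
      obtain ⟨C, hC, hh⟩ := g3 u hu v hv rfl
      refine ⟨C, ch₆ _ _ hC, ?_⟩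
      rw [h₆.val u hu v hv huv]
      exact hh.good_succ
    · have han : a < n := hS.1 ha.mem
      have hbn : b < n := hS.1 hb.mem
      have hab := idx_lt han hbn
      rw [h₆.link _ hab, h₆.val a han b hbn hab, Finset.sum_range_succ, slab_eq ha hb]
      suffices h : σ₅.int 4 (a * n + b) ≠ 0 ∧
          ∑ j ∈ Finset.range (k + 1), slab X Y S j ≤ σ₅.real 5 (a * n + b) from
        ⟨h.1, add_le_add h.2 le_rfl⟩
      set x := ∑ j ∈ Finset.range (k + 1), slab X Y S j with hx
      have hdone : ∀ R ∈ mainSpecs Y hnM hk, R.rule.tp = 3 ∧ R.rule.tv = 4 := by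
        intro R hR
        simp only [mainSpecs, List.mem_cons, List.not_mem_nil, or_false] at hR
        rcases hR with rfl | rfl | rfl | rfl | rfl | rfl | rfl | rfl | rfl | rfl <;> exact ⟨rfl, rfl⟩
      have main : ∀ R ∈ mainSpecs Y hnM hk, ∀ u < n, ∀ v < n, R.G u v →
          (σ₂.int 3 (R.S u v) ≠ 0 ∧ x ≤ σ₂.real 4 (R.S u v)) →
          (σ₃.int 4 (R.D u v) ≠ 0 ∧ x ≤ σ₃.real 5 (R.D u v)) := by
        intro R hR u hu v hv hG hsrc
        have := done₃ R hR u hu v hv hG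
        rw [(hdone R hR).1, (hdone R hR).2] at this
        exact ⟨(this hsrc.1).1, hsrc.2.trans (this hsrc.1).2⟩
      have turn : ∀ R ∈ turnSpecs Y hnM hk, R.rule.tp = 4 → R.rule.tv = 5 → ∀ u < n, ∀ v < n,
          R.G u v → (σ₃.int 4 (R.S u v) ≠ 0 ∧ x ≤ σ₃.real 5 (R.S u v)) →
          (σ₅.int 4 (R.D u v) ≠ 0 ∧ x ≤ σ₅.real 5 (R.D u v)) := by
        intro R hR htp htv u hu v hv hG hsrc
        have := done₅ R hR u hu v hv hG
        rw [htp, htv, h₄.real] at this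
        have := this fun h => hsrc.1 ((h₄.zero _).1 h)
        exact ⟨this.1, hsrc.2.trans this.2⟩
      refine complete_step (X := X) hY hS hk
        (A := fun a b => σ₂.int 3 (a * n + b) ≠ 0 ∧ x ≤ σ₂.real 4 (a * n + b))
        (B := fun a b => σ₃.int 4 (a * n + b) ≠ 0 ∧ x ≤ σ₃.real 5 (a * n + b))
        (C := fun a b => σ₅.int 4 (a * n + b) ≠ 0 ∧ x ≤ σ₅.real 5 (a * n + b))
        (src_done S hS) (fun a _ b _ h => ⟨(mono _ h.1).1, h.2.trans (mono _ h.1).2⟩)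
        (fun h0 => ?_) (main (keepSpec Y hnM hk) (by simp [mainSpecs]))
        (main (upperRiseSpec Y hnM hk) (by simp [mainSpecs]))
        (main (upperFallSpec Y hnM hk) (by simp [mainSpecs]))
        (main (lowerFallSpec Y hnM hk) (by simp [mainSpecs]))
        (main (lowerRiseSpec Y hnM hk) (by simp [mainSpecs]))
        (main (crossDownSpec Y hnM hk) (by simp [mainSpecs]))
        (main (crossUpSpec Y hnM hk) (by simp [mainSpecs]))
        (turn (turnUpperSpec Y hnM hk) (by simp [turnSpecs]) rfl rfl)
        (turn (turnLowerSpec Y hnM hk) (by simp [turnSpecs]) rfl rfl) ha hb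
      have hl : σ₂.int 4 (k * n + k) ≠ 0 := by rw [h₂.link, if_pos rfl]; omega
      have := h₃.mono _ hl
      rw [h₂.val, if_pos rfl] at this
      exact ⟨this.1, by rw [hx, h0]; exact this.2⟩
    · rw [last6] at hne ⊢
      rw [r6]
      obtain ⟨-, -, -, g4⟩ := h₅.sound _ hne
      obtain ⟨S, hC, hA, hx⟩ := g4 rfl
      refine ⟨S, ch₆ _ _ ?_, hA, hx⟩
      unfold ChainIn at hC ⊢
      exact hC
    · intro S hS r hr hmax hlt hrk
      rw [last6, r6]
      rcases (show r < k ∨ r = k by omega) with hrk | rfl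
      · obtain ⟨g1, g2⟩ := hI.best_complete S hS r hr hmax hlt hrk
        have e1 : σ₂.int 4 (n * n) = σ.int 4 (n * n) := by
          rw [h₂.link, if_neg hkk.symm, four₁]
        have e2 : σ₂.real 5 (n * n) = σ.real 5 (n * n) := by
          rw [h₂.val, if_neg hkk.symm, h₁.real]
        have m := h₃.mono (n * n) (by rw [e1]; exact g1)
        have m' := mono _ m.1
        exact ⟨m'.1, by rw [e2] at m; exact g2.trans (m.2.trans m'.2)⟩
      -- Now `r` is the last chosen point. The later slabs are empty, so the area is complete at
      -- slab `r`, and by `last_cases` one of the three end rules applies to its sources.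
      · rw [sum_slab_eq hmax hk]
        obtain ⟨a, ha⟩ := exists_source hY hS.1 hlt ⟨r, hr, le_rfl⟩
        obtain ⟨b, hb⟩ := exists_source (Z := -Y)
          (fun i hi j hj h => hY hi hj (by simpa using h)) hS.1 hlt ⟨r, hr, le_rfl⟩
        have hsrc := src_done S hS a b ha hb
        have han : a < n := hS.1 ha.mem
        have hbn : b < n := hS.1 hb.mem
        suffices h : σ₃.int 4 (n * n) ≠ 0 ∧
            ∑ j ∈ Finset.range (r + 1), slab X Y S j ≤ σ₃.real 5 (n * n) from
          ⟨(mono _ h.1).1, h.2.trans (mono _ h.1).2⟩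
        rcases last_cases hmax ha hb with ⟨rfl, rfl⟩ | ⟨rfl, g1, g2⟩ | ⟨rfl, g1, g2⟩
        · have := done₃ (endSpec Y hnM hk) (by simp [mainSpecs]) _ hk _ hk trivial hsrc.1
          exact ⟨this.1, hsrc.2.trans this.2⟩
        · have := done₃ (endLowSpec Y hnM hk) (by simp [mainSpecs]) a han b hbn ⟨g1, g2⟩ hsrc.1
          exact ⟨this.1, hsrc.2.trans this.2⟩
        · have := done₃ (endHighSpec Y hnM hk) (by simp [mainSpecs]) a han b hbn ⟨g1, g2⟩ hsrc.1
          exact ⟨this.1, hsrc.2.trans this.2⟩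
  refine hrun.mono ?_ fun _ h => h
  simp only [stepConst]
  generalize (push 3 (idx vK vV)).bound + (push 3 (idx vV vK)).bound + 12 = A
  generalize (push 4 (idx vK vV)).bound + (push 4 (idx vV vK)).bound + 12 = B
  generalize startStmt.bound = C
  generalize mainBody.bound = D
  generalize turnBody.bound = E
  generalize copyStmt.bound = F
  nlinarith [Nat.zero_le n, Nat.zero_le (A * n), Nat.zero_le (B * n), Nat.zero_le (C * n),
    Nat.zero_le (A * n * n), Nat.zero_le (B * n * n), Nat.zero_le (C * n * n), Nat.zero_le (n * n)]

end RealRAM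
end

noncomputable section

set_option linter.unusedSimpArgs false

namespace RealRAM
open Sweep Set

variable {M T T' n k : ℕ} {s s' : Stmt} {σ σ₀ : State} {Q Q' : State → Prop} {X Y x : ℕ → ℝ}
  {ID : ℕ → ℕ}

/-! ### Sorting -/

/-- The number of elements with index below `m` that precede the element `i`. -/
def rankBelow (x : ℕ → ℝ) (m i : ℕ) : ℕ := ((Finset.range m).filter fun j => x j < x i).card

theorem rankBelow_le (m i : ℕ) : rankBelow x m i ≤ m := by
  simpa [rankBelow] using Finset.card_filter_le (Finset.range m) fun j => x j < x i

theorem rankBelow_succ (m i : ℕ) :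
    rankBelow x (m + 1) i = if x m < x i then rankBelow x m i + 1 else rankBelow x m i := by
  unfold rankBelow
  rw [Finset.range_add_one, Finset.filter_insert]
  split_ifs
  · rw [Finset.card_insert_of_notMem (by simp)]
  · rfl

theorem rankBelow_lt {i : ℕ} (hi : i < n) : rankBelow x n i < n := by
  have : rankBelow x n i < (Finset.range n).card := by
    refine Finset.card_lt_card (Finset.filter_ssubset.2 ⟨i, by simpa using hi, lt_irrefl _⟩)
  simpa using this

theorem rankBelow_lt_rankBelow {i j : ℕ} (hi : i < n) (h : x i < x j) :
    rankBelow x n i < rankBelow x n j := by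
  refine Finset.card_lt_card ((Finset.ssubset_iff_of_subset ?_).2 ⟨i, ?_, ?_⟩)
  · intro l hl
    simp only [Finset.mem_filter] at hl ⊢
    exact ⟨hl.1, hl.2.trans h⟩
  · simp [hi, h]
  · simp

theorem rankBelow_injOn (hx : InjOn x (Iio n)) : InjOn (rankBelow x n) (Iio n) := by
  intro i hi j hj h
  by_contra hne
  rcases lt_or_gt_of_ne (fun he => hne (hx hi hj he)) with h' | h'
  · exact (rankBelow_lt_rankBelow hi h').ne h
  · exact (rankBelow_lt_rankBelow hj h').ne h.symm

/-- The ranks form an injective map of a finite set to itself, hence a permutation. -/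
theorem exists_rankBelow_eq (hx : InjOn x (Iio n)) (hk : k < n) : ∃ i < n, rankBelow x n i = k := by
  have h := Finset.surjOn_of_injOn_of_card_le (s := Finset.range n) (t := Finset.range n)
    (rankBelow x n) (fun i hi => by simpa using rankBelow_lt (by simpa using hi))
    (by simpa using rankBelow_injOn hx) le_rfl
  obtain ⟨i, hi, h⟩ := h (by simpa using hk : k ∈ (↑(Finset.range n) : Set ℕ))
  exact ⟨i, by simpa using hi, h⟩

theorem lt_of_rankBelow_lt {i j : ℕ} (hx : InjOn x (Iio n)) (hi : i < n) (hj : j < n)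
    (h : rankBelow x n i < rankBelow x n j) : x i < x j := by
  by_contra hle
  rcases (not_lt.1 hle).eq_or_lt with he | hlt
  · rw [hx hi hj he.symm] at h; exact lt_irrefl _ h
  · exact (rankBelow_lt_rankBelow hj hlt).not_gt h

abbrev vR : IExp := ivar 11

def countStmt : Stmt :=
  .cond (.rlt (.get 0 vV) (.get 0 vU)) (.setInt 11 (.lit 0) (.add vR (.lit 1))) .skip

def storeStmt : Stmt :=
  .seq (.setReal 2 vR (.get 0 vU)) (.seq (.setReal 3 vR (.get 1 vU)) (.setInt 2 vR vU))

/-- Sort the points by their abscissae. -/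
def sortStmt : Stmt :=
  forLoop 8 vN (.seq (.setInt 11 (.lit 0) (.lit 0)) (.seq (forLoop 9 vN countStmt) storeStmt))

structure Sorted (n m : ℕ) (σ₀ σ : State) : Prop where
  int : ∀ a, a ≠ 2 → a ≠ 8 → a ≠ 9 → a ≠ 11 → σ.int a = σ₀.int a
  real : ∀ a, a ≠ 2 → a ≠ 3 → σ.real a = σ₀.real a
  id : ∀ i < m, σ.int 2 (rankBelow (σ₀.real 0) n i) = i
  abscissa : ∀ i < m, σ.real 2 (rankBelow (σ₀.real 0) n i) = σ₀.real 0 i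
  ordinate : ∀ i < m, σ.real 3 (rankBelow (σ₀.real 0) n i) = σ₀.real 1 i

theorem Sorted.congr {m : ℕ} {σ' : State} (h : Sorted n m σ₀ σ) (hr : σ'.real = σ.real)
    (hi : ∀ a, a ≠ 8 → a ≠ 9 → a ≠ 11 → σ'.int a = σ.int a) : Sorted n m σ₀ σ' := by
  refine ⟨fun a h2 h8 h9 h11 => ?_, ?_, ?_, ?_, ?_⟩
  · rw [hi a h8 h9 h11, h.int a h2 h8 h9 h11]
  · rw [hr]; exact h.real
  · rw [hi 2 (by omega) (by omega) (by omega)]; exact h.id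
  · rw [hr]; exact h.abscissa
  · rw [hr]; exact h.ordinate

/-- Counting the smaller abscissae for each point is quadratic, which is well within the cubic
budget. -/
theorem sort_runs (hn : σ₀.int 0 0 = n) (hnM : n + 1 < M) (hx : InjOn (σ₀.real 0) (Iio n)) :
    Runs M sortStmt σ₀
      ((3 + ((countStmt.bound + 12) * (n + 1) + storeStmt.bound) + 12) * (n + 1))
      (Sorted n n σ₀) := by
  have bnd : ∀ τ : State, τ.int 0 0 = n → vN.Fits M τ ∧ vN.eval τ = n := fun τ h =>
    ⟨ivar_fits (by omega) (by omega), h⟩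
  have hM0 : ∀ τ, (IExp.lit 0).Fits M τ := fun τ => by change 0 < M; omega
  refine Runs.forLoop (fun m σ => Sorted n m σ₀ σ) (by omega : n < M) (by omega)
    (fun j σ h => bnd σ ?_) (fun i hi σ h h8 => ?_) ?_
  · rw [h.int 0 (by omega) (by omega) (by omega) (by omega), hn]
  · refine Runs.seq (T := 3) (Q' := fun σ' => σ' = σ.setInt 11 0 0)
      (Runs.setInt (hM0 _) (hM0 _) rfl) fun σ₁ h₁ => ?_
    have s₁ : Sorted n i σ₀ σ₁ := h.congr (by rw [h₁]; rfl) fun a h8 h9 h11 => by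
      rw [h₁, setInt_int_of_ne _ _ _ _ _ h11]
    have u₁ : σ₁.int 8 0 = i := by rw [h₁, setInt_int_of_ne _ _ _ _ _ (by omega), h8]
    refine Runs.seq (Runs.forLoop (σ := σ₁) (T := countStmt.bound)
      (fun j τ => Sorted n i σ₀ τ ∧ τ.int 8 0 = i ∧ τ.int 11 0 = rankBelow (σ₀.real 0) j i)
      (by omega : n < M) (by omega) (fun j τ hτ => bnd τ ?_) (fun j hj τ ⟨t1, t2, t3⟩ h9 => ?_)
      ⟨s₁.congr rfl fun a h8 h9 h11 => setInt_int_of_ne _ _ _ _ _ h9, ?_, ?_⟩)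
      fun σ₂ ⟨t1, t2, t3⟩ => ?_
    · rw [hτ.1.int 0 (by omega) (by omega) (by omega) (by omega), hn]
    · have r0 : τ.real 0 = σ₀.real 0 := t1.real 0 (by omega) (by omega)
      have fV : vV.Fits M τ := ivar_fits (by omega) (by omega)
      have fU : vU.Fits M τ := ivar_fits (by omega) (by omega)
      have hle := rankBelow_le (x := σ₀.real 0) j i
      have iff : (BExp.rlt (.get 0 vV) (.get 0 vU)).Holds τ ↔ σ₀.real 0 j < σ₀.real 0 i := by
        simp [BExp.Holds, RExp.eval, IExp.eval, h9, t2, r0]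
      refine Runs.cond ⟨fV, fU⟩ (fun hlt => ?_) fun hlt => Runs.skip ?_
      · refine Runs.setInt (hM0 _) ⟨ivar_fits (by omega) (by omega), (by omega : 1 < M), ?_⟩ ?_
        · simp only [IExp.eval, t3]; omega
        · rw [iff] at hlt
          refine ⟨by simp [IExp.eval, h9], ?_, by simp [t2], ?_⟩
          · exact t1.congr rfl fun a h8 h9 h11 => by
              rw [setInt_int_of_ne _ _ _ _ _ h9, setInt_int_of_ne _ _ _ _ _ h11]
          · rw [rankBelow_succ, if_pos hlt]
            simp [IExp.eval, t3]
      · rw [iff] at hlt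
        refine ⟨h9, t1.congr rfl fun a h8 h9 h11 => setInt_int_of_ne _ _ _ _ _ h9,
          by simp [t2], ?_⟩
        rw [rankBelow_succ, if_neg hlt]
        simp [t3]
    · simp [u₁]
    · simp [h₁, rankBelow]
    · have hrk := rankBelow_lt (x := σ₀.real 0) hi
      set r := rankBelow (σ₀.real 0) n i with hr
      have r0 : σ₂.real 0 = σ₀.real 0 := t1.real 0 (by omega) (by omega)
      have r1 : σ₂.real 1 = σ₀.real 1 := t1.real 1 (by omega) (by omega)
      have fR : vR.Fits M σ₂ := ivar_fits (by omega) (by omega)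
      have fU : vU.Fits M σ₂ := ivar_fits (by omega) (by omega)
      have eR : vR.eval σ₂ = r := t3
      have eU : vU.eval σ₂ = i := t2
      refine Runs.setReal_seq (M := M) fR fU (Runs.setReal_seq (M := M) ?_ ?_
        (Runs.setInt ?_ ?_ ?_))
      · exact (IExp.fits_congr rfl _).2 fR
      · exact (IExp.fits_congr rfl _).2 fU
      · exact (IExp.fits_congr rfl _).2 fR
      · exact (IExp.fits_congr rfl _).2 fU
      simp only [RExp.eval, IExp.eval, setReal_int, setReal_real, t2, t3]
      have hne : ∀ j < i, rankBelow (σ₀.real 0) n j ≠ r := fun j hj he =>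
        hj.ne (rankBelow_injOn hx (show j < n by omega) hi he)
      refine ⟨by simp [t2], fun a h2 h8 h9 h11 => ?_, fun a h2 h3 => ?_, fun j hj => ?_,
        fun j hj => ?_, fun j hj => ?_⟩
      · rw [setInt_int_of_ne _ _ _ _ _ h8, setInt_int_of_ne _ _ _ _ _ h2]
        exact t1.int a h2 h8 h9 h11
      · rw [setInt_real, setInt_real, setReal_real_of_ne _ _ _ _ _ h3,
          setReal_real_of_ne _ _ _ _ _ h2]
        exact t1.real a h2 h3
      · rcases (show j = i ∨ j < i by omega) with rfl | hj'
        · simp [hr]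
        · simp [hne j hj', t1.id j hj']
      · rcases (show j = i ∨ j < i by omega) with rfl | hj'
        · simp [hr, r0]
        · simp [hne j hj', t1.abscissa j hj']
      · rcases (show j = i ∨ j < i by omega) with rfl | hj'
        · simp [hr, r1]
        · simp [hne j hj', t1.ordinate j hj']
  · refine ⟨fun a h2 h8 h9 h11 => setInt_int_of_ne _ _ _ _ _ h8, fun a _ _ => rfl, ?_, ?_, ?_⟩ <;>
      intro i hi <;> omega

/-! ### Output -/

def markBody : Stmt :=
  .seq (.setInt 1 (.get 2 (.get 5 vU)) (.lit 1)) (.setInt 8 (.lit 0) (.get 6 vU))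

def markTest : BExp := .not (.ieq vU (.lit 0))

/-- Mark the points of the best candidate. -/
def markStmt : Stmt :=
  .seq (.setInt 8 (.lit 0) (.get 4 (.mul vN vN))) (.loop markTest markBody)

def markConst : ℕ := markTest.cost + 1 + markBody.bound

/-- As the links strictly decrease, a list starting at `p` has at most `p` nodes; this bounds the
number of rounds. -/
theorem mark_loop_runs (hM : 1 < M) {p : ℕ} {C : Set ℕ} (hC : Chain (σ₀.int 5) (σ₀.int 6) p C)
    (hCM : ∀ i ∈ C, i < M ∧ σ₀.int 2 i < M) (hp : p < M) :
    ∀ σ, (∀ a, a ≠ 1 → a ≠ 8 → σ.int a = σ₀.int a) → σ.int 8 0 = p →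
      Runs M (.loop markTest markBody) σ (markConst * (p + 1)) fun σ' =>
        ∀ i, σ'.int 1 i = 1 ↔ σ.int 1 i = 1 ∨ ∃ s ∈ C, σ₀.int 2 s = i := by
  induction hC with
  | nil =>
    intro σ hσ h8
    refine ⟨σ, _, .loopFalse ⟨ivar_fits (by omega) (by omega), (by omega : 0 < M)⟩ ?_, ?_, by simp⟩
    · simp [markTest, BExp.Holds, IExp.eval, h8]
    · simp only [markConst]; omega
  | @cons p C hlt hC ih =>
    intro σ hσ h8
    have hpt := hCM _ (Set.mem_insert _ _)
    have f8 : vU.Fits M σ := ivar_fits (by omega) (by omega)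
    have body : Runs M markBody σ markBody.bound
        fun σ' => σ' = (σ.setInt 1 (σ₀.int 2 (σ₀.int 5 p)) 1).setInt 8 0 (σ₀.int 6 p) := by
      refine Runs.setInt_seq (M := M) ⟨⟨f8, ?_⟩, ?_⟩ hM (Runs.setInt (by change 0 < M; omega)
        ⟨?_, ?_⟩ ?_)
      · simp only [IExp.eval, h8, hσ 5 (by omega) (by omega)]; exact hpt.1
      · simp only [IExp.eval, h8, hσ 5 (by omega) (by omega), hσ 2 (by omega) (by omega)]
        exact hpt.2
      · exact ivar_fits (by omega) (by rw [setInt_int_of_ne _ _ _ _ _ (by omega), h8]; exact hp)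
      · simp only [IExp.eval]
        rw [setInt_int_of_ne _ _ _ _ _ (by omega), setInt_int_of_ne _ _ _ _ _ (by omega), h8,
          hσ 6 (by omega) (by omega)]
        omega
      · simp only [IExp.eval]
        rw [setInt_int_of_ne σ 1 6 _ _ (by omega), setInt_int_of_ne σ 1 8 _ _ (by omega), h8,
          hσ 6 (by omega) (by omega), hσ 5 (by omega) (by omega), hσ 2 (by omega) (by omega)]
    obtain ⟨σ₁, t₁, e₁, ht₁, h₁⟩ := body
    obtain ⟨σ₂, t₂, e₂, ht₂, h₂⟩ := ih (fun i hi => hCM i (Set.mem_insert_of_mem _ hi))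
      (by omega) σ₁ (fun a h1 h8 => by
        rw [h₁, setInt_int_of_ne _ _ _ _ _ h8, setInt_int_of_ne _ _ _ _ _ h1, hσ a h1 h8])
      (by simp [h₁])
    refine ⟨σ₂, _, .loopTrue ⟨f8, (by omega : 0 < M)⟩ ?_ e₁ e₂, ?_, fun i => ?_⟩
    · simp only [markTest, BExp.Holds, IExp.eval, h8]; omega
    · have h3 : markConst * (σ₀.int 6 p + 1) + markConst ≤ markConst * (p + 1) := by
        rw [← Nat.mul_succ]; exact Nat.mul_le_mul_left _ (by omega)
      have h4 : markConst = markTest.cost + 1 + markBody.bound := rfl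
      omega
    · rw [h₂, h₁]
      simp only [setInt_int, Set.mem_insert_iff, exists_eq_or_imp]
      by_cases hi : i = σ₀.int 2 (σ₀.int 5 p)
      · simp [hi]
      · simp [hi, Ne.symm hi]

end RealRAM
end

noncomputable section

set_option linter.unusedSimpArgs false

namespace RealRAM
open Sweep Set

variable {M T T' n k : ℕ} {s s' : Stmt} {σ σ₀ : State} {Q Q' : State → Prop} {X Y x : ℕ → ℝ}
  {ID : ℕ → ℕ}

/-! ### The program -/

theorem StepInv.congr {σ' : State} (h : StepInv n ID X Y k σ) (hr : σ'.real = σ.real)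
    (hi : ∀ a ≠ 7, σ'.int a = σ.int a) : StepInv n ID X Y k σ' := by
  have hc : ChainIn σ' = ChainIn σ := by
    unfold ChainIn; rw [hi 5 (by omega), hi 6 (by omega)]
  have hb : BestOK n X Y σ' = BestOK n X Y σ := by
    unfold BestOK; rw [hc]
  obtain ⟨h1, h2, h3, h4, h5, h6, h7, h8, h9, h10, h11, h12, h13, h14⟩ := h
  rw [← hi 0 (by omega)] at h1
  rw [← hi 1 (by omega)] at h2
  rw [← hi 2 (by omega)] at h3
  rw [← hr] at h4 h5
  rw [← hi 10 (by omega)] at h6 h7 h8 h9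
  rw [← hi 3 (by omega)] at h8 h11 h12
  rw [← hi 4 (by omega)] at h9 h10 h13 h14
  rw [← hc, ← hr] at h11
  rw [← hr] at h12 h13 h14
  rw [← hb] at h13
  exact ⟨h1, h2, h3, h4, h5, h6, h7, h8, h9, h10, h11, h12, h13, h14⟩

/-- The program for the maximum-area empty rectilinear convex hull. -/
def program : Stmt :=
  .seq sortStmt (.seq (.setInt 10 (.lit 0) (.lit 1)) (.seq (forLoop 7 vN stepStmt) markStmt))

/-- The size of the machine. -/
def machineSize (n : ℕ) : ℕ := 8 * (n + 1) ^ 2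

def timeConst : ℕ :=
  (27 + countStmt.bound + storeStmt.bound) + 3 + (stepConst + 12) + 8 + markConst * 8

/-- Nothing precedes the slab `0`; hence the empty table is complete when the sweep begins. -/
theorem Source.not_zero {Z : ℕ → ℝ} {S : Set ℕ} {a : ℕ} (h : Source Z S 0 a) : False := by
  obtain ⟨s, ⟨-, hs⟩, -⟩ := h.1.2 (Nat.zero_le a)
  omega

theorem dp_runs (hM : M = machineSize n) (hn : σ.int 0 0 = n)
    (h0 : ∀ a, a ≠ 0 → a ≠ 2 → a ≠ 8 → a ≠ 9 → a ≠ 11 → ∀ i, σ.int a i = 0)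
    (hY : InjOn (σ.real 3) (Iio n)) :
    Runs M (.seq (.setInt 10 (.lit 0) (.lit 1)) (forLoop 7 vN stepStmt)) σ
      (3 + (stepConst * (n + 1) ^ 2 + 12) * (n + 1))
      (StepInv n (σ.int 2) (σ.real 2) (σ.real 3) n) := by
  have e : machineSize n = 8 * (n * n) + 16 * n + 8 := by unfold machineSize; ring
  have e' : n * (4 * n + 1) = 4 * (n * n) + n := by ring
  have hM1 : 1 < M := by omega
  refine Runs.seq (T := 3) (Q' := fun σ' => σ' = σ.setInt 10 0 1)
    (Runs.setInt (by change 0 < M; omega) hM1 rfl) fun σ₁ h₁ => ?_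
  -- The last round reads the abscissa with index `n`, which belongs to no point. The table entries
  -- it produces are never used; only the cell `n * n` is read afterwards.
  refine Runs.forLoop (StepInv n (σ.int 2) (σ.real 2) (σ.real 3)) (by omega : n < M) hM1
    (fun j τ h => ⟨ivar_fits (by omega) (by rw [h.size]; omega), h.size⟩)
    (fun k hk τ h h7 => ?_) ?_
  · refine (step_runs hY hk hM1 (by omega) (by omega) (by omega) h h7).imp
      fun τ' h' => ⟨h'.1, h'.2.congr rfl fun a ha => setInt_int_of_ne _ _ _ _ _ ha⟩
  · have i₁ : ∀ a, a ≠ 0 → a ≠ 2 → a ≠ 8 → a ≠ 9 → a ≠ 10 → a ≠ 11 → ∀ i, σ₁.int a i = 0 := by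
      intro a a0 a2 a8 a9 a10 a11 i
      rw [h₁, setInt_int_of_ne _ _ _ _ _ a10]
      exact h0 a a0 a2 a8 a9 a11 i
    have z : ∀ a, a = 1 ∨ a = 3 ∨ a = 4 → ∀ i, σ₁.int a i = 0 := fun a ha =>
      i₁ a (by omega) (by omega) (by omega) (by omega) (by omega) (by omega)
    have t : σ₁.int 10 0 = 1 := by simp [h₁]
    refine StepInv.congr (σ := σ₁) ⟨?_, z 1 (by omega), ?_, by rw [h₁]; rfl, by rw [h₁]; rfl,
      by omega, by omega, fun d => ?_, ?_, fun d _ => z 4 (by omega) d, ?_, ?_, ?_, ?_⟩ rfl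
      fun a ha => setInt_int_of_ne _ _ _ _ _ ha
    · rw [h₁, setInt_int_of_ne _ _ _ _ _ (by omega), hn]
    · rw [h₁, setInt_int_of_ne _ _ _ _ _ (by omega)]
    · rw [z 3 (by omega), t]; omega
    · rw [z 4 (by omega), t]; omega
    · intro u _ v _ hne
      exact absurd (z 3 (by omega) _) hne
    · intro S _ a b ha
      exact (Source.not_zero ha).elim
    · intro hne
      exact absurd (z 4 (by omega) _) hne
    · intro S _ r _ _ _ hr
      omega

theorem mark_runs (hM : M = machineSize n) (h : StepInv n ID X Y n σ) (hID : ∀ i < n, ID i < n) :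
    Runs M markStmt σ (8 + markConst * M) fun σ' =>
      (∀ i, σ'.int 1 i ≠ 1) ∧ σ.int 4 (n * n) = 0 ∨
      ∃ S, Admissible n Y S ∧ (∀ i, σ'.int 1 i = 1 ↔ ∃ s ∈ S, ID s = i) ∧
        σ.real 5 (n * n) = ∑ j ∈ Finset.range n, slab X Y S j := by
  have e : machineSize n = 8 * (n * n) + 16 * n + 8 := by unfold machineSize; ring
  have e' : n * (4 * n + 1) = 4 * (n * n) + n := by ring
  have hc := h.count
  have h4 := h.lt4
  have fN : vN.Fits M σ := ivar_fits (by omega) (by rw [h.size]; omega)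
  have eN : (IExp.mul vN vN).eval σ = n * n := by simp only [IExp.eval, h.size]
  have hset : Runs M (.setInt 8 (.lit 0) (.get 4 (.mul vN vN))) σ 8
      fun σ' => σ' = σ.setInt 8 0 (σ.int 4 (n * n)) := by
    refine Runs.setInt (by change 0 < M; omega) ⟨⟨fN, fN, ?_⟩, ?_⟩ ?_
    · simp only [IExp.eval, h.size]; omega
    · rw [eN]; omega
    · rw [IExp.eval, IExp.eval, eN]
  refine Runs.seq hset fun σ₁ h₁ => ?_
  have hout : ∀ i, σ₁.int 1 i = 0 := fun i => by
    rw [h₁, setInt_int_of_ne _ _ _ _ _ (by omega)]; exact h.out i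
  have frame : ∀ a, a ≠ 1 → a ≠ 8 → σ₁.int a = σ.int a := fun a _ h8 => by
    rw [h₁, setInt_int_of_ne _ _ _ _ _ h8]
  have hle : markConst * (σ.int 4 (n * n) + 1) ≤ markConst * M :=
    Nat.mul_le_mul_left _ (by omega)
  by_cases hp : σ.int 4 (n * n) = 0
  · have := mark_loop_runs (σ₀ := σ) (by omega : 1 < M) (p := 0) (C := ∅) .nil (by simp)
      (by omega) σ₁ frame (by rw [h₁]; simp [hp])
    rw [hp] at hle
    refine this.mono hle fun σ' h' => Or.inl ⟨fun i => ?_, hp⟩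
    have := h' i
    simp [hout] at this
    exact this
  · obtain ⟨S, hC, hA, hx⟩ := h.best hp
    have := mark_loop_runs (σ₀ := σ) (by omega : 1 < M) hC (fun i hi => by
      have hi' : i < n := hA.1 hi
      have := hID i hi'
      rw [h.id]
      omega) (by omega) σ₁ frame (by rw [h₁]; simp)
    refine this.mono hle fun σ' h' => Or.inr ⟨S, hA, fun i => ?_, hx⟩
    rw [h', h.id]
    simp [hout]

end RealRAM
end

/-! ### Optimality of the output and the asymptotic bounds -/

noncomputable section

set_option linter.unusedSimpArgs false

namespace RealRAM
open Sweep Set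

variable {M n k : ℕ} {σ : State} {X Y : ℕ → ℝ} {ID : ℕ → ℕ}

/-- A set of at most one point has no slab with elements on both sides. These are the sets that
`best_complete` leaves out. -/
theorem sum_slab_eq_zero {S : Set ℕ} (hS : S ⊆ Iio n)
    (h : ¬ ∃ r ∈ S, (∀ s ∈ S, s ≤ r) ∧ ∃ s ∈ S, s < r) :
    ∑ j ∈ Finset.range n, slab X Y S j = 0 := by
  refine Finset.sum_eq_zero fun j _ => slab_eq_zero ?_
  rcases S.eq_empty_or_nonempty with rfl | hne
  · simp
  · obtain ⟨r, hr, hmax⟩ := Set.exists_max_image S id ((finite_Iio n).subset hS) hne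
    have hall : ∀ s ∈ S, s = r := by
      intro s hs
      by_contra hsr
      exact h ⟨r, hr, hmax, s, hs, lt_of_le_of_ne (hmax s hs) hsr⟩
    rcases le_or_gt j r with hj | hj
    · exact Or.inl fun s hs => by rw [hall s hs]; exact hj
    · exact Or.inr fun s hs => by rw [hall s hs]; exact hj

/-- An admissible set of maximum area gives a solution of the geometric problem. -/
theorem isMaxAreaEmptyRCH_of_forall_le (hX : ∀ i j, i < j → j < n → X i < X j) {S : Set ℕ}
    (hS : Admissible n Y S)
    (hmax : ∀ T, Admissible n Y T → ∑ j ∈ Finset.range n, slab X Y T j ≤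
      max (∑ j ∈ Finset.range n, slab X Y S j) 0) :
    Rectilinear.IsMaxAreaEmptyRCH ((fun i => (X i, Y i)) '' Iio n)
      ((fun i => (X i, Y i)) '' S) := by
  have hempty : ∀ T ⊆ Iio n, Rectilinear.IsEmptyRCH ((fun i => (X i, Y i)) '' Iio n)
      ((fun i => (X i, Y i)) '' T) ↔ Admissible n Y T := by
    intro T hT
    simp only [Rectilinear.IsEmptyRCH, Admissible, hT, true_and, image_mono hT]
    rw [← disjoint_iff_inter_eq_empty, disjoint_right]
    simp only [mem_image, forall_exists_index, and_imp, forall_apply_eq_imp_iff₂, mem_Iio]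
    exact forall₂_congr fun p hp => not_congr (inner_iff hX hT hp)
  refine ⟨(hempty S hS.1).2 hS, fun S' hS' => ?_⟩
  obtain ⟨T, hT, rfl⟩ := subset_image_iff.1 hS'.1
  rw [areaRCH_eq hX hT, areaRCH_eq hX hS.1]
  have := hmax T ((hempty T hT).1 hS')
  -- `ENNReal.ofReal` truncates at `0`, so comparison with the positive part suffices.
  calc _ ≤ ENNReal.ofReal (max (∑ j ∈ Finset.range n, slab X Y S j) 0) :=
        ENNReal.ofReal_le_ofReal this
    _ = _ := by rw [ENNReal.ofReal_max]; simp

theorem program_runs (pt : Fin n → ℝ × ℝ) (hpt : Rectilinear.GeneralPosition pt) :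
    Runs (machineSize n) program (input pt) (timeConst * (n + 1) ^ 3) fun σ =>
      Rectilinear.IsMaxAreaEmptyRCH (range pt) (output pt σ) := by
  have e : machineSize n = 8 * (n * n) + 16 * n + 8 := by unfold machineSize; ring
  set σ₀ := input pt with hσ₀
  have x0 : ∀ i (h : i < n), σ₀.real 0 i = (pt ⟨i, h⟩).1 := fun i h => by simp [hσ₀, input, h]
  have y0 : ∀ i (h : i < n), σ₀.real 1 i = (pt ⟨i, h⟩).2 := fun i h => by simp [hσ₀, input, h]
  have hx : InjOn (σ₀.real 0) (Iio n) := by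
    intro i hi j hj h
    rw [x0 i hi, x0 j hj] at h
    exact congrArg Fin.val (hpt.1 h)
  have hy : InjOn (σ₀.real 1) (Iio n) := by
    intro i hi j hj h
    rw [y0 i hi, y0 j hj] at h
    exact congrArg Fin.val (hpt.2 h)
  have n0 : σ₀.int 0 0 = n := by simp [hσ₀, input]
  have hrun := Runs.seq (sort_runs (M := machineSize n) n0 (by omega) hx)
    (Q := fun σ => Rectilinear.IsMaxAreaEmptyRCH (range pt) (output pt σ))
    (T' := 3 + ((stepConst * (n + 1) ^ 2 + 12) * (n + 1) + (8 + markConst * machineSize n)))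
    (s' := .seq (.setInt 10 (.lit 0) (.lit 1)) (.seq (forLoop 7 vN stepStmt) markStmt))
    fun σ₁ h₁ => ?_
  · refine hrun.mono ?_ fun _ h => h
    unfold timeConst machineSize
    generalize countStmt.bound = A
    generalize storeStmt.bound = B
    generalize stepConst = C
    generalize markConst = D
    have hn1 : 1 ≤ n + 1 := by omega
    generalize n + 1 = m at hn1
    have h2 : m ≤ m ^ 3 := Nat.le_self_pow (by omega) m
    have h3 : m ^ 2 ≤ m ^ 3 := Nat.pow_le_pow_right hn1 (by omega)
    have h1 : 1 ≤ m ^ 3 := hn1.trans h2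
    have a1 := Nat.mul_le_mul_left A h3
    have a2 := Nat.mul_le_mul_left B h2
    have a3 := Nat.mul_le_mul_left D h3
    nlinarith
  · set rk := rankBelow (σ₀.real 0) n with hrk
    set X := σ₁.real 2 with hXdef
    set Y := σ₁.real 3 with hYdef
    have hX : ∀ i j, i < j → j < n → X i < X j := by
      intro i j hij hj
      obtain ⟨a, ha, rfl⟩ := exists_rankBelow_eq hx (hij.trans hj)
      obtain ⟨b, hb, rfl⟩ := exists_rankBelow_eq hx hj
      rw [hXdef, h₁.abscissa a ha, h₁.abscissa b hb]
      exact lt_of_rankBelow_lt hx ha hb hij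
    have hY : InjOn Y (Iio n) := by
      intro i hi j hj h
      obtain ⟨a, ha, rfl⟩ := exists_rankBelow_eq hx hi
      obtain ⟨b, hb, rfl⟩ := exists_rankBelow_eq hx hj
      rw [hYdef, h₁.ordinate a ha, h₁.ordinate b hb] at h
      rw [hy ha hb h]
    have hID : ∀ i < n, σ₁.int 2 i < n := by
      intro i hi
      obtain ⟨a, ha, rfl⟩ := exists_rankBelow_eq hx hi
      rw [h₁.id a ha]; exact ha
    have hpt' : ∀ i (h : i < n), (X (rk i), Y (rk i)) = pt ⟨i, h⟩ := by
      intro i hi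
      rw [hXdef, hYdef, h₁.abscissa i hi, h₁.ordinate i hi, x0 i hi, y0 i hi]
    have hrange : range pt = (fun i => (X i, Y i)) '' Iio n := by
      ext q
      constructor
      · rintro ⟨⟨i, hi⟩, rfl⟩
        exact ⟨rk i, rankBelow_lt hi, hpt' i hi⟩
      · rintro ⟨k, hk, rfl⟩
        obtain ⟨a, ha, rfl⟩ := exists_rankBelow_eq hx hk
        exact ⟨⟨a, ha⟩, (hpt' a ha).symm⟩
    have hout : ∀ σ : State, ∀ S ⊆ Iio n, (∀ i, σ.int 1 i = 1 ↔ ∃ s ∈ S, σ₁.int 2 s = i) →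
        output pt σ = (fun i => (X i, Y i)) '' S := by
      intro σ S hS hσ
      ext q
      simp only [output, mem_ofPred_eq, mem_image, hσ]
      constructor
      · rintro ⟨⟨i, hi⟩, rfl, s, hs, hsi⟩
        refine ⟨s, hs, ?_⟩
        obtain ⟨a, ha, rfl⟩ := exists_rankBelow_eq hx (hS hs)
        rw [h₁.id a ha] at hsi
        subst hsi
        exact hpt' a hi
      · rintro ⟨s, hs, rfl⟩
        obtain ⟨a, ha, rfl⟩ := exists_rankBelow_eq hx (hS hs)
        exact ⟨⟨a, ha⟩, (hpt' a ha).symm, _, hs, h₁.id a ha⟩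
    have i0 : ∀ a, a ≠ 0 → a ≠ 2 → a ≠ 8 → a ≠ 9 → a ≠ 11 → ∀ i, σ₁.int a i = 0 := by
      intro a a0 a2 a8 a9 a11 i
      rw [h₁.int a a2 a8 a9 a11]
      simp [hσ₀, input, a0]
    obtain ⟨σ₂, t, hE, ht, hI⟩ := dp_runs rfl
      (by rw [h₁.int 0 (by omega) (by omega) (by omega) (by omega), n0]) i0 hY
    obtain ⟨σ₃, t', hE', ht', h₃⟩ := mark_runs rfl hI hID
    cases hE with
    | seq e1 e2 =>
      refine ⟨σ₃, _, .seq e1 (.seq e2 hE'), by omega, ?_⟩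
      rw [hrange]
      rcases h₃ with ⟨g1, g2⟩ | ⟨S, hS, g1, g2⟩
      -- No candidate was recorded, so every admissible set has at most one point and area `0`; the
      -- empty set is then optimal.
      · rw [hout σ₃ ∅ (by simp) (by simpa using g1)]
        refine isMaxAreaEmptyRCH_of_forall_le hX ⟨by simp, fun p _ => ?_⟩ fun T hT => ?_
        · rintro ⟨⟨⟨s, hs, -⟩, -⟩, -⟩
          exact hs
        · refine le_trans (le_of_eq (sum_slab_eq_zero hT.1 ?_)) (le_max_right _ _)
          rintro ⟨r, hr, hmax, hlt⟩
          exact (hI.best_complete T hT r hr hmax hlt (hT.1 hr)).1 g2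
      · rw [hout σ₃ S hS.1 g1]
        refine isMaxAreaEmptyRCH_of_forall_le hX hS fun T hT => ?_
        by_cases h : ∃ r ∈ T, (∀ s ∈ T, s ≤ r) ∧ ∃ s ∈ T, s < r
        · obtain ⟨r, hr, hmax, hlt⟩ := h
          rw [← g2]
          exact (hI.best_complete T hT r hr hmax hlt (hT.1 hr)).2.trans (le_max_left _ _)
        · exact (sum_slab_eq_zero hT.1 h).le.trans (le_max_right _ _)

theorem isBigO_const_mul_succ_pow (c d : ℕ) :
    (fun n : ℕ => ((c * (n + 1) ^ d : ℕ) : ℝ)) =O[atTop] fun n : ℕ => (n : ℝ) ^ d := by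
  -- The constant comes from `n + 1 ≤ 2 * n` for `n ≥ 1`.
  refine IsBigO.of_bound (c * 2 ^ d) ?_
  filter_upwards [eventually_ge_atTop 1] with n hn
  have hn' : (1 : ℝ) ≤ n := by exact_mod_cast hn
  rw [Real.norm_of_nonneg (by positivity), Real.norm_of_nonneg (by positivity), mul_assoc,
    ← mul_pow]
  push_cast
  gcongr
  linarith

end RealRAM

end

theorem mainTheorem3 :
    ∃ (prog : RealRAM.Stmt) (time size : ℕ → ℕ),
      ((fun n => (time n : ℝ)) =O[atTop] fun n => (n : ℝ) ^ 3) ∧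
      ((fun n => (prog.space (size n) : ℝ)) =O[atTop] fun n => (n : ℝ) ^ 2) ∧
      ∀ (n : ℕ) (pt : Fin n → ℝ × ℝ), Rectilinear.GeneralPosition pt →
        n < size n ∧
        ∃ (σ : RealRAM.State) (t : ℕ),
          RealRAM.Exec (size n) prog (RealRAM.input pt) σ t ∧ t ≤ time n ∧
          Rectilinear.IsMaxAreaEmptyRCH (Set.range pt) (RealRAM.output pt σ) := by
  refine ⟨RealRAM.program, fun n => RealRAM.timeConst * (n + 1) ^ 3, RealRAM.machineSize,
    RealRAM.isBigO_const_mul_succ_pow _ 3, ?_, fun n pt hpt =>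
      ⟨?_, RealRAM.program_runs pt hpt⟩⟩
  · have h := RealRAM.isBigO_const_mul_succ_pow (2 * RealRAM.program.width * 8) 2
    refine h.congr_left fun n => ?_
    rw [RealRAM.Stmt.space, RealRAM.machineSize, ← mul_assoc]
  · unfold RealRAM.machineSize
    nlinarith
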